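/- Let $\mathbb K$ be a field. All gradings are upper $\mathbb Z$-gradings, and signs follow the Koszul rule. An $A_\infty$ structure on a graded vector space $V$ is a family of linear maps $m_k\colon V^{\otimes k}\to V$ of degree $2-k$, $k\ge 1$, with $$\sum_{r+s+t=i,\ s\ge 1}(-1)^{r+st}\,m_{r+1+t}\bigl(\mathrm{id}^{\otimes r}\otimes m_s\otimes \mathrm{id}^{\otimes t}\bigr)=0\qquad(i\ge 1);$$ it is minimal if $m_1=0$. An $A_\infty$ morphism $V\to W$ is a family of linear maps $f_k\colon V^{\otimes k}\to W$ of degree $1-k$, $k\ge 1$, with $$\sum_{r+s+t=i,\ s\ge1}(-1)^{r+st}f_{r+1+t}\bigl(\mathrm{id}^{\otimes r}\otimes m_s\otimes \mathrm{id}^{\otimes t}\bigr)=\sum_{i_1+\cdots+i_r=i}(-1)^{\sum_{\ell=1}^{r-1}\ell(i_{r-\ell}-1)}m_r\bigl(f_{i_1}\otimes\cdots\otimes f_{i_r}\bigr)\qquad(i\ge 1).$$ Let $A$ be a (not necessarily unital) differential graded algebra over $\mathbb K$, with differential $d$ of degree $1$ and cohomology $H$. Fix a sign $\kappa\in\{1,-1\}$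 and regard $A$ as an $A_\infty$ algebra with $m_1=\kappa d$, $m_2(a,b)=\kappa\,ab$ and $m_k=0$ for $k\ge 3$. (The usual choice is $\kappa=1$; $\kappa=-1$ corresponds, via $m_k=s^{-1}g_ks^{\otimes k}$, to the bar construction with $g_1(sa)=-s\,da$ and $g_2(sa\otimes sb)=-(-1)^{|a|}s(ab)$.) By an $A_\infty$ structure on $H$ quasi-isomorphic to $A$ we mean one for which there is an $A_\infty$ morphism $f\colon H\to A$ such that $f_1$ induces the identity of $H$ in cohomology, i.e. $f_1(h)$ is a cocycle representing $h$ for every $h\in H$. Let $n\ge 3$ and let $x_1,\dots,x_n\in H$ be homogeneous. A defining system for $x_1,\dots,x_n$ is a family of homogeneous elements $a_{ij}\in A$, for $0\le i<j\le n$ and $j-i\le n-1$, of degree $|a_{ij}|=|x_{i+1}|+\cdots+|x_j|-(j-i-1)$, such that $a_{i-1,i}$ is a cocycle representing $x_i$ and $d a_{ij}=\sum_{i<k<j}\overline{a}_{ik}a_{kj}$ for $2\le j-i\le n-1$, where $\overline a=(-1)^{|a|+1}a$. The Massey product $\langle x_1,\dots,x_n\rangle\subseteq H$ is the set of the classes $\bigl[\sum_{0<k<n}\overline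 a_{0k}a_{kn}\bigr]$ over all defining systems (empty if there is none). **Theorem.** Let $x\in\langle x_1,\dots,x_n\rangle$ with $n\ge 3$. (i) Suppose that $x_1\otimes x_2,\ x_2\otimes x_3,\ \dots,\ x_{n-1}\otimes x_n$ are linearly independent in $H\otimes H$ (for instance, that $x_1,\dots,x_n$ are linearly independent). Then there is a minimal $A_\infty$ structure on $H$, quasi-isomorphic to $A$, which recovers $x$, i.e. $\pm m_n(x_1,\dots,x_n)=x$. (ii) In general, for any minimal $A_\infty$ structure on $H$ quasi-isomorphic to $A$, $$-\kappa\,\varepsilon\, m_n(x_1,\dots,x_n)=x+\Gamma,\qquad \Gamma\in\sum_{j=1}^{n-1}\operatorname{Im}(m_j),\qquad \varepsilon=(-1)^{\sum_{j=1}^{n-1}(n-j)|x_j|}.$$ -/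

import Mathlib

open scoped TensorProduct

/-- The sequence `x 0, …, x (r-1), y, x (r+s), x (r+s+1), …`, in which the block
`x r, …, x (r+s-1)` of length `s` has been replaced by the single entry `y`. -/
def insertBlock {V : Type*} (r s : ℕ) (x : ℕ → V) (y : V) : ℕ → V :=
  fun j => if j < r then x j else if j = r then y else x (j - 1 + s)

/-- The value of
`∑_{r+s+t=i, s≥1} (-1)^(r+st) g_{r+1+t} (id^{⊗r} ⊗ m_s ⊗ id^{⊗t})` on `x 0 ⊗ ⋯ ⊗ x (i-1)`,
where `x j` has degree `p j` and `m_s` has degree `2 - s` (Koszul sign rule). -/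
def insertionSum {K V W : Type*} [Field K] [AddCommGroup V] [Module K V]
    [AddCommGroup W] [Module K W]
    (g : (k : ℕ) → MultilinearMap K (fun _ : Fin k => V) W)
    (m : (k : ℕ) → MultilinearMap K (fun _ : Fin k => V) V)
    (i : ℕ) (p : ℕ → ℤ) (x : ℕ → V) : W :=
  ∑ s ∈ Finset.Icc 1 i, ∑ r ∈ Finset.range (i - s + 1),
    Int.negOnePow ((r : ℤ) + s * ((i - s - r : ℕ) : ℤ)
        + (2 - (s : ℤ)) * ∑ l ∈ Finset.range r, p l) •
      g (r + 1 + (i - s - r)) (fun j => insertBlock r s x (m s (fun l => x (r + l))) j)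

/-- The value of `∑_{i_1+⋯+i_r=i} (-1)^(∑_q (r-q)(i_q-1)) m_r (f_{i_1} ⊗ ⋯ ⊗ f_{i_r})` on
`x 0 ⊗ ⋯ ⊗ x (i-1)`, where `x j` has degree `p j` and `f_k` has degree `1 - k`: by the Koszul
sign rule, `f_{i_q}` moves past all the entries lying in the blocks before the `q`-th one.
(Blocks are numbered from `0` below, so that `r - q` becomes `r - 1 - q`.) -/
def compositionSum {K V W : Type*} [Field K] [AddCommGroup V] [Module K V]
    [AddCommGroup W] [Module K W]
    (m : (k : ℕ) → MultilinearMap K (fun _ : Fin k => W) W)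
    (f : (k : ℕ) → MultilinearMap K (fun _ : Fin k => V) W)
    (i : ℕ) (p : ℕ → ℤ) (x : ℕ → V) : W :=
  ∑ c : Composition i,
    Int.negOnePow (∑ q : Fin c.length,
        (((c.length : ℤ) - 1 - q) * ((c.blocksFun q : ℤ) - 1)
          + (1 - (c.blocksFun q : ℤ)) * ∑ l ∈ Finset.range (c.sizeUpTo q), p l)) •
      m c.length (fun q => f (c.blocksFun q) (fun l => x (c.sizeUpTo q + l)))

/-- An `A∞` algebra structure on a graded vector space, given by its total space `V` and the
subspaces `gr p` of homogeneous elements: operations `m k` of degree `2 - k`, `k ≥ 1`, satisfying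
the Stasheff identities
`∑_{r+s+t=i, s≥1} (-1)^(r+st) m_{r+1+t} (id^{⊗r} ⊗ m_s ⊗ id^{⊗t}) = 0`, `i ≥ 1`.
There is no operation of arity `0`. -/
structure AInfStructure (K : Type*) [Field K] {V : Type*} [AddCommGroup V] [Module K V]
    (gr : ℤ → Submodule K V) where
  m : (k : ℕ) → MultilinearMap K (fun _ : Fin k => V) V
  m_zero : m 0 = 0
  m_mem : ∀ (k : ℕ) (p : Fin k → ℤ) (x : Fin k → V), 1 ≤ k → (∀ j, x j ∈ gr (p j)) →
    m k x ∈ gr ((∑ j, p j) + 2 - k)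
  stasheff : ∀ (i : ℕ) (p : ℕ → ℤ) (x : ℕ → V), 1 ≤ i → (∀ j, x j ∈ gr (p j)) →
    insertionSum m m i p x = 0

/-- An `A∞` structure is minimal if `m_1 = 0`. -/
def AInfStructure.IsMinimal {K : Type*} [Field K] {V : Type*} [AddCommGroup V] [Module K V]
    {gr : ℤ → Submodule K V} (S : AInfStructure K gr) : Prop :=
  S.m 1 = 0

/-- An `A∞` morphism: components `f k` of degree `1 - k`, `k ≥ 1`, such that for all `i ≥ 1`
`∑_{r+s+t=i, s≥1} (-1)^(r+st) f_{r+1+t} (id^{⊗r} ⊗ m_s ⊗ id^{⊗t})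
  = ∑_{i_1+⋯+i_r=i} (-1)^(∑_q (r-q)(i_q-1)) m_r (f_{i_1} ⊗ ⋯ ⊗ f_{i_r})`. -/
structure AInfHom {K : Type*} [Field K] {V W : Type*} [AddCommGroup V] [Module K V]
    [AddCommGroup W] [Module K W] {grV : ℤ → Submodule K V} {grW : ℤ → Submodule K W}
    (S : AInfStructure K grV) (T : AInfStructure K grW) where
  f : (k : ℕ) → MultilinearMap K (fun _ : Fin k => V) W
  f_zero : f 0 = 0
  f_mem : ∀ (k : ℕ) (p : Fin k → ℤ) (x : Fin k → V), 1 ≤ k → (∀ j, x j ∈ grV (p j)) →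
    f k x ∈ grW ((∑ j, p j) + 1 - k)
  map_eq : ∀ (i : ℕ) (p : ℕ → ℤ) (x : ℕ → V), 1 ≤ i → (∀ j, x j ∈ grV (p j)) →
    insertionSum f S.m i p x = compositionSum T.m f i p x

/-- A (not necessarily unital) differential graded algebra over `K`, with upper `ℤ`-grading and
differential of degree `1`, on the associative algebra `A`. -/
structure DGA (K : Type*) [Field K] (A : Type*) [NonUnitalRing A] [Module K A]
    [IsScalarTower K A A] [SMulCommClass K A A] where
  gr : ℤ → Submodule K A
  isInternal : DirectSum.IsInternal gr
  mul_mem : ∀ {p q : ℤ} {a b : A}, a ∈ gr p → b ∈ gr q → a * b ∈ gr (p + q)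
  d : A →ₗ[K] A
  d_mem : ∀ {p : ℤ} {a : A}, a ∈ gr p → d a ∈ gr (p + 1)
  d_d : ∀ a, d (d a) = 0
  leibniz : ∀ {p : ℤ} {a : A} (b : A), a ∈ gr p →
    d (a * b) = d a * b + Int.negOnePow p • (a * d b)

namespace DGA

variable {K : Type*} [Field K] {A : Type*} [NonUnitalRing A] [Module K A]
  [IsScalarTower K A A] [SMulCommClass K A A]

/-- The cocycles. -/
abbrev cocycles (D : DGA K A) : Submodule K A := LinearMap.ker D.d

/-- The (total) cohomology `H = ker d / im d`. -/
abbrev Cohomology (D : DGA K A) : Type _ :=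
  D.cocycles ⧸ (LinearMap.range D.d).submoduleOf D.cocycles

/-- The cohomology class of a cocycle. -/
abbrev cls (D : DGA K A) : D.cocycles →ₗ[K] D.Cohomology :=
  ((LinearMap.range D.d).submoduleOf D.cocycles).mkQ

/-- `a` is a cocycle which represents the class `h`. -/
def Represents (D : DGA K A) (a : A) (h : D.Cohomology) : Prop :=
  ∃ z : D.cocycles, (z : A) = a ∧ D.cls z = h

/-- The degree `p` part `H^p`: classes of cocycles of degree `p`. -/
def grH (D : DGA K A) (p : ℤ) : Submodule K D.Cohomology :=
  ((D.gr p).submoduleOf D.cocycles).map D.cls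

/-- The operations of a DGA as an `A∞` algebra: `m_1 = κ d`, `m_2(a, b) = κ a b`, and `m_k = 0`
otherwise. The usual choice is `κ = 1`; `κ = -1` corresponds, via
`m_k = s⁻¹ g_k s^{⊗k}`, to the bar construction with `g_1 (s a) = - s (d a)` and
`g_2 (s a ⊗ s b) = -(-1)^|a| s (a b)`. -/
def ops (D : DGA K A) (κ : ℤˣ) : (k : ℕ) → MultilinearMap K (fun _ : Fin k => A) A
  | 1 => MultilinearMap.ofSubsingleton K A A (0 : Fin 1) (κ • D.d)
  | 2 => LinearMap.uncurryLeft
      ((MultilinearMap.ofSubsingletonₗ K K A A (0 : Fin 1)).toLinearMap ∘ₗ (κ • LinearMap.mul K A))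
  | _ => 0

theorem ops_zero (D : DGA K A) (κ : ℤˣ) : D.ops κ 0 = 0 := rfl

theorem ops_one (D : DGA K A) (κ : ℤˣ) (v : Fin 1 → A) : D.ops κ 1 v = κ • D.d (v 0) := rfl

theorem ops_two (D : DGA K A) (κ : ℤˣ) (v : Fin 2 → A) : D.ops κ 2 v = κ • (v 0 * v 1) := rfl

theorem ops_ge_three (D : DGA K A) (κ : ℤˣ) (k : ℕ) (hk : 3 ≤ k) : D.ops κ k = 0 := by
  obtain ⟨k, rfl⟩ := Nat.exists_eq_add_of_le' hk
  rfl

theorem ops_mem (D : DGA K A) (κ : ℤˣ) (k : ℕ) (p : Fin k → ℤ) (x : Fin k → A)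
    (hx : ∀ j, x j ∈ D.gr (p j)) : D.ops κ k x ∈ D.gr ((∑ j, p j) + 2 - k) := by
  have key : ∀ {q : ℤ} {a : A}, a ∈ D.gr q → κ • a ∈ D.gr q := by
    intro q a ha
    rcases Int.units_eq_one_or κ with h | h <;> simp [h, ha]
  match k with
  | 0 => simp [ops_zero]
  | 1 =>
    rw [ops_one]
    convert key (D.d_mem (hx 0)) using 2
    simp; ring
  | 2 =>
    rw [ops_two]
    convert key (D.mul_mem (hx 0) (hx 1)) using 2
    simp [Fin.sum_univ_two]
  | k + 3 =>
    rw [ops_ge_three _ _ _ (by omega)]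
    exact Submodule.zero_mem _

theorem ops_stasheff (D : DGA K A) (κ : ℤˣ) (i : ℕ) (p : ℕ → ℤ) (x : ℕ → A) (hi : 1 ≤ i)
    (hx : ∀ j, x j ∈ D.gr (p j)) : insertionSum (D.ops κ) (D.ops κ) i p x = 0 := by
  by_cases h4 : 4 ≤ i
  · refine Finset.sum_eq_zero fun s hs => Finset.sum_eq_zero fun r hr => ?_
    rw [Finset.mem_Icc] at hs
    rw [Finset.mem_range] at hr
    by_cases h3 : 3 ≤ r + 1 + (i - s - r)
    · rw [ops_ge_three _ _ _ h3]; simp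
    · have : 3 ≤ s := by omega
      rw [ops_ge_three _ _ s this]
      have h0 : (D.ops κ (r + 1 + (i - s - r)))
          (fun j => insertBlock r s x ((0 : MultilinearMap K (fun _ : Fin s => A) A)
            (fun l => x (r + l))) j) = 0 := by
        refine MultilinearMap.map_coord_zero _ (⟨r, by omega⟩ : Fin _) ?_
        simp [insertBlock]
      rw [h0, smul_zero]
  · have hcases : i = 1 ∨ i = 2 ∨ i = 3 := by omega
    rcases hcases with rfl | rfl | rfl
    · simp [insertionSum, ops_one, insertBlock, D.d_d]
    · simp [insertionSum, insertBlock, Finset.sum_Icc_succ_top, Finset.sum_range_succ, ops_one, ops_two]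
      rw [D.leibniz _ (hx 0), Int.negOnePow_add]
      rcases Int.units_eq_one_or κ with h | h <;> simp [h] <;> abel
    · simp [insertionSum, insertBlock, Finset.sum_Icc_succ_top, Finset.sum_range_succ, ops_one, ops_two, ops_ge_three]
      rw [Int.negOnePow_even 2 (by decide)]
      rcases Int.units_eq_one_or κ with h | h <;> simp [h, mul_assoc]

/-- A DGA regarded as an `A∞` algebra. -/
def toAInf (D : DGA K A) (κ : ℤˣ) : AInfStructure K D.gr where
  m := D.ops κ
  m_zero := rfl
  m_mem k p x _ hx := D.ops_mem κ k p x hx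
  stasheff i p x hi hx := D.ops_stasheff κ i p x hi hx

/-- The sum of the degrees of the classes numbered `i, …, j - 1`. -/
def degSum {n : ℕ} (p : Fin n → ℤ) (i j : ℕ) : ℤ :=
  ∑ l ∈ Finset.univ.filter (fun l : Fin n => i ≤ (l : ℕ) ∧ (l : ℕ) < j), p l

/-- The degree of the element `a_{ij}` of a defining system for classes of degrees
`p 0, …, p (n-1)`. -/
def sysDeg {n : ℕ} (p : Fin n → ℤ) (i j : ℕ) : ℤ :=
  degSum p i j - ((j : ℤ) - i - 1)

/-- `∑_{i<k<j} ā_{ik} a_{kj}`, where `ā = (-1)^(|a|+1) a`. -/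
def sysSum {n : ℕ} (p : Fin n → ℤ) (a : ℕ → ℕ → A) (i j : ℕ) : A :=
  ∑ k ∈ Finset.Ioo i j, (Int.negOnePow (sysDeg p i k + 1) • a i k) * a k j

/-- `a = {a_{ij}}`, `0 ≤ i < j ≤ n`, `j - i ≤ n - 1`, is a defining system for the classes
`x 0, …, x (n-1)` of degrees `p 0, …, p (n-1)` (entries `a i j` for other `i, j` are irrelevant):
`a_{i,i+1}` is a cocycle representing the class `x i`, and `d a_{ij} = ∑_{i<k<j} ā_{ik} a_{kj}`
when `2 ≤ j - i ≤ n - 1`; all `a_{ij}` are homogeneous, of the degree that this forces. -/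
structure IsDefiningSystem (D : DGA K A) {n : ℕ} (p : Fin n → ℤ) (x : Fin n → D.Cohomology)
    (a : ℕ → ℕ → A) : Prop where
  mem : ∀ i j : ℕ, i < j → j ≤ n → j - i ≤ n - 1 → a i j ∈ D.gr (sysDeg p i j)
  represents : ∀ i : Fin n, D.Represents (a i (i + 1)) (x i)
  d_eq : ∀ i j : ℕ, j ≤ n → 2 ≤ j - i → j - i ≤ n - 1 → D.d (a i j) = sysSum p a i j

/-- The Massey product set `⟨x 0, …, x (n-1)⟩` of classes of degrees `p 0, …, p (n-1)`: the
classes `[∑_{0<k<n} ā_{0k} a_{kn}]` for all defining systems. It is empty when there is no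
defining system; a defining system exhibits, by restriction, zero as an element of each of the
lower products `⟨x i, …, x j⟩`, so the triviality of these is not a separate condition. -/
def masseyProduct (D : DGA K A) {n : ℕ} (p : Fin n → ℤ) (x : Fin n → D.Cohomology) :
    Set D.Cohomology :=
  {y | ∃ a : ℕ → ℕ → A, D.IsDefiningSystem p x a ∧ D.Represents (sysSum p a 0 n) y}

/-- An `A∞` structure `S` on `H` is quasi-isomorphic to the DGA (over the identity of `H`): there
is an `A∞` morphism `f` from `(H, S)` to the DGA whose first component induces the identity in
cohomology, i.e. `f_1 h` is a cocycle representing `h`, for each `h`. -/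
def QuasiIsoTo (D : DGA K A) (κ : ℤˣ) (S : AInfStructure K D.grH) : Prop :=
  ∃ F : AInfHom S (D.toAInf κ), ∀ h : D.Cohomology, D.Represents (F.f 1 (fun _ => h)) h

end DGA

/-!
The signed operations of an `A∞` structure on `H`, and the signed components of an `A∞` morphism to
`A`, are turned into linear maps `b : T H → H` and `f : T H → A` on the tensor algebra (`bar`).
There, the `A∞` relations say that the coderivation `δ` with corestriction `b` (`coDer`) has
square zero, and that the coalgebra morphism `F` with corestriction `f` (`coHom`) intertwines `δ`
and the differential `δ_A` of the bar construction of `A` (`diffA`); see `insertionSum_eq` and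
`compositionSum_eq`. Coalgebra maps are handled by means of the convolution product of maps on the
tensor algebra: `F` is the solution of `F = 1 + f ⋆ F`, and similarly for `δ`, so that identities
between such maps are proved by uniqueness of the solutions of recursions (`rec_unique`), and
depend on the corestrictions only.

Statement about arbitrary minimal structures (`minimalModel_eq_massey`). For a defining system
`a`, let `Φ` be the sum of the `a_{0,k₁} ⊗ a_{k₁,k₂} ⊗ ⋯ ⊗ a_{k_r,n}` over all subdivisions of
`[0, n]` into at least two intervals. All terms of `δ_A Φ` but the one of length one cancel by the
equations of the defining system, and up to sign what is left represents `x ∈ ⟨x₁, …, xₙ⟩`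
(`diffA_subdivisionSum`, `exists_diffA_eq`). Hence `F x` is a boundary in the bar construction of
`A`. Since `f₁` is a homotopy equivalence, `F` is an isomorphism on the first pages of the spectral
sequences of the length filtrations, and it reflects boundaries with control of leading terms
(`exists_primitive`, `exists_coDer_eq`): `x = δ z'` with `z' = ± x₁ ⊗ ⋯ ⊗ xₙ` plus shorter words.
Applying the projection to words of length one gives `x = ± b(x₁ ⊗ ⋯ ⊗ xₙ)` plus values of `b` on
shorter words.

Existence (`exists_minimalModel`). Fix a splitting of `A`, with `f₁ : H → A` a choice of
representatives, `π : A → H` the projection and `h` a homotopy. Kadeishvili's recursion `b = π U`,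
`f = f₁ - c h U + φ`, where `U` only involves shorter words, produces a minimal structure and a
quasi-isomorphism for any cocycle-valued `φ` (`exists_solution`, `solution_spec`). A defining system
for `x` may be changed so that `a_{i-1,i} = f₁(x_i)` (`exists_isDefiningSystem`). If the
`x_i ⊗ x_{i+1}` are linearly independent, then `φ` can be chosen such that `f` takes the values
`a_{ij}` on the words `x_{i+1} ⊗ ⋯ ⊗ x_j` (`exists_cocyclePart`), in which case `b` vanishes on these
words, and its value on `x₁ ⊗ ⋯ ⊗ xₙ` is the class given by the defining system, up to sign
(`solution_word`).
-/

/-! ### Words in the tensor algebra -/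

namespace BarConstruction

open TensorAlgebra (ι)

section Words

variable (K : Type*) {V W X : Type*} [Field K] [AddCommGroup V] [Module K V]
  [AddCommGroup W] [Module K W] [AddCommGroup X] [Module K X]

/-- The word `x a ⊗ x (a+1) ⊗ ⋯ ⊗ x (a+k-1)` of length `k`, as an element of the tensor algebra. -/
def word (x : ℕ → V) : ℕ → ℕ → TensorAlgebra K V
  | _, 0 => 1
  | a, k + 1 => ι K (x a) * word x (a + 1) k

@[simp] theorem word_zero (x : ℕ → V) (a : ℕ) : word K x a 0 = 1 := rfl

theorem word_succ (x : ℕ → V) (a k : ℕ) :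
    word K x a (k + 1) = ι K (x a) * word K x (a + 1) k := rfl

@[simp] theorem word_one (x : ℕ → V) (a : ℕ) : word K x a 1 = ι K (x a) := by
  simp [word_succ]

variable {K}

theorem word_congr {x y : ℕ → V} {a b k : ℕ} (h : ∀ j < k, x (a + j) = y (b + j)) :
    word K x a k = word K y b k := by
  induction k generalizing a b with
  | zero => rfl
  | succ k ih =>
    have h0 : x a = y b := h 0 (by omega)
    rw [word_succ, word_succ, h0, ih (a := a + 1) (b := b + 1) fun j hj => by
      simpa [add_assoc, add_comm 1 j] using h (j + 1) (by omega)]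

theorem word_add (x : ℕ → V) (a k l : ℕ) :
    word K x a (k + l) = word K x a k * word K x (a + k) l := by
  induction k generalizing a with
  | zero => simp
  | succ k ih =>
    rw [show k + 1 + l = (k + l) + 1 by ring, word_succ, word_succ, ih, mul_assoc,
      show a + 1 + k = a + (k + 1) by ring]

theorem tprod_eq_word (x : ℕ → V) (a k : ℕ) :
    TensorAlgebra.tprod K V k (fun j => x (a + j)) = word K x a k := by
  induction k generalizing a with
  | zero => simp [TensorAlgebra.tprod_apply]
  | succ k ih =>
    rw [word_succ, ← ih, TensorAlgebra.tprod_apply, TensorAlgebra.tprod_apply, List.ofFn_succ,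
      List.prod_cons]
    simp [add_assoc, add_comm 1]

variable (K) in
/-- The algebra homomorphism `v₁⋯vₙ ↦ φ(v₁)⋯φ(vₙ)` of tensor algebras. -/
noncomputable def tmap (φ : V →ₗ[K] W) : TensorAlgebra K V →ₐ[K] TensorAlgebra K W :=
  TensorAlgebra.lift K (ι K ∘ₗ φ)

theorem tmap_ι (φ : V →ₗ[K] W) (v : V) : tmap K φ (ι K v) = ι K (φ v) := by simp [tmap]

theorem tmap_word (φ : V →ₗ[K] W) (x : ℕ → V) (a k : ℕ) :
    tmap K φ (word K x a k) = word K (fun j => φ (x j)) a k := by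
  induction k generalizing a with
  | zero => simp
  | succ k ih => rw [word_succ, word_succ, map_mul, ih, tmap_ι]

/-- A word with one more letter in front. -/
theorem exists_word_cons (v : V) (x : ℕ → V) (k : ℕ) :
    ι K v * word K x 0 k = word K (fun j => Nat.casesOn j v x) 0 (k + 1) := by
  have h : word K x 0 k = word K (fun j => Nat.casesOn j v x) (0 + 1) k := by
    refine word_congr fun j _ => ?_
    simp [add_comm 1 j]
  rw [word_succ, h]
  rfl

theorem eq_top_of_ι_mul_mem (S : Submodule K (TensorAlgebra K V)) (h1 : 1 ∈ S)
    (h : ∀ v, ∀ t ∈ S, ι K v * t ∈ S) : S = ⊤ := by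
  have key : ∀ t : TensorAlgebra K V, ∀ u ∈ S, t * u ∈ S := by
    intro t
    induction t using TensorAlgebra.induction with
    | algebraMap r =>
      intro u hu
      rw [← Algebra.smul_def]
      exact S.smul_mem _ hu
    | ι v => exact h v
    | mul a b ha hb =>
      intro u hu
      rw [mul_assoc]
      exact ha _ (hb _ hu)
    | add a b ha hb =>
      intro u hu
      rw [add_mul]
      exact S.add_mem (ha _ hu) (hb _ hu)
  rw [eq_top_iff]
  intro t _
  simpa using key t 1 h1

/-- If the homogeneous elements span `V`, then the words in homogeneous letters span the tensor
algebra. -/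
theorem span_homogeneous_word {gr : ℤ → Submodule K V} (hgr : ⨆ p, gr p = ⊤) :
    Submodule.span K {t : TensorAlgebra K V | ∃ (p : ℕ → ℤ) (x : ℕ → V) (k : ℕ),
      (∀ j, x j ∈ gr (p j)) ∧ t = word K x 0 k} = ⊤ := by
  set S := Submodule.span K {t : TensorAlgebra K V | ∃ (p : ℕ → ℤ) (x : ℕ → V) (k : ℕ),
      (∀ j, x j ∈ gr (p j)) ∧ t = word K x 0 k}
  refine eq_top_of_ι_mul_mem S
    (Submodule.subset_span ⟨0, 0, 0, fun _ => Submodule.zero_mem _, rfl⟩) fun v t ht => ?_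
  induction ht using Submodule.span_induction with
  | zero => simp
  | add a b _ _ ha hb => rw [mul_add]; exact S.add_mem ha hb
  | smul c a _ ha => rw [mul_smul_comm]; exact S.smul_mem c ha
  | mem t ht =>
    obtain ⟨p, x, k, hx, rfl⟩ := ht
    have hv : v ∈ ⨆ p, gr p := hgr ▸ Submodule.mem_top
    induction hv using Submodule.iSup_induction' with
    | zero => simp
    | add a b _ _ ha hb => rw [map_add, add_mul]; exact S.add_mem ha hb
    | mem q v hv =>
      refine Submodule.subset_span ⟨fun j => Nat.casesOn j q p, fun j => Nat.casesOn j v x, k + 1,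
        ?_, exists_word_cons v x k⟩
      rintro (_ | j)
      exacts [hv, hx j]

theorem ext_homogeneous_word {gr : ℤ → Submodule K V} (hgr : ⨆ p, gr p = ⊤)
    {f g : TensorAlgebra K V →ₗ[K] X}
    (h : ∀ (p : ℕ → ℤ) (x : ℕ → V) (k : ℕ), (∀ j, x j ∈ gr (p j)) →
      f (word K x 0 k) = g (word K x 0 k)) : f = g := by
  refine LinearMap.ext_on (span_homogeneous_word hgr) ?_
  rintro _ ⟨p, x, k, hx, rfl⟩
  exact h p x k hx

theorem ext_word {f g : TensorAlgebra K V →ₗ[K] X}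
    (h : ∀ (x : ℕ → V) (k : ℕ), f (word K x 0 k) = g (word K x 0 k)) : f = g :=
  ext_homogeneous_word (gr := fun _ => ⊤) (by simp) fun _ x k _ => h x k

theorem ext_one_ι_mul {f g : TensorAlgebra K V →ₗ[K] X} (h1 : f 1 = g 1)
    (h : ∀ v t, f t = g t → f (ι K v * t) = g (ι K v * t)) : f = g := by
  have := eq_top_of_ι_mul_mem (LinearMap.eqLocus f g) h1 (fun v t ht => h v t ht)
  ext t
  exact (this ▸ Submodule.mem_top : t ∈ LinearMap.eqLocus f g)

/-- The linear map on the tensor algebra with the given values on words, length by length. -/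
noncomputable def ofMultilinear (g : (k : ℕ) → MultilinearMap K (fun _ : Fin k => V) X) :
    TensorAlgebra K V →ₗ[K] X :=
  DirectSum.toModule K ℕ X (fun k => PiTensorProduct.lift (g k)) ∘ₗ
    TensorAlgebra.toDirectSum.toLinearMap

theorem ofMultilinear_tprod (g : (k : ℕ) → MultilinearMap K (fun _ : Fin k => V) X) {k : ℕ}
    (v : Fin k → V) : ofMultilinear g (TensorAlgebra.tprod K V k v) = g k v := by
  rw [ofMultilinear, LinearMap.comp_apply, AlgHom.toLinearMap_apply,
    TensorAlgebra.toDirectSum_tensorPower_tprod, ← DirectSum.lof_eq_of K, DirectSum.toModule_lof,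
    PiTensorProduct.lift.tprod]

theorem ofMultilinear_word (g : (k : ℕ) → MultilinearMap K (fun _ : Fin k => V) X)
    (x : ℕ → V) (a k : ℕ) : ofMultilinear g (word K x a k) = g k (fun j => x (a + j)) := by
  rw [← tprod_eq_word, ofMultilinear_tprod]

end Words

section Letters

variable {K V : Type*} [Field K] [AddCommGroup V] [Module K V]

/-- The projection of the tensor algebra onto the words of length one. -/
noncomputable abbrev letter : TensorAlgebra K V →ₗ[K] V := TensorAlgebra.ιInv

/-- The projection of the tensor algebra onto the words of length zero. -/
noncomputable abbrev counit : TensorAlgebra K V →ₗ[K] K :=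
  TensorAlgebra.algebraMapInv.toLinearMap

theorem letter_ι (v : V) : letter (ι K v) = v := TensorAlgebra.ι_leftInverse v

@[simp] theorem letter_one : letter (1 : TensorAlgebra K V) = 0 := by
  let _ : Module Kᵐᵒᵖ V := Module.compHom _ ((RingHom.id K).fromOpposite mul_comm)
  have : IsCentralScalar K V := ⟨fun _ _ => rfl⟩
  change (TensorAlgebra.toTrivSqZeroExt (1 : TensorAlgebra K V)).snd = 0
  rw [map_one, TrivSqZeroExt.snd_one]

theorem letter_ι_mul_ι_mul (v w : V) (t : TensorAlgebra K V) :
    letter (ι K v * (ι K w * t)) = 0 := by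
  simp [letter, TensorAlgebra.ιInv, TensorAlgebra.toTrivSqZeroExt]

@[simp] theorem algebraMapInv_ι (v : V) : TensorAlgebra.algebraMapInv (ι K v) = (0 : K) := by
  simp [TensorAlgebra.algebraMapInv]

@[simp] theorem counit_ι_mul (v : V) (t : TensorAlgebra K V) : counit (ι K v * t) = 0 := by
  simp [counit, TensorAlgebra.algebraMapInv]

end Letters

/-! ### Deconcatenation and the convolution product -/

section Convolution

variable {K V W X R : Type*} [Field K] [AddCommGroup V] [Module K V]
  [AddCommGroup W] [Module K W] [AddCommGroup X] [Module K X]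

/-- One step in the recursive construction of deconcatenation: from `(t, Δ t)` to
`(v t, Δ (v t))`. -/
noncomputable def comulStep : V →ₗ[K] Module.End K (TensorAlgebra K V ×
    (TensorAlgebra K V ⊗[K] TensorAlgebra K V)) where
  toFun v := LinearMap.prod (LinearMap.mulLeft K (ι K v) ∘ₗ LinearMap.fst K _ _)
    (TensorProduct.mk K _ _ 1 ∘ₗ LinearMap.mulLeft K (ι K v) ∘ₗ LinearMap.fst K _ _
      + LinearMap.rTensor _ (LinearMap.mulLeft K (ι K v)) ∘ₗ LinearMap.snd K _ _)
  map_add' v w := by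
    ext <;> simp [add_mul, TensorProduct.add_tmul, TensorProduct.tmul_add]
  map_smul' c v := by
    ext <;> simp [TensorProduct.smul_tmul']

theorem comulStep_apply (v : V) (z : TensorAlgebra K V × (TensorAlgebra K V ⊗[K] TensorAlgebra K V)) :
    comulStep v z = (ι K v * z.1,
      1 ⊗ₜ (ι K v * z.1) + LinearMap.rTensor _ (LinearMap.mulLeft K (ι K v)) z.2) := rfl

/-- The deconcatenation coproduct `Δ(v₁⋯vₙ) = ∑ v₁⋯vᵢ ⊗ vᵢ₊₁⋯vₙ` of the tensor algebra. -/
noncomputable def comul : TensorAlgebra K V →ₗ[K] TensorAlgebra K V ⊗[K] TensorAlgebra K V where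
  toFun t := (TensorAlgebra.lift K comulStep t (1, 1 ⊗ₜ 1)).2
  map_add' := by simp
  map_smul' := by simp

theorem comul_one : comul (1 : TensorAlgebra K V) = 1 ⊗ₜ 1 := by simp [comul]

theorem comul_ι_mul (v : V) (t : TensorAlgebra K V) : comul (ι K v * t) =
    1 ⊗ₜ (ι K v * t) + LinearMap.rTensor _ (LinearMap.mulLeft K (ι K v)) (comul t) := by
  let φ : TensorAlgebra K V →ₗ[K] TensorAlgebra K V :=
    { toFun := fun t => (TensorAlgebra.lift K comulStep t (1, 1 ⊗ₜ 1)).1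
      map_add' := by simp
      map_smul' := by simp }
  have hφ : φ = LinearMap.id := by
    refine ext_one_ι_mul (by simp [φ]) fun v t ht => ?_
    simp only [φ, LinearMap.coe_mk, AddHom.coe_mk, LinearMap.id_apply] at ht
    simp [φ, comulStep_apply, ht]
  have h : (TensorAlgebra.lift K comulStep t (1, 1 ⊗ₜ 1)).1 = t := LinearMap.congr_fun hφ t
  simp [comul, comulStep_apply, h]

section NonUnital

variable [NonUnitalRing R] [Module K R] [IsScalarTower K R R] [SMulCommClass K R R]

/-- The convolution product of linear maps from the tensor algebra (with deconcatenation) to an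
algebra: `(f ⋆ g)(v₁⋯vₙ) = ∑ f(v₁⋯vᵢ) g(vᵢ₊₁⋯vₙ)`. -/
noncomputable def conv (f g : TensorAlgebra K V →ₗ[K] R) : TensorAlgebra K V →ₗ[K] R :=
  LinearMap.mul' K R ∘ₗ TensorProduct.map f g ∘ₗ comul

local notation:70 f:70 " ⋆ " g:71 => conv f g

theorem conv_one (f g : TensorAlgebra K V →ₗ[K] R) : (f ⋆ g) 1 = f 1 * g 1 := by
  simp [conv, comul_one]

theorem conv_ι_mul (f g : TensorAlgebra K V →ₗ[K] R) (v : V) (t : TensorAlgebra K V) :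
    (f ⋆ g) (ι K v * t) = f 1 * g (ι K v * t) + ((f ∘ₗ LinearMap.mulLeft K (ι K v)) ⋆ g) t := by
  simp only [conv, LinearMap.comp_apply, comul_ι_mul, map_add]
  congr 1
  generalize comul t = z
  induction z with
  | zero => simp
  | tmul a b => simp
  | add a b ha hb => simp only [map_add, ha, hb]

theorem add_conv (f f' g : TensorAlgebra K V →ₗ[K] R) : (f + f') ⋆ g = f ⋆ g + f' ⋆ g := by
  simp [conv, TensorProduct.map_add_left, LinearMap.comp_add, LinearMap.add_comp]

theorem conv_add (f g g' : TensorAlgebra K V →ₗ[K] R) : f ⋆ (g + g') = f ⋆ g + f ⋆ g' := by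
  simp [conv, TensorProduct.map_add_right, LinearMap.comp_add, LinearMap.add_comp]

theorem smul_conv (c : K) (f g : TensorAlgebra K V →ₗ[K] R) : (c • f) ⋆ g = c • (f ⋆ g) := by
  simp [conv, TensorProduct.map_smul_left, LinearMap.comp_smul, LinearMap.smul_comp]

theorem conv_smul (c : K) (f g : TensorAlgebra K V →ₗ[K] R) : f ⋆ (c • g) = c • (f ⋆ g) := by
  simp [conv, TensorProduct.map_smul_right, LinearMap.comp_smul, LinearMap.smul_comp]

theorem neg_conv (f g : TensorAlgebra K V →ₗ[K] R) : (-f) ⋆ g = -(f ⋆ g) := by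
  simpa using smul_conv (-1) f g

theorem conv_neg (f g : TensorAlgebra K V →ₗ[K] R) : f ⋆ (-g) = -(f ⋆ g) := by
  simpa using conv_smul (-1) f g

theorem sub_conv (f f' g : TensorAlgebra K V →ₗ[K] R) : (f - f') ⋆ g = f ⋆ g - f' ⋆ g := by
  rw [sub_eq_add_neg, add_conv, neg_conv, ← sub_eq_add_neg]

theorem conv_sub (f g g' : TensorAlgebra K V →ₗ[K] R) : f ⋆ (g - g') = f ⋆ g - f ⋆ g' := by
  rw [sub_eq_add_neg, conv_add, conv_neg, ← sub_eq_add_neg]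

theorem zero_conv (g : TensorAlgebra K V →ₗ[K] R) : 0 ⋆ g = 0 := by
  simpa using smul_conv 0 0 g

theorem conv_mulLeft (f g : TensorAlgebra K V →ₗ[K] R) (v : V) :
    (f ⋆ g) ∘ₗ LinearMap.mulLeft K (ι K v) = LinearMap.mulLeft K (f 1) ∘ₗ g ∘ₗ
      LinearMap.mulLeft K (ι K v) + (f ∘ₗ LinearMap.mulLeft K (ι K v)) ⋆ g := by
  ext t
  simp [conv_ι_mul]

theorem mulLeft_comp_conv (r : R) (f g : TensorAlgebra K V →ₗ[K] R) :
    (LinearMap.mulLeft K r ∘ₗ f) ⋆ g = LinearMap.mulLeft K r ∘ₗ (f ⋆ g) := by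
  ext t
  simp only [conv, LinearMap.comp_apply]
  generalize comul t = z
  induction z with
  | zero => simp
  | tmul a b => simp [mul_assoc]
  | add a b ha hb => simp only [map_add, ha, hb]

theorem conv_assoc (f g h : TensorAlgebra K V →ₗ[K] R) : f ⋆ g ⋆ h = f ⋆ (g ⋆ h) := by
  have key : ∀ t, ∀ f : TensorAlgebra K V →ₗ[K] R, (f ⋆ g ⋆ h) t = (f ⋆ (g ⋆ h)) t := by
    intro t
    have ht : t ∈ (⨅ f : TensorAlgebra K V →ₗ[K] R,
        LinearMap.eqLocus (f ⋆ g ⋆ h) (f ⋆ (g ⋆ h))) := by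
      rw [eq_top_of_ι_mul_mem (⨅ f : TensorAlgebra K V →ₗ[K] R,
        LinearMap.eqLocus (f ⋆ g ⋆ h) (f ⋆ (g ⋆ h)))]
      · trivial
      · simp [Submodule.mem_iInf, conv_one, mul_assoc]
      · intro v t ht
        simp only [Submodule.mem_iInf, LinearMap.mem_eqLocus] at ht ⊢
        intro f
        rw [conv_ι_mul, conv_ι_mul, conv_mulLeft, add_conv, LinearMap.add_apply, ht,
          mulLeft_comp_conv, conv_ι_mul g h, conv_one]
        simp [mul_add, mul_assoc, add_assoc]
    simpa [Submodule.mem_iInf] using (Submodule.mem_iInf _).1 ht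
  ext t
  exact key t f

theorem conv_word (f g : TensorAlgebra K V →ₗ[K] R) (x : ℕ → V) (a k : ℕ) :
    (f ⋆ g) (word K x a k) =
      ∑ s ∈ Finset.range (k + 1), f (word K x a s) * g (word K x (a + s) (k - s)) := by
  induction k generalizing a f with
  | zero => simp [conv_one]
  | succ k ih =>
    rw [word_succ, conv_ι_mul, ih, Finset.sum_range_succ' _ (k + 1), add_comm (f 1 * _)]
    have h0 : f (word K x a 0) * g (word K x (a + 0) (k + 1 - 0)) =
      f 1 * g (ι K (x a) * word K x (a + 1) k) := rfl
    rw [h0, add_left_inj]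
    refine Finset.sum_congr rfl fun s _ => ?_
    rw [LinearMap.comp_apply, LinearMap.mulLeft_apply, ← word_succ, Nat.add_sub_add_right,
      show a + 1 + s = a + (s + 1) by ring]

theorem comp_conv {R' : Type*} [NonUnitalRing R'] [Module K R'] [IsScalarTower K R' R']
    [SMulCommClass K R' R'] (φ : R →ₗ[K] R') (hφ : ∀ a b, φ (a * b) = φ a * φ b)
    (f g : TensorAlgebra K V →ₗ[K] R) : φ ∘ₗ conv f g = conv (φ ∘ₗ f) (φ ∘ₗ g) := by
  ext t
  simp only [conv, LinearMap.comp_apply]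
  generalize comul t = z
  induction z with
  | zero => simp
  | tmul a b => simp [hφ]
  | add a b ha hb => simp only [map_add, ha, hb]

end NonUnital

end Convolution

end BarConstruction

namespace BarConstruction

open TensorAlgebra (ι)

/-! ### Recursion along the word length -/

section Recursion

variable {K V W X R : Type*} [Field K] [AddCommGroup V] [Module K V]
  [AddCommGroup W] [Module K W] [AddCommGroup X] [Module K X]
  [NonUnitalRing R] [Module K R] [IsScalarTower K R R] [SMulCommClass K R R]

local notation:70 f:70 " ⋆ " g:71 => conv f g

/-- Two linear maps on the tensor algebra agree on all words of length less than `k`. -/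
def AgreeBelow (k : ℕ) (f g : TensorAlgebra K V →ₗ[K] X) : Prop :=
  ∀ (x : ℕ → V) (a j : ℕ), j < k → f (word K x a j) = g (word K x a j)

/-- The fixed point of an operator `Ψ` such that `Ψ f` is determined on words of length `k` by the
values of `f` on words of length less than `k`: on words of length `k` it is `Ψ^(k+1) 0`. -/
noncomputable def fixedPoint (Ψ : (TensorAlgebra K V →ₗ[K] X) → (TensorAlgebra K V →ₗ[K] X)) :
    TensorAlgebra K V →ₗ[K] X :=
  ofMultilinear fun k => (Ψ^[k + 1] 0).compMultilinearMap (TensorAlgebra.tprod K V k)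

theorem fixedPoint_word (Ψ : (TensorAlgebra K V →ₗ[K] X) → (TensorAlgebra K V →ₗ[K] X))
    (x : ℕ → V) (a k : ℕ) : fixedPoint Ψ (word K x a k) = Ψ^[k + 1] 0 (word K x a k) := by
  rw [fixedPoint, ofMultilinear_word, LinearMap.compMultilinearMap_apply, tprod_eq_word]

theorem fixedPoint_eq {Ψ : (TensorAlgebra K V →ₗ[K] X) → (TensorAlgebra K V →ₗ[K] X)}
    (hΨ : ∀ k f g, AgreeBelow k f g → AgreeBelow (k + 1) (Ψ f) (Ψ g)) :
    fixedPoint Ψ = Ψ (fixedPoint Ψ) := by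
  have h1 : ∀ m, AgreeBelow m (Ψ^[m] 0) (Ψ^[m + 1] 0) := by
    intro m
    induction m with
    | zero => exact fun x a j hj => absurd hj (Nat.not_lt_zero _)
    | succ m ih =>
      rw [Function.iterate_succ_apply', Function.iterate_succ_apply' _ (m + 1)]
      exact hΨ _ _ _ ih
  have h2 : ∀ m d, AgreeBelow m (Ψ^[m] 0) (Ψ^[m + d] 0) := by
    intro m d
    induction d with
    | zero => exact fun _ _ _ _ => rfl
    | succ d ih =>
      intro x a j hj
      rw [ih x a j hj]
      exact h1 (m + d) x a j (by omega)
  have h3 : ∀ k, AgreeBelow k (fixedPoint Ψ) (Ψ^[k] 0) := by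
    intro k x a j hj
    rw [fixedPoint_word, h2 (j + 1) (k - (j + 1)) x a j (by omega)]
    congr 3
    omega
  refine ext_word fun x k => ?_
  rw [h3 (k + 1) x 0 k (by omega), Function.iterate_succ_apply']
  exact (hΨ k _ _ (h3 k) x 0 k (by omega)).symm

theorem eq_of_fixed {Ψ : (TensorAlgebra K V →ₗ[K] X) → (TensorAlgebra K V →ₗ[K] X)}
    (hΨ : ∀ k f g, AgreeBelow k f g → AgreeBelow (k + 1) (Ψ f) (Ψ g))
    {f g : TensorAlgebra K V →ₗ[K] X} (hf : f = Ψ f) (hg : g = Ψ g) : f = g := by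
  have h : ∀ k, AgreeBelow k f g := by
    intro k
    induction k with
    | zero => exact fun x a j hj => absurd hj (Nat.not_lt_zero _)
    | succ k ih =>
      rw [hf, hg]
      exact hΨ k f g ih
  exact ext_word fun x k => h (k + 1) x 0 k (by omega)

theorem AgreeBelow.conv_left {k : ℕ} {a g g' : TensorAlgebra K V →ₗ[K] R} (ha : a 1 = 0)
    (h : AgreeBelow k g g') : AgreeBelow (k + 1) (a ⋆ g) (a ⋆ g') := by
  intro x i j hj
  rw [conv_word, conv_word]
  refine Finset.sum_congr rfl fun s _ => ?_
  rcases Nat.eq_zero_or_pos s with rfl | hs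
  · simp [ha]
  · by_cases hj0 : j = 0
    · subst hj0
      have : s = 0 := by simp_all
      omega
    · rw [h _ _ _ (by omega)]

theorem AgreeBelow.linear_recursion {c a : TensorAlgebra K V →ₗ[K] R} (ha : a 1 = 0) (k : ℕ)
    (f g : TensorAlgebra K V →ₗ[K] R) (h : AgreeBelow k f g) :
    AgreeBelow (k + 1) (c + a ⋆ f) (c + a ⋆ g) := by
  intro x i j hj
  rw [LinearMap.add_apply, LinearMap.add_apply, AgreeBelow.conv_left ha h x i j hj]

/-- The solution `Y` of the equation `Y = c + a ⋆ Y` (provided that `a 1 = 0`). -/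
noncomputable def recSol (c a : TensorAlgebra K V →ₗ[K] R) : TensorAlgebra K V →ₗ[K] R :=
  fixedPoint fun Y => c + a ⋆ Y

theorem recSol_eq {c a : TensorAlgebra K V →ₗ[K] R} (ha : a 1 = 0) :
    recSol c a = c + a ⋆ recSol c a :=
  fixedPoint_eq (AgreeBelow.linear_recursion ha)

theorem rec_unique {c a Y Z : TensorAlgebra K V →ₗ[K] R} (ha : a 1 = 0)
    (hY : Y = c + a ⋆ Y) (hZ : Z = c + a ⋆ Z) : Y = Z :=
  eq_of_fixed (AgreeBelow.linear_recursion ha) hY hZ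

/-! ### Units and letters under convolution -/

theorem letter_ι_mul (v : V) (t : TensorAlgebra K V) : letter (ι K v * t) = counit t • v := by
  have : letter ∘ₗ LinearMap.mulLeft K (ι K v) = counit.smulRight v := by
    refine ext_one_ι_mul (by simp [letter_ι]) fun w t _ => ?_
    simp [letter_ι_mul_ι_mul]
  exact LinearMap.congr_fun this t

theorem smulRight_counit_conv (r : R) (g : TensorAlgebra K V →ₗ[K] R) :
    (counit.smulRight r) ⋆ g = LinearMap.mulLeft K r ∘ₗ g := by
  refine ext_one_ι_mul (by simp [conv_one]) fun v t _ => ?_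
  rw [conv_ι_mul]
  have : (counit.smulRight r) ∘ₗ LinearMap.mulLeft K (ι K v) = 0 := by
    ext t
    simp
  simp [this, zero_conv]

theorem letter_conv_ι_mul (ρ : V →ₗ[K] R) (g : TensorAlgebra K V →ₗ[K] R) (v : V)
    (t : TensorAlgebra K V) : ((ρ ∘ₗ letter) ⋆ g) (ι K v * t) = ρ v * g t := by
  have h : (ρ ∘ₗ letter) ∘ₗ LinearMap.mulLeft K (ι K v) = counit.smulRight (ρ v) := by
    ext t
    simp [letter_ι_mul]
  rw [conv_ι_mul, h, smulRight_counit_conv]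
  simp

theorem letter_conv_one (ρ : V →ₗ[K] R) (g : TensorAlgebra K V →ₗ[K] R) :
    ((ρ ∘ₗ letter) ⋆ g) 1 = 0 := by
  simp [conv_one]

/-- The unit `v₁⋯vₙ ↦ 0` (`n ≥ 1`), `1 ↦ 1` of the convolution product. -/
noncomputable def convUnit (R : Type*) [Ring R] [Algebra K R] : TensorAlgebra K V →ₗ[K] R :=
  Algebra.linearMap K R ∘ₗ counit

section Unital

variable {R : Type*} [Ring R] [Algebra K R]

@[simp] theorem convUnit_one : convUnit R (1 : TensorAlgebra K V) = 1 := by simp [convUnit]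

@[simp] theorem convUnit_ι_mul (v : V) (t : TensorAlgebra K V) : convUnit R (ι K v * t) = 0 := by
  simp [convUnit]

theorem convUnit_conv (g : TensorAlgebra K V →ₗ[K] R) : convUnit R ⋆ g = g := by
  have : (convUnit R : TensorAlgebra K V →ₗ[K] R) = counit.smulRight 1 := by
    ext t
    simp [convUnit, Algebra.algebraMap_eq_smul_one]
  rw [this, smulRight_counit_conv]
  ext t
  simp

end Unital

theorem tmap_rec (φ : V →ₗ[K] W) : (tmap K φ).toLinearMap =
    convUnit _ + ((ι K ∘ₗ φ) ∘ₗ letter) ⋆ (tmap K φ).toLinearMap := by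
  refine ext_one_ι_mul ?_ fun v t _ => ?_
  · simp [letter_conv_one]
  · rw [LinearMap.add_apply, letter_conv_ι_mul]
    simp [tmap_ι]

theorem id_rec : (LinearMap.id : TensorAlgebra K V →ₗ[K] TensorAlgebra K V) =
    convUnit _ + (ι K ∘ₗ letter) ⋆ LinearMap.id := by
  refine ext_one_ι_mul ?_ fun v t _ => ?_
  · simp [letter_conv_one]
  · rw [LinearMap.add_apply, letter_conv_ι_mul]
    simp

theorem letter_comp_tmap (φ : V →ₗ[K] W) :
    letter ∘ₗ (tmap K φ).toLinearMap = φ ∘ₗ letter := by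
  refine ext_one_ι_mul (by simp) fun v t _ => ?_
  have h : counit (tmap K φ t) = counit t := by
    have : counit ∘ₗ (tmap K φ).toLinearMap = counit := by
      refine ext_one_ι_mul (by simp) fun v t _ => ?_
      have h1 : tmap K φ (ι K v * t) = ι K (φ v) * tmap K φ t := by rw [map_mul, tmap_ι]
      change counit (tmap K φ (ι K v * t)) = _
      rw [h1, counit_ι_mul, counit_ι_mul]
    exact LinearMap.congr_fun this t
  rw [LinearMap.comp_apply, LinearMap.comp_apply, AlgHom.toLinearMap_apply, map_mul, tmap_ι,
    letter_ι_mul, letter_ι_mul, h, map_smul]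

theorem counit_comp_ι_conv (w : TensorAlgebra K V →ₗ[K] W)
    (g : TensorAlgebra K V →ₗ[K] TensorAlgebra K W) : counit ∘ₗ ((ι K ∘ₗ w) ⋆ g) = 0 := by
  refine ext_word fun x k => ?_
  simp [conv_word]

theorem letter_comp_ι_conv (w : TensorAlgebra K V →ₗ[K] W)
    {g : TensorAlgebra K V →ₗ[K] TensorAlgebra K W} (hg : counit ∘ₗ g = counit) :
    letter ∘ₗ ((ι K ∘ₗ w) ⋆ g) = w := by
  refine ext_word fun x k => ?_
  have h : ∀ t, counit (g t) = counit t := LinearMap.congr_fun hg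
  rw [LinearMap.comp_apply, conv_word, map_sum, Finset.sum_range_succ, Finset.sum_eq_zero]
  · simp [letter_ι_mul, h]
  · intro s hs
    obtain ⟨m, hm⟩ : ∃ m, k - s = m + 1 := ⟨k - s - 1, by simp at hs; omega⟩
    rw [LinearMap.comp_apply, letter_ι_mul, h, hm, word_succ, counit_ι_mul, zero_smul]

theorem letter_comp_ι_conv_zero (w : TensorAlgebra K V →ₗ[K] W)
    {g : TensorAlgebra K V →ₗ[K] TensorAlgebra K W} (hg : counit ∘ₗ g = 0) :
    letter ∘ₗ ((ι K ∘ₗ w) ⋆ g) = 0 := by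
  refine ext_word fun x k => ?_
  have h : ∀ t, counit (g t) = 0 := LinearMap.congr_fun hg
  rw [LinearMap.comp_apply, conv_word, map_sum]
  exact Finset.sum_eq_zero fun s _ => by
    rw [LinearMap.comp_apply, letter_ι_mul, h, zero_smul]

/-- If `E = e ⋆ G + a ⋆ E` with `e` and `a` taking values in letters, then on the words of the
smallest length on which `e` does not vanish (and on shorter ones) `E` is `e`. -/
theorem eq_on_leading_words {e a : TensorAlgebra K V →ₗ[K] W}
    {E G : TensorAlgebra K V →ₗ[K] TensorAlgebra K W} (ha : a 1 = 0) (hG : G 1 = 1)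
    (hE : E = (ι K ∘ₗ e) ⋆ G + (ι K ∘ₗ a) ⋆ E) {k : ℕ} (he : AgreeBelow k e 0)
    (x : ℕ → V) (i j : ℕ) (hj : j ≤ k) : E (word K x i j) = ι K (e (word K x i j)) := by
  induction j using Nat.strong_induction_on generalizing i with
  | _ j ih =>
    rw [hE, LinearMap.add_apply, conv_word, conv_word, Finset.sum_range_succ,
      Finset.sum_eq_zero, Finset.sum_eq_zero]
    · simp [hG]
    · intro s hs
      rw [Finset.mem_range] at hs
      rcases Nat.eq_zero_or_pos s with rfl | hs0
      · simp [ha]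
      · rw [← hE] at *
        by_cases hj0 : j = 0
        · omega
        rw [ih (j - s) (by omega) _ (by omega), he _ _ _ (by omega)]
        simp
    · intro s hs
      rw [Finset.mem_range] at hs
      rw [LinearMap.comp_apply, he _ _ _ (by omega)]
      simp

/-! ### Coalgebra morphisms and coderivations -/

/-- The coalgebra morphism `F = ∑ f ⊗ ⋯ ⊗ f` of tensor coalgebras with the given
corestriction `f`. -/
noncomputable def coHom (f : TensorAlgebra K V →ₗ[K] W) :
    TensorAlgebra K V →ₗ[K] TensorAlgebra K W :=
  recSol (convUnit _) (ι K ∘ₗ f)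

/-- The coderivation `δ = ∑ σ ⊗ ⋯ ⊗ σ ⊗ b ⊗ id ⊗ ⋯ ⊗ id` with the given corestriction `b`. Here
`σ` is the sign that the Koszul rule attaches to moving `b` past a letter. -/
noncomputable def coDer (σ : V →ₗ[K] V) (b : TensorAlgebra K V →ₗ[K] V) :
    TensorAlgebra K V →ₗ[K] TensorAlgebra K V :=
  recSol ((ι K ∘ₗ b) ⋆ LinearMap.id) (ι K ∘ₗ σ ∘ₗ letter)

theorem coHom_eq {f : TensorAlgebra K V →ₗ[K] W} (hf : f 1 = 0) :
    coHom f = convUnit _ + (ι K ∘ₗ f) ⋆ coHom f :=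
  recSol_eq (by simp [hf])

theorem coDer_eq (σ : V →ₗ[K] V) (b : TensorAlgebra K V →ₗ[K] V) :
    coDer σ b = (ι K ∘ₗ b) ⋆ LinearMap.id + (ι K ∘ₗ σ ∘ₗ letter) ⋆ coDer σ b :=
  recSol_eq (by simp)

theorem coHom_one {f : TensorAlgebra K V →ₗ[K] W} (hf : f 1 = 0) : coHom f 1 = 1 := by
  rw [coHom_eq hf]
  simp [conv_one, hf]

theorem coDer_ι_mul (σ : V →ₗ[K] V) (b : TensorAlgebra K V →ₗ[K] V) (v : V)
    (t : TensorAlgebra K V) : coDer σ b (ι K v * t) =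
      ((ι K ∘ₗ b) ⋆ LinearMap.id) (ι K v * t) + ι K (σ v) * coDer σ b t := by
  conv_lhs => rw [coDer_eq]
  rw [LinearMap.add_apply, ← LinearMap.comp_assoc, letter_conv_ι_mul]
  rfl

theorem counit_comp_coHom {f : TensorAlgebra K V →ₗ[K] W} (hf : f 1 = 0) :
    counit ∘ₗ coHom f = counit := by
  rw [coHom_eq hf, LinearMap.comp_add, counit_comp_ι_conv]
  refine ext_one_ι_mul (by simp) fun v t _ => by simp

theorem letter_comp_coHom {f : TensorAlgebra K V →ₗ[K] W} (hf : f 1 = 0) :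
    letter ∘ₗ coHom f = f := by
  rw [coHom_eq hf, LinearMap.comp_add, letter_comp_ι_conv _ (counit_comp_coHom hf)]
  have : letter ∘ₗ (convUnit (TensorAlgebra K W) : TensorAlgebra K V →ₗ[K] _) = 0 :=
    ext_one_ι_mul (by simp) fun v t _ => by simp
  rw [this, zero_add]

theorem counit_comp_coDer (σ : V →ₗ[K] V) (b : TensorAlgebra K V →ₗ[K] V) :
    counit ∘ₗ coDer σ b = 0 := by
  rw [coDer_eq, LinearMap.comp_add, counit_comp_ι_conv, counit_comp_ι_conv, zero_add]

theorem letter_comp_coDer (σ : V →ₗ[K] V) (b : TensorAlgebra K V →ₗ[K] V) :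
    letter ∘ₗ coDer σ b = b := by
  rw [coDer_eq, LinearMap.comp_add, letter_comp_ι_conv _ (by rfl),
    letter_comp_ι_conv_zero _ (counit_comp_coDer σ b), add_zero]

theorem coDer_one (σ : V →ₗ[K] V) {b : TensorAlgebra K V →ₗ[K] V} (hb : b 1 = 0) :
    coDer σ b 1 = 0 := by
  rw [coDer_eq]
  simp [conv_one, hb]

theorem coDer_ι (σ : V →ₗ[K] V) {b : TensorAlgebra K V →ₗ[K] V} (hb : b 1 = 0) (v : V) :
    coDer σ b (ι K v) = ι K (b (ι K v)) := by
  have := coDer_ι_mul σ b v 1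
  rw [mul_one, coDer_one _ hb, mul_zero, add_zero, ← word_one K (fun _ => v) 0, conv_word] at this
  rw [← word_one K (fun _ => v) 0, this]
  simp [Finset.sum_range_succ, hb]

theorem coDer_add (σ : V →ₗ[K] V) (b b' : TensorAlgebra K V →ₗ[K] V) :
    coDer σ (b + b') = coDer σ b + coDer σ b' := by
  refine rec_unique (c := (ι K ∘ₗ (b + b')) ⋆ LinearMap.id) (a := ι K ∘ₗ σ ∘ₗ letter) (by simp)
    (coDer_eq _ _) ?_
  conv_lhs => rw [coDer_eq, coDer_eq σ b']
  rw [LinearMap.comp_add, add_conv, conv_add]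
  abel

theorem coDer_sub (σ : V →ₗ[K] V) (b b' : TensorAlgebra K V →ₗ[K] V) :
    coDer σ (b - b') = coDer σ b - coDer σ b' := by
  rw [eq_sub_iff_add_eq, ← coDer_add, sub_add_cancel]

theorem coHom_unique {f : TensorAlgebra K V →ₗ[K] W} (hf : f 1 = 0)
    {F : TensorAlgebra K V →ₗ[K] TensorAlgebra K W}
    (hF : F = convUnit _ + (ι K ∘ₗ f) ⋆ F) : coHom f = F :=
  rec_unique (by simp [hf]) (coHom_eq hf) hF

theorem coHom_comp_letter (φ : V →ₗ[K] W) : coHom (φ ∘ₗ letter) = (tmap K φ).toLinearMap :=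
  coHom_unique (by simp) (tmap_rec φ)

/-! ### Compatibility with deconcatenation -/

section Comul

/-- The inclusion `t ↦ t ⊗ 1`. -/
noncomputable abbrev inl : TensorAlgebra K W →ₐ[K] TensorAlgebra K W ⊗[K] TensorAlgebra K W :=
  Algebra.TensorProduct.includeLeft

/-- The inclusion `t ↦ 1 ⊗ t`. -/
noncomputable abbrev inr : TensorAlgebra K W →ₐ[K] TensorAlgebra K W ⊗[K] TensorAlgebra K W :=
  Algebra.TensorProduct.includeRight

theorem map_comp_comul (f g : TensorAlgebra K V →ₗ[K] TensorAlgebra K W) :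
    TensorProduct.map f g ∘ₗ comul =
      (inl.toLinearMap ∘ₗ f) ⋆ (inr.toLinearMap ∘ₗ g) := by
  ext t
  simp only [conv, LinearMap.comp_apply]
  generalize comul t = z
  induction z with
  | zero => simp
  | tmul a b => simp
  | add a b ha hb => simp only [map_add, ha, hb]

theorem comul_comp_ι_conv (w : TensorAlgebra K V →ₗ[K] W)
    (g : TensorAlgebra K V →ₗ[K] TensorAlgebra K W) :
    comul ∘ₗ ((ι K ∘ₗ w) ⋆ g) = inr.toLinearMap ∘ₗ ((ι K ∘ₗ w) ⋆ g) +
      (inl.toLinearMap ∘ₗ ι K ∘ₗ w) ⋆ (comul ∘ₗ g) := by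
  have hl : ∀ (u : TensorAlgebra K W) (z : TensorAlgebra K W ⊗[K] TensorAlgebra K W),
      LinearMap.rTensor _ (LinearMap.mulLeft K u) z = (u ⊗ₜ 1) * z := by
    intro u z
    induction z with
    | zero => simp
    | tmul a b => simp
    | add a b ha hb => simp only [map_add, ha, hb, mul_add]
  ext t
  simp only [conv, LinearMap.comp_apply, LinearMap.add_apply]
  generalize comul t = z
  induction z with
  | zero => simp
  | tmul a b => simp [comul_ι_mul, hl]
  | add a b ha hb =>
    simp only [map_add, ha, hb]
    abel

theorem inl_comp_conv (f g : TensorAlgebra K V →ₗ[K] TensorAlgebra K W) :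
    inl.toLinearMap ∘ₗ (f ⋆ g) = (inl.toLinearMap ∘ₗ f) ⋆ (inl.toLinearMap ∘ₗ g) :=
  comp_conv _ (fun a b => map_mul inl a b) f g

theorem inl_comp_convUnit : inl.toLinearMap ∘ₗ (convUnit _ : TensorAlgebra K V →ₗ[K] _) =
    convUnit (TensorAlgebra K W ⊗[K] TensorAlgebra K W) := by
  refine ext_one_ι_mul ?_ fun v t _ => by simp
  simp [Algebra.TensorProduct.one_def]

theorem inr_comp_convUnit : inr.toLinearMap ∘ₗ (convUnit _ : TensorAlgebra K V →ₗ[K] _) =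
    convUnit (TensorAlgebra K W ⊗[K] TensorAlgebra K W) := by
  refine ext_one_ι_mul ?_ fun v t _ => by simp
  simp [Algebra.TensorProduct.one_def]

theorem comul_comp_convUnit : comul ∘ₗ (convUnit _ : TensorAlgebra K V →ₗ[K] TensorAlgebra K W) =
    convUnit (TensorAlgebra K W ⊗[K] TensorAlgebra K W) := by
  refine ext_one_ι_mul ?_ fun v t _ => by simp
  simp [comul_one, Algebra.TensorProduct.one_def]

theorem comul_comp_coHom {f : TensorAlgebra K V →ₗ[K] W} (hf : f 1 = 0) :
    comul ∘ₗ coHom f = TensorProduct.map (coHom f) (coHom f) ∘ₗ comul := by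
  refine rec_unique (c := inr.toLinearMap ∘ₗ coHom f) (a := inl.toLinearMap ∘ₗ ι K ∘ₗ f)
    (by simp [hf]) ?_ ?_
  · conv_lhs => rw [coHom_eq hf]
    rw [LinearMap.comp_add, comul_comp_ι_conv, comul_comp_convUnit, ← inr_comp_convUnit,
      ← add_assoc, ← LinearMap.comp_add, ← coHom_eq hf]
  · rw [map_comp_comul]
    conv_lhs => rw [coHom_eq hf, LinearMap.comp_add, inl_comp_conv, inl_comp_convUnit, add_conv,
      convUnit_conv, conv_assoc, ← coHom_eq hf]

theorem comul_comp_coDer (σ : V →ₗ[K] V) (b : TensorAlgebra K V →ₗ[K] V) :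
    comul ∘ₗ coDer σ b = TensorProduct.map (coDer σ b) LinearMap.id ∘ₗ comul +
      TensorProduct.map (tmap K σ).toLinearMap (coDer σ b) ∘ₗ comul := by
  have hid : (comul : TensorAlgebra K V →ₗ[K] _) =
      (inl.toLinearMap ∘ₗ LinearMap.id) ⋆ (inr.toLinearMap ∘ₗ LinearMap.id) := by
    rw [← map_comp_comul, TensorProduct.map_id, LinearMap.id_comp]
  refine rec_unique (c := inr.toLinearMap ∘ₗ coDer σ b + (inl.toLinearMap ∘ₗ ι K ∘ₗ b) ⋆ comul)
    (a := inl.toLinearMap ∘ₗ ι K ∘ₗ σ ∘ₗ letter) (by simp) ?_ ?_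
  · have h : inr.toLinearMap ∘ₗ coDer σ b = inr.toLinearMap ∘ₗ ((ι K ∘ₗ b) ⋆ LinearMap.id) +
        inr.toLinearMap ∘ₗ ((ι K ∘ₗ σ ∘ₗ letter) ⋆ coDer σ b) := by
      rw [← LinearMap.comp_add, ← coDer_eq]
    rw [h]
    conv_lhs => rw [coDer_eq]
    rw [LinearMap.comp_add, comul_comp_ι_conv, comul_comp_ι_conv, LinearMap.comp_id]
    abel
  · rw [map_comp_comul, map_comp_comul]
    conv_lhs =>
      rw [coDer_eq, tmap_rec]
      rw [LinearMap.comp_add, inl_comp_conv, inl_comp_conv, LinearMap.comp_add,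
        inl_comp_conv, inl_comp_convUnit, add_conv, add_conv, convUnit_conv, conv_assoc,
        conv_assoc, conv_assoc, ← hid, ← coDer_eq]
    rw [conv_add]
    simp only [LinearMap.comp_assoc]
    abel

theorem conv_comp_coHom {f : TensorAlgebra K V →ₗ[K] W} (hf : f 1 = 0)
    (g k : TensorAlgebra K W →ₗ[K] R) :
    (g ⋆ k) ∘ₗ coHom f = (g ∘ₗ coHom f) ⋆ (k ∘ₗ coHom f) := by
  rw [conv, conv, LinearMap.comp_assoc, LinearMap.comp_assoc, comul_comp_coHom hf,
    TensorProduct.map_comp]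
  rfl

theorem conv_comp_coDer (σ : V →ₗ[K] V) (b : TensorAlgebra K V →ₗ[K] V)
    (g k : TensorAlgebra K V →ₗ[K] R) :
    (g ⋆ k) ∘ₗ coDer σ b = (g ∘ₗ coDer σ b) ⋆ k +
      (g ∘ₗ (tmap K σ).toLinearMap) ⋆ (k ∘ₗ coDer σ b) := by
  rw [conv, LinearMap.comp_assoc, LinearMap.comp_assoc, comul_comp_coDer]
  simp only [LinearMap.comp_add, ← LinearMap.comp_assoc, ← TensorProduct.map_comp,
    LinearMap.comp_id, conv]

theorem conv_comp_tmap (φ : V →ₗ[K] W) (g k : TensorAlgebra K W →ₗ[K] R) :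
    (g ⋆ k) ∘ₗ (tmap K φ).toLinearMap =
      (g ∘ₗ (tmap K φ).toLinearMap) ⋆ (k ∘ₗ (tmap K φ).toLinearMap) := by
  rw [← coHom_comp_letter]
  exact conv_comp_coHom (by simp) g k

/-- The failure of a coalgebra morphism `F` to commute with coderivations is determined by its
corestriction. -/
theorem coDer_comp_coHom_sub {σ : V →ₗ[K] V} {σ' : W →ₗ[K] W} (b : TensorAlgebra K V →ₗ[K] V)
    (b' : TensorAlgebra K W →ₗ[K] W) {f : TensorAlgebra K V →ₗ[K] W} (hf : f 1 = 0)
    (hσ : σ' ∘ₗ f = f ∘ₗ (tmap K σ).toLinearMap) :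
    coDer σ' b' ∘ₗ coHom f - coHom f ∘ₗ coDer σ b =
      (ι K ∘ₗ (b' ∘ₗ coHom f - f ∘ₗ coDer σ b)) ⋆ coHom f +
      (ι K ∘ₗ (f ∘ₗ (tmap K σ).toLinearMap)) ⋆
        (coDer σ' b' ∘ₗ coHom f - coHom f ∘ₗ coDer σ b) := by
  have h1 : coDer σ' b' ∘ₗ coHom f = (ι K ∘ₗ b' ∘ₗ coHom f) ⋆ coHom f +
      (ι K ∘ₗ f ∘ₗ (tmap K σ).toLinearMap) ⋆ (coDer σ' b' ∘ₗ coHom f) := by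
    conv_lhs => rw [coDer_eq]
    rw [LinearMap.add_comp, conv_comp_coHom hf, conv_comp_coHom hf, LinearMap.id_comp,
      LinearMap.comp_assoc, LinearMap.comp_assoc, LinearMap.comp_assoc, letter_comp_coHom hf, hσ]
  have h2 : coHom f ∘ₗ coDer σ b = (ι K ∘ₗ f ∘ₗ coDer σ b) ⋆ coHom f +
      (ι K ∘ₗ f ∘ₗ (tmap K σ).toLinearMap) ⋆ (coHom f ∘ₗ coDer σ b) := by
    conv_lhs => rw [coHom_eq hf]
    rw [LinearMap.add_comp, conv_comp_coDer, LinearMap.comp_assoc, LinearMap.comp_assoc, convUnit,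
      LinearMap.comp_assoc, counit_comp_coDer, LinearMap.comp_zero, zero_add]
  conv_lhs => rw [h1, h2]
  rw [LinearMap.comp_sub, sub_conv, conv_sub]
  abel

/-- The square of an odd coderivation is a coderivation, so it is determined by its
corestriction. -/
theorem coDer_comp_coDer {σ : V →ₗ[K] V} (hσ : σ ∘ₗ σ = LinearMap.id)
    {b : TensorAlgebra K V →ₗ[K] V} (hb : b ∘ₗ (tmap K σ).toLinearMap = -(σ ∘ₗ b)) :
    coDer σ b ∘ₗ coDer σ b = (ι K ∘ₗ (b ∘ₗ coDer σ b)) ⋆ LinearMap.id +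
      (ι K ∘ₗ letter) ⋆ (coDer σ b ∘ₗ coDer σ b) := by
  have h : coDer σ b ∘ₗ coDer σ b = ((ι K ∘ₗ b) ⋆ LinearMap.id) ∘ₗ coDer σ b +
      ((ι K ∘ₗ σ ∘ₗ letter) ⋆ coDer σ b) ∘ₗ coDer σ b := by
    rw [← LinearMap.add_comp, ← coDer_eq]
  conv_lhs => rw [h]
  rw [conv_comp_coDer, conv_comp_coDer]
  simp only [LinearMap.comp_assoc, LinearMap.id_comp]
  rw [hb, letter_comp_coDer, letter_comp_tmap, ← LinearMap.comp_assoc letter σ σ, hσ,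
    LinearMap.id_comp, LinearMap.comp_neg, neg_conv]
  abel

end Comul

end Recursion

end BarConstruction

namespace BarConstruction

open TensorAlgebra (ι)

/-! ### The word length filtration -/

section Filtration

variable {K V W X : Type*} [Field K] [AddCommGroup V] [Module K V]
  [AddCommGroup W] [Module K W] [AddCommGroup X] [Module K X]

local notation:70 f:70 " ⋆ " g:71 => conv f g

/-- The span of the words of length less than `k`. -/
def lenLT (K V : Type*) [Field K] [AddCommGroup V] [Module K V] (k : ℕ) :
    Submodule K (TensorAlgebra K V) :=
  Submodule.span K {t | ∃ (x : ℕ → V) (a j : ℕ), j < k ∧ t = word K x a j}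

theorem word_mem_lenLT (x : ℕ → V) (a : ℕ) {j k : ℕ} (h : j < k) : word K x a j ∈ lenLT K V k :=
  Submodule.subset_span ⟨x, a, j, h, rfl⟩

theorem lenLT_mono {k l : ℕ} (h : k ≤ l) : lenLT K V k ≤ lenLT K V l := by
  refine Submodule.span_mono ?_
  rintro _ ⟨x, a, j, hj, rfl⟩
  exact ⟨x, a, j, by omega, rfl⟩

theorem lenLT_zero : lenLT K V 0 = ⊥ := by
  rw [lenLT, Submodule.span_eq_bot]
  rintro _ ⟨x, a, j, hj, -⟩
  exact absurd hj (Nat.not_lt_zero _)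

/-- Induction over the words in a step of the length filtration. -/
theorem map_mem_of_mem_lenLT {φ : TensorAlgebra K V →ₗ[K] X} {S : Submodule K X} {k : ℕ}
    (h : ∀ x a j, j < k → φ (word K x a j) ∈ S) {t : TensorAlgebra K V} (ht : t ∈ lenLT K V k) :
    φ t ∈ S := by
  have : lenLT K V k ≤ S.comap φ := by
    rw [lenLT, Submodule.span_le]
    rintro _ ⟨x, a, j, hj, rfl⟩
    exact h x a j hj
  exact this ht

theorem AgreeBelow.eq_of_mem {f g : TensorAlgebra K V →ₗ[K] X} {k : ℕ} (h : AgreeBelow k f g)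
    {t : TensorAlgebra K V} (ht : t ∈ lenLT K V k) : f t = g t := by
  have := map_mem_of_mem_lenLT (φ := f - g) (S := ⊥) (k := k)
    (fun x a j hj => by simp [h x a j hj]) ht
  simpa [sub_eq_zero] using this

theorem ι_mul_mem_lenLT (v : V) {t : TensorAlgebra K V} {k : ℕ} (ht : t ∈ lenLT K V k) :
    ι K v * t ∈ lenLT K V (k + 1) := by
  refine map_mem_of_mem_lenLT (φ := LinearMap.mulLeft K (ι K v)) (fun x a j hj => ?_) ht
  have h : word K x a j = word K (fun i => x (a + i)) 0 j := word_congr fun i _ => by simp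
  rw [LinearMap.mulLeft_apply, h, exists_word_cons]
  exact word_mem_lenLT _ _ (by omega)

/-- A linear map of tensor algebras lowers the length of words by at least `e`. -/
def Lowers (e : ℕ) (φ : TensorAlgebra K V →ₗ[K] TensorAlgebra K W) : Prop :=
  ∀ (x : ℕ → V) (a k : ℕ), φ (word K x a k) ∈ lenLT K W (k + 1 - e)

theorem Lowers.mem {e : ℕ} {φ : TensorAlgebra K V →ₗ[K] TensorAlgebra K W} (h : Lowers e φ)
    {t : TensorAlgebra K V} {k : ℕ} (ht : t ∈ lenLT K V k) : φ t ∈ lenLT K W (k - e) :=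
  map_mem_of_mem_lenLT (fun x a j hj => lenLT_mono (by omega) (h x a j)) ht

/-- If `w` vanishes on words of length at most `e`, then `ι w ⋆ g` lowers the length by `e` when
`g` does not raise it. -/
theorem Lowers.ι_conv {e : ℕ} {w : TensorAlgebra K V →ₗ[K] W}
    {g : TensorAlgebra K V →ₗ[K] TensorAlgebra K W} (hw : AgreeBelow (e + 1) w 0)
    (hg : Lowers 0 g) : Lowers e ((ι K ∘ₗ w) ⋆ g) := by
  intro x a k
  rw [conv_word]
  refine Submodule.sum_mem _ fun s hs => ?_
  rw [Finset.mem_range] at hs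
  by_cases h : s < e + 1
  · simp [hw x a s h]
  · exact lenLT_mono (by omega) (ι_mul_mem_lenLT _ (hg x (a + s) (k - s)))

theorem Lowers.recursion {e : ℕ} {c E : TensorAlgebra K V →ₗ[K] TensorAlgebra K W}
    {w : TensorAlgebra K V →ₗ[K] W} (hw : w 1 = 0) (hc : Lowers e c)
    (hE : E = c + (ι K ∘ₗ w) ⋆ E) : Lowers e E := by
  intro x a k
  induction k using Nat.strong_induction_on generalizing a with
  | _ k ih =>
    rw [hE, LinearMap.add_apply, conv_word]
    refine Submodule.add_mem _ (hc x a k) (Submodule.sum_mem _ fun s hs => ?_)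
    rw [Finset.mem_range] at hs
    rcases Nat.eq_zero_or_pos s with rfl | hs0
    · simp [hw]
    have := ih (k - s) (by omega) (a + s)
    by_cases hse : k - s + 1 ≤ e
    · rw [Nat.sub_eq_zero_of_le hse, lenLT_zero, Submodule.mem_bot] at this
      rw [this, mul_zero]
      exact Submodule.zero_mem _
    · exact lenLT_mono (by omega) (ι_mul_mem_lenLT _ this)

theorem lowers_id : Lowers 0 (LinearMap.id : TensorAlgebra K V →ₗ[K] TensorAlgebra K V) :=
  fun x a k => word_mem_lenLT x a (by omega)

theorem lowers_convUnit : Lowers 0 (convUnit _ : TensorAlgebra K V →ₗ[K] TensorAlgebra K W) := by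
  intro x a k
  match k with
  | 0 =>
    rw [word_zero, convUnit_one]
    exact word_mem_lenLT (fun _ => 0) 0 (j := 0) (by omega)
  | k + 1 =>
    rw [word_succ, convUnit_ι_mul]
    exact Submodule.zero_mem _

theorem agreeBelow_one {w : TensorAlgebra K V →ₗ[K] W} (hw : w 1 = 0) : AgreeBelow 1 w 0 := by
  intro x a j hj
  obtain rfl : j = 0 := by omega
  simp [hw]

theorem agreeBelow_two {w : TensorAlgebra K V →ₗ[K] W} (hw : w 1 = 0)
    (hw1 : ∀ v, w (ι K v) = 0) : AgreeBelow 2 w 0 := by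
  intro x a j hj
  obtain rfl | rfl : j = 0 ∨ j = 1 := by omega
  · simp [hw]
  · simp [hw1]

theorem lowers_coHom {f : TensorAlgebra K V →ₗ[K] W} (hf : f 1 = 0) : Lowers 0 (coHom f) :=
  Lowers.recursion hf lowers_convUnit (coHom_eq hf)

theorem lowers_tmap (φ : V →ₗ[K] W) : Lowers 0 (tmap K φ).toLinearMap := by
  rw [← coHom_comp_letter]
  exact lowers_coHom (by simp)

theorem lowers_coDer {e : ℕ} (σ : V →ₗ[K] V) {b : TensorAlgebra K V →ₗ[K] V}
    (hb : AgreeBelow (e + 1) b 0) : Lowers e (coDer σ b) :=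
  Lowers.recursion (by simp) (Lowers.ι_conv hb lowers_id) (coDer_eq σ b)

/-- A coalgebra morphism agrees, up to shorter words, with its linear part. -/
theorem lowers_coHom_sub_tmap {f : TensorAlgebra K V →ₗ[K] W} {φ : V →ₗ[K] W} (hf : f 1 = 0)
    (hf1 : ∀ v, f (ι K v) = φ v) : Lowers 1 (coHom f - (tmap K φ).toLinearMap) := by
  have h : coHom f - (tmap K φ).toLinearMap = (ι K ∘ₗ (f - φ ∘ₗ letter)) ⋆ coHom f +
      (ι K ∘ₗ φ ∘ₗ letter) ⋆ (coHom f - (tmap K φ).toLinearMap) := by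
    conv_lhs => rw [coHom_eq hf, tmap_rec]
    rw [LinearMap.comp_sub, sub_conv, conv_sub, LinearMap.comp_assoc]
    abel
  refine Lowers.recursion (by simp) (Lowers.ι_conv (agreeBelow_two ?_ ?_) (lowers_coHom hf)) h
  · simp [hf]
  · simp [hf1, letter_ι]

end Filtration

/-! ### The tensor homotopy -/

section Homotopy

variable {K V : Type*} [Field K] [AddCommGroup V] [Module K V]

local notation:70 f:70 " ⋆ " g:71 => conv f g

theorem coDer_letter_comp_conv (σ d ρ : V →ₗ[K] V)
    (g : TensorAlgebra K V →ₗ[K] TensorAlgebra K V) :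
    coDer σ (d ∘ₗ letter) ∘ₗ ((ι K ∘ₗ ρ ∘ₗ letter) ⋆ g) =
      (ι K ∘ₗ (d ∘ₗ ρ) ∘ₗ letter) ⋆ g +
      (ι K ∘ₗ (σ ∘ₗ ρ) ∘ₗ letter) ⋆ (coDer σ (d ∘ₗ letter) ∘ₗ g) := by
  simp only [← LinearMap.comp_assoc _ _ (ι K)]
  refine ext_one_ι_mul ?_ fun v t _ => ?_
  · simp [conv_one]
  · simp only [LinearMap.comp_apply, LinearMap.add_apply]
    rw [letter_conv_ι_mul, letter_conv_ι_mul, letter_conv_ι_mul, LinearMap.comp_apply,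
      coDer_ι_mul, ← LinearMap.comp_assoc, letter_conv_ι_mul]
    simp

theorem conv_comp_coDer_letter (σ d ρ : V →ₗ[K] V)
    (g : TensorAlgebra K V →ₗ[K] TensorAlgebra K V) :
    ((ι K ∘ₗ ρ ∘ₗ letter) ⋆ g) ∘ₗ coDer σ (d ∘ₗ letter) =
      (ι K ∘ₗ (ρ ∘ₗ d) ∘ₗ letter) ⋆ g +
      (ι K ∘ₗ (ρ ∘ₗ σ) ∘ₗ letter) ⋆ (g ∘ₗ coDer σ (d ∘ₗ letter)) := by
  rw [conv_comp_coDer]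
  simp only [LinearMap.comp_assoc, letter_comp_coDer, letter_comp_tmap]

/-- The homotopy `∑ q ⊗ ⋯ ⊗ q ⊗ h ⊗ id ⊗ ⋯ ⊗ id` (with Koszul signs) on the tensor coalgebra that
is induced by a homotopy `h` from `q` to the identity. -/
noncomputable def tensorHomotopy (σ q h : V →ₗ[K] V) :
    TensorAlgebra K V →ₗ[K] TensorAlgebra K V :=
  recSol ((ι K ∘ₗ h ∘ₗ letter) ⋆ LinearMap.id) (ι K ∘ₗ (σ ∘ₗ q) ∘ₗ letter)

theorem tensorHomotopy_eq (σ q h : V →ₗ[K] V) : tensorHomotopy σ q h =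
    (ι K ∘ₗ h ∘ₗ letter) ⋆ LinearMap.id +
      (ι K ∘ₗ (σ ∘ₗ q) ∘ₗ letter) ⋆ tensorHomotopy σ q h :=
  recSol_eq (by simp)

theorem lowers_tensorHomotopy (σ q h : V →ₗ[K] V) : Lowers 0 (tensorHomotopy σ q h) :=
  Lowers.recursion (by simp) (Lowers.ι_conv (agreeBelow_one (by simp)) lowers_id)
    (tensorHomotopy_eq σ q h)

theorem tensorHomotopy_spec {σ q h d : V →ₗ[K] V} (hσ : σ ∘ₗ σ = LinearMap.id)
    (hdq : d ∘ₗ q = 0) (hqd : q ∘ₗ d = 0) (hhσ : h ∘ₗ σ = -(σ ∘ₗ h)) (hqσ : q ∘ₗ σ = σ ∘ₗ q)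
    (hd : d ∘ₗ h + h ∘ₗ d = LinearMap.id - q) :
    coDer σ (d ∘ₗ letter) ∘ₗ tensorHomotopy σ q h +
      tensorHomotopy σ q h ∘ₗ coDer σ (d ∘ₗ letter) =
      LinearMap.id - (tmap K q).toLinearMap := by
  set D := coDer σ (d ∘ₗ letter)
  set H := tensorHomotopy σ q h
  have e1 : σ ∘ₗ σ ∘ₗ q = q := by rw [← LinearMap.comp_assoc, hσ, LinearMap.id_comp]
  have e2 : (σ ∘ₗ q) ∘ₗ σ = q := by rw [LinearMap.comp_assoc, hqσ, e1]
  have h1 : D ∘ₗ H = (ι K ∘ₗ (d ∘ₗ h) ∘ₗ letter) ⋆ LinearMap.id +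
      (ι K ∘ₗ (σ ∘ₗ h) ∘ₗ letter) ⋆ D + (ι K ∘ₗ q ∘ₗ letter) ⋆ (D ∘ₗ H) := by
    conv_lhs => rw [show H = _ from tensorHomotopy_eq σ q h]
    rw [LinearMap.comp_add, coDer_letter_comp_conv, coDer_letter_comp_conv, ← hqσ,
      ← LinearMap.comp_assoc σ q d, hdq, hqσ, e1, LinearMap.zero_comp, LinearMap.zero_comp,
      LinearMap.comp_zero, zero_conv, zero_add, LinearMap.comp_id]
  have h2 : H ∘ₗ D = (ι K ∘ₗ (h ∘ₗ d) ∘ₗ letter) ⋆ LinearMap.id -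
      (ι K ∘ₗ (σ ∘ₗ h) ∘ₗ letter) ⋆ D + (ι K ∘ₗ q ∘ₗ letter) ⋆ (H ∘ₗ D) := by
    conv_lhs => rw [show H = _ from tensorHomotopy_eq σ q h]
    rw [LinearMap.add_comp, conv_comp_coDer_letter, conv_comp_coDer_letter, e2,
      LinearMap.comp_assoc d q σ, hqd, hhσ, LinearMap.comp_zero, LinearMap.zero_comp,
      LinearMap.comp_zero, zero_conv, zero_add, LinearMap.id_comp, LinearMap.neg_comp,
      LinearMap.comp_neg, neg_conv]
    abel
  refine rec_unique (c := (ι K ∘ₗ (d ∘ₗ h + h ∘ₗ d) ∘ₗ letter) ⋆ LinearMap.id)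
    (a := ι K ∘ₗ q ∘ₗ letter) (by simp) ?_ ?_
  · conv_lhs => rw [h1, h2]
    rw [LinearMap.add_comp, LinearMap.comp_add, add_conv, conv_add]
    abel
  · conv_lhs => rw [id_rec, tmap_rec]
    rw [hd, LinearMap.sub_comp, LinearMap.comp_sub, sub_conv, conv_sub, LinearMap.id_comp,
      LinearMap.comp_assoc]
    abel

end Homotopy

/-! ### Comparison of filtered complexes -/

section Comparison

variable {K M N : Type*} [Field K] [AddCommGroup M] [Module K M] [AddCommGroup N] [Module K N]

/-- A filtered chain map `F`, whose leading part `I` has a left inverse `P` that is a homotopy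
inverse of `I` for the leading part `D` of the differential `δ'`, is injective in cohomology,
compatibly with the filtration: a primitive `w` of `F z` gives a primitive `z'` of `z`, with the
leading part `P w`. -/
theorem exists_primitive {filM : ℕ → Submodule K M} {filN : ℕ → Submodule K N}
    {δ : M →ₗ[K] M} {δ' D H : N →ₗ[K] N} {F I : M →ₗ[K] N} {P : N →ₗ[K] M}
    (hM0 : filM 0 = ⊥) (hM : Monotone filM)
    (hδ : ∀ k, ∀ t ∈ filM k, δ t ∈ filM (k - 1))
    (hδD : ∀ k, ∀ t ∈ filN k, δ' t - D t ∈ filN (k - 1))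
    (hF0 : ∀ k, ∀ t ∈ filM k, F t ∈ filN k)
    (hFI : ∀ k, ∀ t ∈ filM k, F t - I t ∈ filN (k - 1))
    (hP : ∀ k, ∀ t ∈ filN k, P t ∈ filM k) (hH : ∀ k, ∀ t ∈ filN k, H t ∈ filN k)
    (hDH : ∀ t, D (H t) + H (D t) = t - I (P t)) (hPD : ∀ t, P (D t) = 0)
    (hPI : ∀ t, P (I t) = t) (hδ' : ∀ t, δ' (δ' t) = 0) (hF : ∀ t, δ' (F t) = F (δ t)) (k : ℕ) :
    ∀ (w : N) (z : M), w ∈ filN (k + 1) → z ∈ filM k → F z = δ' w →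
      ∃ z' ∈ filM (k + 1), δ z' = z ∧ z' - P w ∈ filM k := by
  induction k with
  | zero =>
    intro w z hw hz _
    have hPw : P w ∈ filM 1 := hP _ _ hw
    have h0 : δ (P w) ∈ filM 0 := hδ _ _ hPw
    rw [hM0, Submodule.mem_bot] at hz h0
    exact ⟨P w, hPw, by rw [hz, h0], by simp⟩
  | succ k ih =>
    intro w z hw hz hwz
    have hv : P w ∈ filM (k + 2) := hP _ _ hw
    have hu : H w ∈ filN (k + 2) := hH _ _ hw
    have hDw : D w ∈ filN (k + 1) := by
      have : D w = F z - (δ' w - D w) := by rw [hwz]; abel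
      rw [this]
      exact Submodule.sub_mem _ (hF0 _ _ hz) (hδD _ _ hw)
    -- subtracting `F (P w)` and a coboundary removes the leading part of `w`
    set w' := w - F (P w) - δ' (H w) with hw'_def
    have hw' : w' ∈ filN (k + 1) := by
      have : w' = H (D w) - (F (P w) - I (P w)) - (δ' (H w) - D (H w)) := by
        have h := hDH w
        rw [eq_sub_iff_add_eq] at h
        rw [hw'_def]
        nth_rewrite 1 [← h]
        abel
      rw [this]
      exact Submodule.sub_mem _ (Submodule.sub_mem _ (hH _ _ hDw) (hFI _ _ hv)) (hδD _ _ hu)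
    have hz1 : F (z - δ (P w)) = δ' w' := by
      rw [hw'_def, map_sub, map_sub, map_sub, hδ', hF, hwz, sub_zero]
    have hmem1 : z - δ (P w) ∈ filM (k + 1) := Submodule.sub_mem _ hz (hδ _ _ hv)
    have hmem : z - δ (P w) ∈ filM k := by
      have : z - δ (P w) = P (δ' w' - D w') -
          P (F (z - δ (P w)) - I (z - δ (P w))) := by
        rw [map_sub P, map_sub P, hPI, hPD, hz1]
        abel
      rw [this]
      exact Submodule.sub_mem _ (hP _ _ (hδD _ _ hw')) (hP _ _ (hFI _ _ hmem1))
    obtain ⟨z'', hz'', h1, h2⟩ := ih w' _ hw' hmem hz1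
    refine ⟨P w + z'', Submodule.add_mem _ hv (hM (by omega) hz''), ?_, by simpa using hz''⟩
    rw [map_add, h1]
    abel

end Comparison

end BarConstruction

/-! ### Splittings of a differential graded algebra -/

namespace DGA

variable {K : Type*} [Field K] {A : Type*} [NonUnitalRing A] [Module K A]
  [IsScalarTower K A A] [SMulCommClass K A A] (D : DGA K A)

theorem iSup_gr : ⨆ p, D.gr p = ⊤ := D.isInternal.submodule_iSup_eq_top

theorem exists_linearMap {X : Type*} [AddCommGroup X] [Module K X]
    (φ : (p : ℤ) → D.gr p →ₗ[K] X) :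
    ∃ Φ : A →ₗ[K] X, ∀ (p : ℤ) (a : A) (ha : a ∈ D.gr p), Φ a = φ p ⟨a, ha⟩ := by
  let e := LinearEquiv.ofBijective (DirectSum.coeLinearMap D.gr) D.isInternal
  refine ⟨DirectSum.toModule K ℤ X φ ∘ₗ e.symm.toLinearMap, fun p a ha => ?_⟩
  have : e.symm a = DirectSum.lof K ℤ (fun p => D.gr p) p ⟨a, ha⟩ := by
    rw [LinearEquiv.symm_apply_eq]
    exact (DirectSum.coeLinearMap_lof D.gr p ⟨a, ha⟩).symm
  simp [this]

/-- Linear maps agree if they agree on the members of a family of subspaces spanning the whole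
space. -/
theorem _root_.LinearMap.ext_of_iSup_eq_top {V X : Type*} [AddCommGroup V] [Module K V]
    [AddCommGroup X] [Module K X] {gr : ℤ → Submodule K V} (hgr : ⨆ p, gr p = ⊤)
    {f g : V →ₗ[K] X} (h : ∀ p, ∀ v ∈ gr p, f v = g v) : f = g := by
  have : ⨆ p, gr p ≤ LinearMap.eqLocus f g := iSup_le fun p v hv => h p v hv
  ext v
  exact this (hgr ▸ Submodule.mem_top)

theorem _root_.Submodule.units_smul_mem' {V : Type*} [AddCommGroup V] [Module K V]
    (S : Submodule K V) (κ : ℤˣ) {v : V} (hv : v ∈ S) : κ • v ∈ S := by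
  rcases Int.units_eq_one_or κ with h | h <;> simp [h, hv]

/-- The sign involution `a ↦ (-1)^|a| a`. -/
noncomputable def sgn : A →ₗ[K] A :=
  (D.exists_linearMap fun p => Int.negOnePow p • (D.gr p).subtype).choose

theorem sgn_of_mem {p : ℤ} {a : A} (ha : a ∈ D.gr p) : D.sgn a = Int.negOnePow p • a :=
  (D.exists_linearMap fun p => Int.negOnePow p • (D.gr p).subtype).choose_spec p a ha

theorem sgn_mem {p : ℤ} {a : A} (ha : a ∈ D.gr p) : D.sgn a ∈ D.gr p := by
  rw [D.sgn_of_mem ha]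
  exact Submodule.units_smul_mem' _ _ ha

theorem _root_.Int.negOnePow_smul_self {V : Type*} [AddCommGroup V] (p : ℤ) (v : V) :
    Int.negOnePow p • Int.negOnePow p • v = v := by
  rw [smul_smul, ← Int.negOnePow_add, Int.negOnePow_even _ ⟨p, rfl⟩, one_smul]

theorem sgn_sgn (a : A) : D.sgn (D.sgn a) = a := by
  have : D.sgn ∘ₗ D.sgn = LinearMap.id := LinearMap.ext_of_iSup_eq_top D.iSup_gr fun p a ha => by
    rw [LinearMap.comp_apply, D.sgn_of_mem (D.sgn_mem ha), D.sgn_of_mem ha,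
      Int.negOnePow_smul_self, LinearMap.id_apply]
  exact LinearMap.congr_fun this a

/-- A linear map of odd degree anticommutes with the signs. -/
theorem comp_sgn_of_odd {φ : A →ₗ[K] A} {e : ℤ} (he : Odd e)
    (hφ : ∀ p, ∀ a ∈ D.gr p, φ a ∈ D.gr (p + e)) (a : A) : φ (D.sgn a) = -D.sgn (φ a) := by
  have : φ ∘ₗ D.sgn = -(D.sgn ∘ₗ φ) := LinearMap.ext_of_iSup_eq_top D.iSup_gr fun p a ha => by
    rw [LinearMap.comp_apply, LinearMap.neg_apply, LinearMap.comp_apply, D.sgn_of_mem ha,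
      D.sgn_of_mem (hφ p a ha), Int.negOnePow_add, Int.negOnePow_odd e he]
    rcases Int.units_eq_one_or (Int.negOnePow p) with h | h <;> simp [h]
  exact LinearMap.congr_fun this a

theorem d_sgn (a : A) : D.d (D.sgn a) = -D.sgn (D.d a) :=
  D.comp_sgn_of_odd (e := 1) (by decide) (fun _ _ h => D.d_mem h) a

theorem sgn_mul (a b : A) : D.sgn (a * b) = D.sgn a * D.sgn b := by
  have h1 : ∀ p, ∀ a ∈ D.gr p, ∀ b, D.sgn (a * b) = D.sgn a * D.sgn b := by
    intro p a ha b
    have : D.sgn ∘ₗ LinearMap.mulLeft K a = LinearMap.mulLeft K (D.sgn a) ∘ₗ D.sgn :=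
      LinearMap.ext_of_iSup_eq_top D.iSup_gr fun q b hb => by
        simp only [LinearMap.comp_apply, LinearMap.mulLeft_apply]
        rw [D.sgn_of_mem ha, D.sgn_of_mem hb, D.sgn_of_mem (D.mul_mem ha hb), Int.negOnePow_add,
          mul_smul]
        rcases Int.units_eq_one_or (Int.negOnePow p) with h | h <;>
          rcases Int.units_eq_one_or (Int.negOnePow q) with h' | h' <;> simp [h, h']
    exact LinearMap.congr_fun this b
  have : D.sgn ∘ₗ LinearMap.mulRight K b = LinearMap.mulRight K (D.sgn b) ∘ₗ D.sgn :=
    LinearMap.ext_of_iSup_eq_top D.iSup_gr fun p a ha => by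
      simpa using h1 p a ha b
  exact LinearMap.congr_fun this a

theorem d_mul (a b : A) : D.d (a * b) = D.d a * b + D.sgn a * D.d b := by
  have : D.d ∘ₗ LinearMap.mulRight K b = LinearMap.mulRight K b ∘ₗ D.d +
      LinearMap.mulRight K (D.d b) ∘ₗ D.sgn :=
    LinearMap.ext_of_iSup_eq_top D.iSup_gr fun p a ha => by
      simp only [LinearMap.comp_apply, LinearMap.mulRight_apply, LinearMap.add_apply]
      rw [D.leibniz b ha, D.sgn_of_mem ha]
      rcases Int.units_eq_one_or (Int.negOnePow p) with h | h <;> simp [h]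
  exact LinearMap.congr_fun this a

open Classical in
/-- The projection to the homogeneous part of degree `q`. -/
noncomputable def projGr (q : ℤ) : A →ₗ[K] A :=
  (D.exists_linearMap fun p => if p = q then (D.gr p).subtype else 0).choose

theorem projGr_of_mem {q : ℤ} {a : A} (ha : a ∈ D.gr q) : D.projGr q a = a := by
  classical
  rw [projGr, (D.exists_linearMap fun p => if p = q then (D.gr p).subtype else 0).choose_spec q a ha]
  simp

theorem projGr_of_ne {p q : ℤ} {a : A} (ha : a ∈ D.gr p) (hpq : p ≠ q) : D.projGr q a = 0 := by
  classical
  rw [projGr, (D.exists_linearMap fun p => if p = q then (D.gr p).subtype else 0).choose_spec p a ha]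
  simp [hpq]

theorem projGr_mem (q : ℤ) (a : A) : D.projGr q a ∈ D.gr q := by
  have : ⨆ p, D.gr p ≤ (D.gr q).comap (D.projGr q) := iSup_le fun p a ha => by
    rw [Submodule.mem_comap]
    by_cases h : p = q
    · subst h
      rwa [D.projGr_of_mem ha]
    · rw [D.projGr_of_ne ha h]
      exact Submodule.zero_mem _
  exact this (D.iSup_gr ▸ Submodule.mem_top)

theorem d_projGr (q : ℤ) (a : A) : D.d (D.projGr q a) = D.projGr (q + 1) (D.d a) := by
  have : D.d ∘ₗ D.projGr q = D.projGr (q + 1) ∘ₗ D.d :=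
    LinearMap.ext_of_iSup_eq_top D.iSup_gr fun p a ha => by
      rw [LinearMap.comp_apply, LinearMap.comp_apply]
      by_cases h : p = q
      · subst h
        rw [D.projGr_of_mem ha, D.projGr_of_mem (D.d_mem ha)]
      · rw [D.projGr_of_ne ha h, D.projGr_of_ne (D.d_mem ha) (by simpa using h), map_zero]
  exact LinearMap.congr_fun this a

theorem exists_primitiveMap : ∃ h : A →ₗ[K] A, (∀ p, ∀ a ∈ D.gr p, h a ∈ D.gr (p + -1)) ∧
    ∀ a, D.d (h (D.d a)) = D.d a := by
  obtain ⟨s, hs⟩ := D.d.rangeRestrict.exists_rightInverse_of_surjective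
    (LinearMap.range_rangeRestrict _)
  obtain ⟨t, ht⟩ := LinearMap.exists_extend s
  obtain ⟨h, hh⟩ := D.exists_linearMap fun p => (D.projGr (p + -1) ∘ₗ t) ∘ₗ (D.gr p).subtype
  refine ⟨h, fun p a ha => ?_, fun a => ?_⟩
  · rw [hh p a ha]
    exact D.projGr_mem _ _
  · have hdt : ∀ a, D.d (t (D.d a)) = D.d a := by
      intro a
      have h1 : t (D.d a) = s ⟨D.d a, LinearMap.mem_range_self _ a⟩ :=
        LinearMap.congr_fun ht ⟨D.d a, LinearMap.mem_range_self _ a⟩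
      have h2 := LinearMap.congr_fun hs ⟨D.d a, LinearMap.mem_range_self _ a⟩
      rw [h1]
      exact congrArg Subtype.val h2
    have : D.d ∘ₗ h ∘ₗ D.d = D.d := LinearMap.ext_of_iSup_eq_top D.iSup_gr fun p a ha => by
      have hda := D.d_mem ha
      rw [LinearMap.comp_apply, LinearMap.comp_apply, hh (p + 1) (D.d a) hda]
      simp only [LinearMap.comp_apply, Submodule.subtype_apply]
      rw [D.d_projGr, hdt, add_assoc]
      exact D.projGr_of_mem (by simpa using hda)
    exact LinearMap.congr_fun this a

/-- A map of degree `-1` which assigns a primitive to each coboundary. -/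
noncomputable def prim : A →ₗ[K] A := D.exists_primitiveMap.choose

theorem prim_mem {p : ℤ} {a : A} (ha : a ∈ D.gr p) : D.prim a ∈ D.gr (p + -1) :=
  D.exists_primitiveMap.choose_spec.1 p a ha

theorem d_prim_d (a : A) : D.d (D.prim (D.d a)) = D.d a :=
  D.exists_primitiveMap.choose_spec.2 a

theorem Represents.d_eq_zero {D : DGA K A} {a : A} {h : D.Cohomology} (ha : D.Represents a h) :
    D.d a = 0 := by
  obtain ⟨z, rfl, -⟩ := ha
  exact z.2

theorem represents_zero_iff {a : A} : D.Represents a 0 ↔ ∃ b, a = D.d b := by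
  constructor
  · rintro ⟨z, rfl, hz⟩
    rw [Submodule.mkQ_apply, Submodule.Quotient.mk_eq_zero] at hz
    obtain ⟨b, hb⟩ := hz
    exact ⟨b, hb.symm⟩
  · rintro ⟨b, rfl⟩
    refine ⟨⟨D.d b, D.d_d b⟩, rfl, ?_⟩
    rw [Submodule.mkQ_apply, Submodule.Quotient.mk_eq_zero]
    exact ⟨b, rfl⟩

theorem Represents.sub {D : DGA K A} {a b : A} {h k : D.Cohomology} (ha : D.Represents a h)
    (hb : D.Represents b k) : D.Represents (a - b) (h - k) := by
  obtain ⟨z, rfl, rfl⟩ := ha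
  obtain ⟨w, rfl, rfl⟩ := hb
  exact ⟨z - w, rfl, map_sub _ _ _⟩

theorem Represents.exists_eq_d {D : DGA K A} {a b : A} {h : D.Cohomology}
    (ha : D.Represents a h) (hb : D.Represents b h) : ∃ c, a - b = D.d c := by
  rw [← D.represents_zero_iff, ← sub_self h]
  exact ha.sub hb

/-- The projection of `A` to its cohomology, `a ↦ [a - h d a]`. -/
noncomputable def toCoh : A →ₗ[K] D.Cohomology :=
  D.cls ∘ₗ (LinearMap.id - D.prim ∘ₗ D.d).codRestrict D.cocycles
    fun a => by simp [D.d_prim_d]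

theorem represents_toCoh {a : A} (ha : D.d a = 0) : D.Represents a (D.toCoh a) :=
  ⟨⟨a, ha⟩, rfl, by simp [toCoh, LinearMap.codRestrict, ha]⟩

theorem Represents.toCoh_eq {D : DGA K A} {a : A} {h : D.Cohomology} (ha : D.Represents a h) :
    D.toCoh a = h := by
  obtain ⟨⟨z, hz⟩, rfl, rfl⟩ := ha
  have : D.d z = 0 := hz
  simp [toCoh, LinearMap.codRestrict, this]

theorem toCoh_d (a : A) : D.toCoh (D.d a) = 0 :=
  ((D.represents_zero_iff).2 ⟨a, rfl⟩).toCoh_eq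

theorem toCoh_mem {p : ℤ} {a : A} (ha : a ∈ D.gr p) : D.toCoh a ∈ D.grH p := by
  refine ⟨_, ?_, rfl⟩
  change a - D.prim (D.d a) ∈ D.gr p
  refine Submodule.sub_mem _ ha ?_
  have := D.prim_mem (D.d_mem ha)
  rwa [add_neg_cancel_right] at this

/-- The section `[z] ↦ z - d h z` of the projection to cohomology. -/
noncomputable def ofCoh : D.Cohomology →ₗ[K] A :=
  Submodule.liftQ _ ((LinearMap.id - D.d ∘ₗ D.prim) ∘ₗ D.cocycles.subtype) (by
    rintro ⟨z, hz⟩ ⟨b, hb⟩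
    simp only [Submodule.subtype_apply] at hb
    subst hb
    simp [D.d_prim_d])

theorem represents_ofCoh (h : D.Cohomology) : D.Represents (D.ofCoh h) h := by
  obtain ⟨z, rfl⟩ := Submodule.mkQ_surjective _ h
  have h1 : D.Represents (z : A) (D.cls z) := ⟨z, rfl, rfl⟩
  have h2 := h1.sub ((D.represents_zero_iff).2 ⟨D.prim z, rfl⟩)
  rw [sub_zero] at h2
  exact h2

theorem toCoh_ofCoh (h : D.Cohomology) : D.toCoh (D.ofCoh h) = h := (D.represents_ofCoh h).toCoh_eq

theorem ofCoh_mem {p : ℤ} {h : D.Cohomology} (hh : h ∈ D.grH p) : D.ofCoh h ∈ D.gr p := by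
  obtain ⟨z, hz, rfl⟩ := hh
  have hz' : (z : A) ∈ D.gr p := hz
  refine Submodule.sub_mem _ hz' ?_
  have := D.d_mem (D.prim_mem hz')
  rwa [neg_add_cancel_right] at this

theorem iSup_grH : ⨆ p, D.grH p = ⊤ := by
  rw [eq_top_iff]
  intro h _
  rw [← D.toCoh_ofCoh h]
  have : ⨆ p, D.gr p ≤ (⨆ p, D.grH p).comap D.toCoh :=
    iSup_le fun p a ha => Submodule.mem_iSup_of_mem p (D.toCoh_mem ha)
  exact this (D.iSup_gr ▸ Submodule.mem_top)

/-- The sign involution `h ↦ (-1)^|h| h` of the cohomology. -/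
noncomputable def sgnH : D.Cohomology →ₗ[K] D.Cohomology := D.toCoh ∘ₗ D.sgn ∘ₗ D.ofCoh

theorem sgnH_of_mem {p : ℤ} {h : D.Cohomology} (hh : h ∈ D.grH p) :
    D.sgnH h = Int.negOnePow p • h := by
  rw [sgnH, LinearMap.comp_apply, LinearMap.comp_apply, D.sgn_of_mem (D.ofCoh_mem hh)]
  conv_rhs => rw [← D.toCoh_ofCoh h]
  rcases Int.units_eq_one_or (Int.negOnePow p) with h | h <;> simp [h]

/-- The projection of the cohomology to its homogeneous part of degree `q`. -/
noncomputable def projGrH (q : ℤ) : D.Cohomology →ₗ[K] D.Cohomology :=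
  D.toCoh ∘ₗ D.projGr q ∘ₗ D.ofCoh

theorem projGrH_of_mem {q : ℤ} {h : D.Cohomology} (hh : h ∈ D.grH q) : D.projGrH q h = h := by
  rw [projGrH, LinearMap.comp_apply, LinearMap.comp_apply, D.projGr_of_mem (D.ofCoh_mem hh),
    toCoh_ofCoh]

theorem projGrH_of_ne {p q : ℤ} {h : D.Cohomology} (hh : h ∈ D.grH p) (hpq : p ≠ q) :
    D.projGrH q h = 0 := by
  rw [projGrH, LinearMap.comp_apply, LinearMap.comp_apply, D.projGr_of_ne (D.ofCoh_mem hh) hpq,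
    map_zero]

/-- The homotopy from `f π` to the identity of `A`, for a section `f` of the projection `π` to
cohomology. -/
noncomputable def homotopy (f : D.Cohomology →ₗ[K] A) : A →ₗ[K] A :=
  D.prim ∘ₗ (LinearMap.id - D.prim ∘ₗ D.d - f ∘ₗ D.toCoh)

theorem homotopy_d (f : D.Cohomology →ₗ[K] A) (a : A) :
    D.homotopy f (D.d a) = D.prim (D.d a) := by
  simp [homotopy, D.d_d, D.toCoh_d]

theorem d_homotopy {f : D.Cohomology →ₗ[K] A} (hf : ∀ h, D.Represents (f h) h) (a : A) :
    D.d (D.homotopy f a) = a - D.prim (D.d a) - f (D.toCoh a) := by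
  have h1 : D.d (a - D.prim (D.d a)) = 0 := by simp [D.d_prim_d]
  have h2 : D.toCoh (a - D.prim (D.d a)) = D.toCoh a := by
    have := D.represents_toCoh h1
    rw [← this.toCoh_eq]
    simp [toCoh, LinearMap.codRestrict, D.d_prim_d]
  obtain ⟨b, hb⟩ := (D.represents_toCoh h1).exists_eq_d (hf (D.toCoh (a - D.prim (D.d a))))
  rw [h2] at hb
  simp only [homotopy, LinearMap.comp_apply, LinearMap.sub_apply, LinearMap.id_apply, hb,
    D.d_prim_d]

theorem homotopy_mem {f : D.Cohomology →ₗ[K] A} (hf : ∀ p, ∀ h ∈ D.grH p, f h ∈ D.gr p) {p : ℤ}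
    {a : A} (ha : a ∈ D.gr p) : D.homotopy f a ∈ D.gr (p + -1) := by
  refine D.prim_mem (Submodule.sub_mem _ (Submodule.sub_mem _ ha ?_) (hf p _ (D.toCoh_mem ha)))
  have := D.prim_mem (D.d_mem ha)
  rwa [add_neg_cancel_right] at this

end DGA

namespace BarConstruction

open TensorAlgebra (ι)

/-! ### From signed operations to the bar construction -/

section Desuspension

variable {K V W : Type*} [Field K] [AddCommGroup V] [Module K V] [AddCommGroup W] [Module K W]

local notation:70 f:70 " ⋆ " g:71 => conv f g

/-- The map of the tensor coalgebra that corresponds to the operations `g k`, by means of the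
signs `(-1)^(∑ (k-j)|v_j|)` of the `k`-fold tensor power of the suspension. The involution `s` is
`v ↦ (-1)^|v| v`. -/
noncomputable def bar (s : V →ₗ[K] V) (g : (k : ℕ) → MultilinearMap K (fun _ : Fin k => V) W) :
    TensorAlgebra K V →ₗ[K] W :=
  ofMultilinear fun k => (g k).compLinearMap fun j : Fin k => (s ^ (k - 1 - (j : ℕ)) : Module.End K V)

/-- The operations that correspond to a map of the tensor coalgebra. -/
noncomputable def unbar (s : V →ₗ[K] V) (b : TensorAlgebra K V →ₗ[K] W) (k : ℕ) :
    MultilinearMap K (fun _ : Fin k => V) W :=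
  (b.compMultilinearMap (TensorAlgebra.tprod K V k)).compLinearMap
    fun j : Fin k => (s ^ (k - 1 - (j : ℕ)) : Module.End K V)

theorem bar_unbar {s : V →ₗ[K] V} (hs : ∀ v, s (s v) = v) (b : TensorAlgebra K V →ₗ[K] W) :
    bar s (unbar s b) = b := by
  have h : ∀ (m : ℕ) (v : V), (s ^ m : Module.End K V) ((s ^ m : Module.End K V) v) = v := by
    intro m v
    have hss : (s * s : Module.End K V) = 1 := LinearMap.ext hs
    rw [← Module.End.mul_apply, ← (Commute.refl s).mul_pow, hss, one_pow, Module.End.one_apply]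
  refine ext_word fun x k => ?_
  rw [bar, ofMultilinear_word, unbar]
  simp only [MultilinearMap.compLinearMap_apply, LinearMap.compMultilinearMap_apply, h]
  rw [tprod_eq_word]

/-- The exponent `∑ (k-1-j) |v_j|` of the sign in `s^{⊗k}`. -/
def suspExp (p : ℕ → ℤ) (a k : ℕ) : ℤ := ∑ j ∈ Finset.range k, ((k : ℤ) - 1 - j) * p (a + j)

theorem suspExp_add (p : ℕ → ℤ) (a k l : ℕ) : suspExp p a (k + l) =
    suspExp p a k + l * ∑ j ∈ Finset.range k, p (a + j) + suspExp p (a + k) l := by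
  simp only [suspExp, Finset.sum_range_add, Finset.mul_sum, ← Finset.sum_add_distrib]
  congr 1
  · refine Finset.sum_congr rfl fun j _ => ?_
    push_cast
    ring
  · refine Finset.sum_congr rfl fun j _ => ?_
    rw [add_assoc]
    push_cast
    ring

theorem suspExp_congr {p q : ℕ → ℤ} {a b k : ℕ} (h : ∀ j < k, p (a + j) = q (b + j)) :
    suspExp p a k = suspExp q b k :=
  Finset.sum_congr rfl fun j hj => by rw [h j (Finset.mem_range.1 hj)]

theorem negOnePow_smul_eq (e : ℤ) (v : V) :
    Int.negOnePow e • v = (((Int.negOnePow e : ℤˣ) : ℤ) : K) • v := by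
  rcases Int.units_eq_one_or (Int.negOnePow e) with h | h <;> simp [h]

theorem negOnePow_sum {α : Type*} (S : Finset α) (e : α → ℤ) :
    Int.negOnePow (∑ j ∈ S, e j) = ∏ j ∈ S, Int.negOnePow (e j) := by
  classical
  induction S using Finset.induction_on with
  | empty => simp
  | insert a S ha ih => rw [Finset.sum_insert ha, Finset.prod_insert ha, Int.negOnePow_add, ih]

variable {gr : ℤ → Submodule K V} {s : V →ₗ[K] V}

theorem pow_apply_of_mem (hs : ∀ p, ∀ v ∈ gr p, s v = Int.negOnePow p • v) {p : ℤ} {v : V}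
    (hv : v ∈ gr p) (m : ℕ) : (s ^ m : Module.End K V) v = Int.negOnePow (m * p) • v := by
  induction m with
  | zero => simp
  | succ m ih =>
    rw [pow_succ', Module.End.mul_apply, ih, negOnePow_smul_eq (K := K), map_smul, hs p v hv,
      ← negOnePow_smul_eq, smul_smul, ← Int.negOnePow_add]
    congr 2
    push_cast
    ring

theorem compLinearMap_pow_apply (hs : ∀ p, ∀ v ∈ gr p, s v = Int.negOnePow p • v)
    {p : ℕ → ℤ} {x : ℕ → V} (hx : ∀ j, x j ∈ gr (p j)) {k : ℕ}
    (g : MultilinearMap K (fun _ : Fin k => V) W) (a : ℕ) :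
    g.compLinearMap (fun j : Fin k => (s ^ (k - 1 - (j : ℕ)) : Module.End K V))
      (fun j : Fin k => x (a + j)) =
      Int.negOnePow (suspExp p a k) • g (fun j : Fin k => x (a + j)) := by
  rw [MultilinearMap.compLinearMap_apply]
  have h1 : ∀ j : Fin k, (s ^ (k - 1 - (j : ℕ)) : Module.End K V) (x (a + j)) =
      (((Int.negOnePow (((k : ℤ) - 1 - (j : ℕ)) * p (a + j)) : ℤˣ) : ℤ) : K) • x (a + j) := by
    intro j
    rw [pow_apply_of_mem hs (hx _), negOnePow_smul_eq (K := K)]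
    have : ((k - 1 - (j : ℕ) : ℕ) : ℤ) = (k : ℤ) - 1 - (j : ℕ) := by omega
    rw [this]
  simp only [h1]
  rw [MultilinearMap.map_smul_univ, negOnePow_smul_eq (K := K), suspExp,
    ← Fin.sum_univ_eq_sum_range (fun j => ((k : ℤ) - 1 - j) * p (a + j)), negOnePow_sum]
  simp

theorem bar_word (hs : ∀ p, ∀ v ∈ gr p, s v = Int.negOnePow p • v)
    {p : ℕ → ℤ} {x : ℕ → V} (hx : ∀ j, x j ∈ gr (p j))
    (g : (k : ℕ) → MultilinearMap K (fun _ : Fin k => V) W) (a k : ℕ) :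
    bar s g (word K x a k) =
      Int.negOnePow (suspExp p a k) • g k (fun j : Fin k => x (a + j)) := by
  rw [bar, ofMultilinear_word, compLinearMap_pow_apply hs hx]

theorem eq_bar_word (hs : ∀ p, ∀ v ∈ gr p, s v = Int.negOnePow p • v)
    {p : ℕ → ℤ} {x : ℕ → V} (hx : ∀ j, x j ∈ gr (p j))
    (g : (k : ℕ) → MultilinearMap K (fun _ : Fin k => V) W) (a k : ℕ) :
    g k (fun j : Fin k => x (a + j)) =
      Int.negOnePow (suspExp p a k) • bar s g (word K x a k) := by
  rw [bar_word hs hx, Int.negOnePow_smul_self]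

theorem bar_one (g : (k : ℕ) → MultilinearMap K (fun _ : Fin k => V) W) (h : g 0 = 0) :
    bar s g 1 = 0 := by
  rw [← word_zero K (fun _ => (0 : V)) 0, bar, ofMultilinear_word, h]
  simp

theorem bar_ι (g : (k : ℕ) → MultilinearMap K (fun _ : Fin k => V) W) (v : V) :
    bar s g (ι K v) = g 1 (fun _ => v) := by
  rw [← word_one K (fun _ => v) 0, bar, ofMultilinear_word, MultilinearMap.compLinearMap_apply]
  simp

theorem coDer_word (σ : V →ₗ[K] V) (b : TensorAlgebra K V →ₗ[K] V) (hb : b 1 = 0) (x : ℕ → V)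
    (a k : ℕ) : coDer σ b (word K x a k) = ∑ r ∈ Finset.range (k + 1),
      word K (fun j => σ (x j)) a r *
        ((ι K ∘ₗ b) ⋆ LinearMap.id) (word K x (a + r) (k - r)) := by
  induction k generalizing a with
  | zero => simp [coDer_one σ hb, conv_one, hb]
  | succ k ih =>
    rw [word_succ, coDer_ι_mul, ih, Finset.sum_range_succ' _ (k + 1), add_comm, Finset.mul_sum]
    congr 1
    · refine Finset.sum_congr rfl fun r _ => ?_
      rw [word_succ, mul_assoc, Nat.add_sub_add_right, show a + 1 + r = a + (r + 1) by ring]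
    · simp [word_succ]

theorem word_sign {σ : V →ₗ[K] V} (hσ : ∀ p, ∀ v ∈ gr p, σ v = Int.negOnePow (p + 1) • v)
    {p : ℕ → ℤ} {x : ℕ → V} (hx : ∀ j, x j ∈ gr (p j)) (a k : ℕ) :
    word K (fun j => σ (x j)) a k =
      Int.negOnePow (∑ j ∈ Finset.range k, p (a + j) + k) • word K x a k := by
  induction k generalizing a with
  | zero => simp
  | succ k ih =>
    rw [word_succ, word_succ, ih, hσ _ _ (hx a), negOnePow_smul_eq (K := K) (p a + 1), map_smul,
      negOnePow_smul_eq (K := K), smul_mul_smul_comm, negOnePow_smul_eq (K := K), ← Int.cast_mul,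
      ← Units.val_mul, ← Int.negOnePow_add, Finset.sum_range_succ', Nat.cast_succ]
    have : p a + 1 + (∑ j ∈ Finset.range k, p (a + 1 + j) + k) =
        ∑ j ∈ Finset.range k, p (a + (j + 1)) + p (a + 0) + (k + 1) := by
      simp only [add_assoc, add_comm 1, add_zero]
      ring
    rw [this]

/-- The left side of the `A∞` relations is, up to an overall sign, `g δ` for the maps `g` and `δ`
of the bar construction. -/
theorem insertionSum_eq (hs : ∀ p, ∀ v ∈ gr p, s v = Int.negOnePow p • v)
    (g : (k : ℕ) → MultilinearMap K (fun _ : Fin k => V) W)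
    (m : (k : ℕ) → MultilinearMap K (fun _ : Fin k => V) V) (hm0 : m 0 = 0)
    (hm : ∀ (k : ℕ) (p : Fin k → ℤ) (x : Fin k → V), 1 ≤ k → (∀ j, x j ∈ gr (p j)) →
      m k x ∈ gr ((∑ j, p j) + 2 - k))
    (i : ℕ) {p : ℕ → ℤ} {x : ℕ → V} (hx : ∀ j, x j ∈ gr (p j)) :
    insertionSum g m i p x = Int.negOnePow (suspExp p 0 i) •
      bar s g (coDer (-s) (bar s m) (word K x 0 i)) := by
  have hσ : ∀ p, ∀ v ∈ gr p, (-s) v = Int.negOnePow (p + 1) • v := by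
    intro p v hv
    rw [LinearMap.neg_apply, hs p v hv, Int.negOnePow_succ, Units.neg_smul]
  have hb1 : bar s m 1 = 0 := bar_one m hm0
  have hsum : coDer (-s) (bar s m) (word K x 0 i) =
      ∑ u ∈ Finset.Icc 1 i, ∑ r ∈ Finset.range (i - u + 1),
        word K (fun j => (-s) (x j)) 0 r *
          (ι K (bar s m (word K x r u)) * word K x (r + u) (i - r - u)) := by
    rw [coDer_word _ _ hb1]
    simp only [conv_word, Finset.mul_sum, zero_add]
    have : ∀ r ∈ Finset.range (i + 1), ∑ u ∈ Finset.range (i - r + 1),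
        word K (fun j => (-s) (x j)) 0 r * ((ι K ∘ₗ bar s m) (word K x r u) *
          (LinearMap.id : TensorAlgebra K V →ₗ[K] _) (word K x (r + u) (i - r - u))) =
        ∑ u ∈ Finset.Icc 1 (i - r), word K (fun j => (-s) (x j)) 0 r *
          (ι K (bar s m (word K x r u)) * word K x (r + u) (i - r - u)) := by
      intro r _
      symm
      refine Finset.sum_subset (fun u hu => ?_) fun u hu hu' => ?_
      · simp at hu ⊢
        omega
      · obtain rfl : u = 0 := by
          simp at hu hu'
          omega
        simp [hb1]
    rw [Finset.sum_congr rfl this]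
    refine Finset.sum_comm' fun r u => ?_
    simp
    omega
  rw [hsum, map_sum, Finset.smul_sum, insertionSum]
  refine Finset.sum_congr rfl fun u hu => ?_
  rw [map_sum, Finset.smul_sum]
  refine Finset.sum_congr rfl fun r hr => ?_
  rw [Finset.mem_Icc] at hu
  rw [Finset.mem_range] at hr
  obtain ⟨t, rfl⟩ : ∃ t, i = r + (u + t) := ⟨i - u - r, by omega⟩
  have ht : r + (u + t) - u - r = t := by omega
  have ht' : r + (u + t) - r - u = t := by omega
  rw [ht, ht']
  set y := m u (fun l : Fin u => x (r + l)) with hy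
  set q : ℕ → ℤ := insertBlock r u p (∑ j ∈ Finset.range u, p (r + j) + 2 - u) with hq
  have hymem : y ∈ gr (∑ j ∈ Finset.range u, p (r + j) + 2 - u) := by
    rw [← Fin.sum_univ_eq_sum_range (fun j => p (r + j))]
    exact hm u _ _ hu.1 fun j => hx _
  have hins : ∀ j, insertBlock r u x y j ∈ gr (q j) := by
    intro j
    rw [hq]
    unfold insertBlock
    split_ifs
    exacts [hx _, hymem, hx _]
  have hword : word K (insertBlock r u x y) 0 (r + (1 + t)) =
      word K x 0 r * (ι K y * word K x (r + u) t) := by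
    rw [word_add, word_add, word_one]
    congr 1
    · refine word_congr fun j hj => ?_
      simp [insertBlock, hj]
    · congr 1
      · simp [insertBlock]
      · refine word_congr fun j hj => ?_
        have h1 : ¬ 0 + r + 1 + j < r := by omega
        have h2 : ¬ 0 + r + 1 + j = r := by omega
        simp only [insertBlock, h1, h2, if_false]
        congr 1
        omega
  have hexp : suspExp q 0 (r + (1 + t)) = suspExp p 0 r + (1 + t) * ∑ j ∈ Finset.range r, p j +
      t * (∑ j ∈ Finset.range u, p (r + j) + 2 - u) + suspExp p (r + u) t := by
    have h1 : suspExp q 0 r = suspExp p 0 r :=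
      suspExp_congr fun j hj => by simp [hq, insertBlock, hj]
    have h2 : ∑ j ∈ Finset.range r, q (0 + j) = ∑ j ∈ Finset.range r, p j :=
      Finset.sum_congr rfl fun j hj => by simp [hq, insertBlock, Finset.mem_range.1 hj]
    have h3 : suspExp q (0 + r + 1) t = suspExp p (r + u) t := suspExp_congr fun j hj => by
      have h1 : ¬ 0 + r + 1 + j < r := by omega
      have h2 : ¬ 0 + r + 1 + j = r := by omega
      simp only [hq, insertBlock, h1, h2, if_false]
      congr 1
      omega
    rw [suspExp_add, suspExp_add, h1, h2, h3]
    simp [suspExp, hq, insertBlock]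
    ring
  have hg := eq_bar_word hs hins g 0 (r + (1 + t))
  simp only [zero_add] at hg
  have hu1 : r + 1 + t = r + (1 + t) := by ring
  have hterm : word K (fun j => (-s) (x j)) 0 r *
      (ι K (bar s m (word K x r u)) * word K x (r + u) t) =
      Int.negOnePow (∑ j ∈ Finset.range r, p j + r + suspExp p r u) •
        word K (insertBlock r u x y) 0 (r + (1 + t)) := by
    rw [hword, word_sign hσ hx, bar_word hs hx, negOnePow_smul_eq (K := K) (suspExp p r u),
      map_smul, negOnePow_smul_eq (K := K), negOnePow_smul_eq (K := K), smul_mul_assoc,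
      smul_mul_assoc, mul_smul_comm, smul_smul, Int.negOnePow_add (_ + _), Units.val_mul,
      Int.cast_mul]
    simp only [zero_add, hy]
  rw [hu1, hg, hterm, negOnePow_smul_eq (K := K) (_ + suspExp p r u), map_smul,
    ← negOnePow_smul_eq, smul_smul, smul_smul, ← Int.negOnePow_add, ← Int.negOnePow_add]
  congr 1
  rw [Int.negOnePow_eq_iff, hexp, suspExp_add, suspExp_add]
  simp only [zero_add]
  refine ⟨(∑ j ∈ Finset.range r, p j) - u * (∑ j ∈ Finset.range r, p j) + t - suspExp p r u, ?_⟩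
  push_cast
  ring

end Desuspension

section OfDGA

variable {K : Type*} [Field K] {A : Type*} [NonUnitalRing A] [Module K A]
  [IsScalarTower K A A] [SMulCommClass K A A] (D : DGA K A)
  {V : Type*} [AddCommGroup V] [Module K V]

local notation:70 f:70 " ⋆ " g:71 => conv f g

theorem units_smul_eq {X : Type*} [AddCommGroup X] [Module K X] (κ : ℤˣ) (v : X) :
    κ • v = (((κ : ℤˣ) : ℤ) : K) • v := by
  rcases Int.units_eq_one_or κ with h | h <;> simp [h]

theorem sum_composition_eq {X : Type*} [AddCommGroup X] {i : ℕ} (hi : 1 ≤ i)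
    (T : Composition i → X) (hT : ∀ c : Composition i, 3 ≤ c.length → T c = 0) :
    ∑ c, T c = T ⟨[i], by simp; omega, by simp⟩ + ∑ u : Fin (i - 1),
      T ⟨[u + 1, i - (u + 1)], by simp; omega, by simp; omega⟩ := by
  have := Finset.sum_of_injOn (s := (Finset.univ : Finset (Option (Fin (i - 1)))))
    (t := Finset.univ) (f := fun o => T (o.elim (⟨[i], by simp; omega, by simp⟩)
      fun u => ⟨[u + 1, i - (u + 1)], by simp; omega, by simp; omega⟩)) (g := T)
    (fun o => o.elim (⟨[i], by simp; omega, by simp⟩)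
      fun u => ⟨[u + 1, i - (u + 1)], by simp; omega, by simp; omega⟩) ?_ ?_ ?_ ?_
  · rw [← this, Fintype.sum_option]
    rfl
  · rintro (_ | u) - (_ | v) - h
    · rfl
    · have := congrArg (fun c => c.blocks.length) h
      simp at this
    · have := congrArg (fun c => c.blocks.length) h
      simp at this
    · have := congrArg (fun c => c.blocks) h
      simp at this
      simp [Fin.ext_iff, this]
  · exact fun _ _ => Finset.mem_univ _
  · intro c _ hc
    refine hT c ?_
    by_contra hlen
    refine hc ?_
    obtain ⟨l, hl, hsum⟩ := c
    rcases l with _ | ⟨a, _ | ⟨b, _ | ⟨d, l⟩⟩⟩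
    · simp at hsum
      omega
    · refine ⟨none, by simp, ?_⟩
      apply Composition.ext
      simp at hsum
      simp [hsum]
    · have ha : 0 < a := hl (by simp)
      have hb : 0 < b := hl (by simp)
      simp at hsum
      refine ⟨some ⟨a - 1, by omega⟩, by simp, ?_⟩
      apply Composition.ext
      simp
      omega
    · simp [Composition.length] at hlen
  · exact fun _ _ => rfl

/-- The right side of the relations for an `A∞` morphism to a differential graded algebra, in terms
of the bar construction. -/
theorem compositionSum_eq {gr : ℤ → Submodule K V} {s : V →ₗ[K] V}
    (hs : ∀ p, ∀ v ∈ gr p, s v = Int.negOnePow p • v) (κ : ℤˣ)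
    (f : (k : ℕ) → MultilinearMap K (fun _ : Fin k => V) A) (hf0 : f 0 = 0)
    (hf : ∀ (k : ℕ) (p : Fin k → ℤ) (x : Fin k → V), 1 ≤ k → (∀ j, x j ∈ gr (p j)) →
      f k x ∈ D.gr ((∑ j, p j) + 1 - k))
    {i : ℕ} (hi : 1 ≤ i) {p : ℕ → ℤ} {x : ℕ → V} (hx : ∀ j, x j ∈ gr (p j)) :
    compositionSum (D.ops κ) f i p x = Int.negOnePow (suspExp p 0 i) • κ •
      (D.d (bar s f (word K x 0 i)) +
        ((D.sgn ∘ₗ bar s f) ⋆ bar s f) (word K x 0 i)) := by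
  rw [compositionSum, sum_composition_eq hi]
  · rw [smul_add κ, smul_add]
    congr 1
    · change Int.negOnePow (∑ q : Fin 1, ((((1 : ℕ) : ℤ) - 1 - (q : ℕ)) *
        ((([i].get q : ℕ) : ℤ) - 1) + (1 - (([i].get q : ℕ) : ℤ)) *
          ∑ l ∈ Finset.range (([i].take q).sum), p l)) •
        κ • D.d (f i (fun l => x (0 + l))) = _
      rw [Fin.sum_univ_one, eq_bar_word hs hx f, negOnePow_smul_eq (K := K) (suspExp p 0 i),
        map_smul, smul_comm κ, ← negOnePow_smul_eq]
      simp
    · obtain ⟨n, rfl⟩ := Nat.exists_eq_add_of_le' hi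
      have hb1 : bar s f 1 = 0 := bar_one f hf0
      rw [conv_word, Finset.sum_range_succ, Finset.sum_range_succ', Nat.sub_self, word_zero,
        word_zero, hb1, mul_zero, add_zero, LinearMap.comp_apply, hb1, map_zero, zero_mul, add_zero,
        Finset.smul_sum, Finset.smul_sum, ← Fin.sum_univ_eq_sum_range (fun u => _ • κ • (_ * _))]
      refine Finset.sum_congr rfl fun u _ => ?_
      have hu : (u : ℕ) < n := u.2
      obtain ⟨a, ha⟩ : ∃ a, (u : ℕ) + 1 = a := ⟨_, rfl⟩
      obtain ⟨b, hb⟩ : ∃ b, n + 1 - a = b := ⟨_, rfl⟩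
      have hab : n + 1 = a + b := by omega
      have hsgn : (D.sgn ∘ₗ bar s f) (word K x 0 a) =
          Int.negOnePow ((∑ j ∈ Finset.range a, p j) + 1 - a) • bar s f (word K x 0 a) := by
        refine D.sgn_of_mem ?_
        rw [bar_word hs hx]
        refine Submodule.units_smul_mem' _ _ ?_
        rw [← Fin.sum_univ_eq_sum_range]
        refine hf a (fun j => p j) _ (by omega) fun j => ?_
        rw [zero_add]
        exact hx j
      change Int.negOnePow (∑ q : Fin 2, ((((2 : ℕ) : ℤ) - 1 - (q : ℕ)) *
        ((([(u : ℕ) + 1, n + 1 - (u + 1)].get q : ℕ) : ℤ) - 1) +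
          (1 - (([(u : ℕ) + 1, n + 1 - (u + 1)].get q : ℕ) : ℤ)) *
          ∑ l ∈ Finset.range (([(u : ℕ) + 1, n + 1 - (u + 1)].take q).sum), p l)) •
        κ • (f (u + 1) (fun l => x (0 + l)) * f (n + 1 - (u + 1)) (fun l => x (u + 1 + l))) = _
      rw [ha, hb, hab, hsgn, eq_bar_word hs hx f 0 a, eq_bar_word hs hx f a b,
        Fin.sum_univ_two, zero_add, negOnePow_smul_eq (K := K) (suspExp p 0 a),
        negOnePow_smul_eq (K := K) (suspExp p a b), smul_mul_smul_comm, ← Int.cast_mul,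
        ← Units.val_mul, ← Int.negOnePow_add, ← negOnePow_smul_eq,
        negOnePow_smul_eq (K := K) (_ + 1 - _), smul_mul_assoc, ← negOnePow_smul_eq,
        smul_smul, smul_smul, smul_smul, smul_smul]
      congr 1
      rw [mul_right_comm, mul_right_comm _ κ, ← Int.negOnePow_add, ← Int.negOnePow_add]
      congr 1
      rw [Int.negOnePow_eq_iff, suspExp_add]
      simp only [Fin.isValue, Fin.val_zero, Fin.val_one, List.get_eq_getElem,
        List.getElem_cons_zero, List.getElem_cons_succ, List.take_zero, List.sum_nil,
        Finset.range_zero, Finset.sum_empty, mul_zero, List.take_succ_cons, List.sum_cons,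
        add_zero, zero_add]
      refine ⟨(a : ℤ) - 1 - b * ∑ l ∈ Finset.range a, p l, ?_⟩
      push_cast
      ring
  · intro c hc
    rw [D.ops_ge_three κ _ hc]
    simp

end OfDGA

end BarConstruction

namespace BarConstruction

open TensorAlgebra (ι)

/-! ### Sums over subdivisions of an interval -/

section Subdivision

variable {K V : Type*} [Field K] [AddCommGroup V] [Module K V]

/-- The sum `∑ a_{i,k₁} ⊗ a_{k₁,k₂} ⊗ ⋯ ⊗ a_{k_r,j}` over all subdivisions of the interval from `i`
to `j`. -/
noncomputable def subdivisionSum (a : ℕ → ℕ → V) (j : ℕ) (i : ℕ) : TensorAlgebra K V :=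
  if i < j then ∑ m ∈ (Finset.Ioc i j).attach, ι K (a i m) * subdivisionSum a j m else 1
termination_by j - i
decreasing_by
  have := Finset.mem_Ioc.1 m.2
  omega

theorem subdivisionSum_self (a : ℕ → ℕ → V) (j : ℕ) :
    subdivisionSum (K := K) a j j = 1 := by
  rw [subdivisionSum, if_neg (lt_irrefl _)]

theorem subdivisionSum_of_lt (a : ℕ → ℕ → V) {i j : ℕ} (h : i < j) :
    subdivisionSum (K := K) a j i =
      ∑ m ∈ Finset.Ioc i j, ι K (a i m) * subdivisionSum a j m := by
  rw [subdivisionSum, if_pos h]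
  exact Finset.sum_attach _ fun m => ι K (a i m) * subdivisionSum a j m

theorem subdivisionSum_mem (a : ℕ → ℕ → V) {i j : ℕ} (hij : i ≤ j) :
    subdivisionSum a j i ∈ lenLT K V (j - i + 1) := by
  obtain ⟨k, rfl⟩ := Nat.exists_eq_add_of_le hij
  induction k using Nat.strong_induction_on generalizing i with
  | _ k ih =>
    rcases Nat.eq_zero_or_pos k with rfl | hk
    · rw [add_zero, subdivisionSum_self]
      exact word_mem_lenLT (fun _ => 0) 0 (j := 0) (by omega)
    · rw [subdivisionSum_of_lt a (by omega)]
      refine Submodule.sum_mem _ fun m hm => ?_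
      rw [Finset.mem_Ioc] at hm
      have := ih (i + k - m) (by omega) (i := m) (by omega)
      rw [show m + (i + k - m) = i + k by omega] at this
      exact lenLT_mono (by omega) (ι_mul_mem_lenLT _ this)

theorem subdivisionSum_sub_mem (a : ℕ → ℕ → V) {i k : ℕ} :
    subdivisionSum a (i + k) i - word K (fun j => a j (j + 1)) i k ∈ lenLT K V k := by
  induction k generalizing i with
  | zero => simp [subdivisionSum_self]
  | succ k ih =>
    have hI : Finset.Ioc i (i + (k + 1)) = insert (i + 1) (Finset.Ioc (i + 1) (i + (k + 1))) := by
      ext m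
      simp only [Finset.mem_Ioc, Finset.mem_insert]
      omega
    rw [subdivisionSum_of_lt a (by omega), hI, Finset.sum_insert (by simp), word_succ,
      add_sub_right_comm, ← mul_sub]
    refine Submodule.add_mem _ (ι_mul_mem_lenLT _ ?_) (Submodule.sum_mem _ fun m hm => ?_)
    · rw [show i + (k + 1) = i + 1 + k by ring]
      exact ih
    · rw [Finset.mem_Ioc] at hm
      exact lenLT_mono (by omega) (ι_mul_mem_lenLT _ (subdivisionSum_mem a hm.2))

end Subdivision

/-! ### The bar construction of a differential graded algebra -/

section BarOfDGA

variable {K : Type*} [Field K] {A : Type*} [NonUnitalRing A] [Module K A]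
  [IsScalarTower K A A] [SMulCommClass K A A] (D : DGA K A) (c : K)
  {V : Type*} [AddCommGroup V] [Module K V]

local notation:70 f:70 " ⋆ " g:71 => conv f g

/-- The corestriction `c (d + (a, b) ↦ (-1)^|a| a b)` of the differential of the bar construction
of a differential graded algebra. -/
noncomputable def barA : TensorAlgebra K A →ₗ[K] A :=
  c • (D.d ∘ₗ letter + (D.sgn ∘ₗ letter) ⋆ letter)

/-- The differential of the bar construction of a differential graded algebra. -/
noncomputable def diffA : TensorAlgebra K A →ₗ[K] TensorAlgebra K A := coDer (-D.sgn) (barA D c)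

theorem barA_one : barA D c 1 = 0 := by simp [barA, conv_one]

theorem barA_ι (a : A) : barA D c (ι K a) = c • D.d a := by
  have h := letter_conv_ι_mul D.sgn (letter : TensorAlgebra K A →ₗ[K] A) a 1
  rw [mul_one] at h
  simp [barA, h, letter_ι]

theorem diffA_ι (a : A) : diffA D c (ι K a) = ι K (c • D.d a) := by
  rw [diffA, coDer_ι _ (barA_one D c), barA_ι]

theorem barA_comp_coHom {f : TensorAlgebra K V →ₗ[K] A} (hf : f 1 = 0) :
    barA D c ∘ₗ coHom f = c • (D.d ∘ₗ f + (D.sgn ∘ₗ f) ⋆ f) := by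
  rw [barA, LinearMap.smul_comp, LinearMap.add_comp, conv_comp_coHom hf, LinearMap.comp_assoc,
    LinearMap.comp_assoc, letter_comp_coHom hf]

theorem sgn_comp_sgn : D.sgn ∘ₗ D.sgn = LinearMap.id := LinearMap.ext D.sgn_sgn

theorem neg_sgn_comp_neg_sgn : (-D.sgn) ∘ₗ (-D.sgn) = LinearMap.id := by
  rw [LinearMap.neg_comp, LinearMap.comp_neg, neg_neg, sgn_comp_sgn]

theorem d_comp_sgn : D.d ∘ₗ D.sgn = -(D.sgn ∘ₗ D.d) := LinearMap.ext D.d_sgn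

theorem sgn_comp_conv (f g : TensorAlgebra K V →ₗ[K] A) :
    D.sgn ∘ₗ (f ⋆ g) = (D.sgn ∘ₗ f) ⋆ (D.sgn ∘ₗ g) := comp_conv _ D.sgn_mul f g

theorem d_comp_conv (f g : TensorAlgebra K V →ₗ[K] A) :
    D.d ∘ₗ (f ⋆ g) = (D.d ∘ₗ f) ⋆ g + (D.sgn ∘ₗ f) ⋆ (D.d ∘ₗ g) := by
  refine ext_word fun x k => ?_
  simp only [LinearMap.comp_apply, LinearMap.add_apply, conv_word, map_sum, D.d_mul,
    Finset.sum_add_distrib]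

theorem barA_comp_tmap :
    barA D c ∘ₗ (tmap K (-D.sgn)).toLinearMap = -((-D.sgn) ∘ₗ barA D c) := by
  have e : ((-D.sgn) ∘ₗ letter : TensorAlgebra K A →ₗ[K] A) = -(D.sgn ∘ₗ letter) := rfl
  rw [LinearMap.neg_comp, neg_neg, barA, LinearMap.smul_comp, LinearMap.add_comp, conv_comp_tmap,
    LinearMap.comp_assoc, LinearMap.comp_assoc, letter_comp_tmap, e, LinearMap.comp_smul,
    LinearMap.comp_add, sgn_comp_conv, LinearMap.comp_neg, LinearMap.comp_neg,
    ← LinearMap.comp_assoc letter, ← LinearMap.comp_assoc letter, sgn_comp_sgn, d_comp_sgn,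
    neg_conv, conv_neg, neg_neg, LinearMap.neg_comp, neg_neg, LinearMap.comp_assoc]

theorem barA_comp_diffA : barA D c ∘ₗ diffA D c = 0 := by
  have h0 : D.d ∘ₗ D.d = 0 := LinearMap.ext D.d_d
  have h : (D.d ∘ₗ letter + (D.sgn ∘ₗ letter) ⋆ letter) ∘ₗ diffA D c = 0 := by
    rw [LinearMap.add_comp, diffA, conv_comp_coDer, LinearMap.comp_assoc, LinearMap.comp_assoc,
      LinearMap.comp_assoc, letter_comp_coDer, letter_comp_tmap, barA]
    simp only [LinearMap.comp_smul, smul_conv, conv_smul, ← smul_add]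
    rw [LinearMap.comp_add, LinearMap.comp_add, d_comp_conv, sgn_comp_conv,
      ← LinearMap.comp_assoc letter, ← LinearMap.comp_assoc letter, ← LinearMap.comp_assoc letter,
      ← LinearMap.comp_assoc letter, ← LinearMap.comp_assoc letter, LinearMap.comp_neg,
      sgn_comp_sgn, h0, d_comp_sgn, LinearMap.id_comp, LinearMap.neg_comp, LinearMap.neg_comp,
      LinearMap.id_comp, LinearMap.zero_comp, neg_conv, neg_conv, add_conv, conv_add, conv_assoc,
      LinearMap.comp_assoc]
    rw [smul_eq_zero]
    right
    abel
  rw [barA, LinearMap.smul_comp, h, smul_zero]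

theorem diffA_diffA : diffA D c ∘ₗ diffA D c = 0 := by
  refine rec_unique (c := 0) (a := ι K ∘ₗ letter) (by simp) ?_ ?_
  · have := coDer_comp_coDer (neg_sgn_comp_neg_sgn D) (barA_comp_tmap D c)
    have h0 : barA D c ∘ₗ coDer (-D.sgn) (barA D c) = 0 := barA_comp_diffA D c
    rwa [h0, LinearMap.comp_zero, zero_conv] at this
  · rw [zero_add]
    refine ext_word fun x k => ?_
    simp [conv_word]

/-- The differential of the bar construction agrees, up to shorter words, with that of the tensor
powers of the complex `A`. -/
theorem lowers_diffA_sub : Lowers 1 (diffA D c - coDer (-D.sgn) ((c • D.d) ∘ₗ letter)) := by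
  rw [diffA, ← coDer_sub]
  refine lowers_coDer _ (agreeBelow_two ?_ fun a => ?_)
  · simp [barA_one]
  · simp [barA_ι, letter_ι]

theorem conv_id_ι_mul (a : A) (t : TensorAlgebra K A) :
    ((ι K ∘ₗ barA D c) ⋆ LinearMap.id) (ι K a * t) = c • (ι K (D.d a) * t +
      ((ι K ∘ₗ LinearMap.mulLeft K (D.sgn a) ∘ₗ letter) ⋆ LinearMap.id) t) := by
  have h2 : ((D.sgn ∘ₗ letter) ⋆ letter) ∘ₗ LinearMap.mulLeft K (ι K a) =
      LinearMap.mulLeft K (D.sgn a) ∘ₗ letter := by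
    refine LinearMap.ext fun t => ?_
    rw [LinearMap.comp_apply, LinearMap.mulLeft_apply, letter_conv_ι_mul]
    rfl
  have h1 : (ι K ∘ₗ D.d ∘ₗ letter) ⋆ LinearMap.id = ((ι K ∘ₗ D.d) ∘ₗ letter) ⋆ LinearMap.id := rfl
  rw [barA, LinearMap.comp_smul, smul_conv, LinearMap.comp_add, add_conv, LinearMap.smul_apply,
    LinearMap.add_apply, h1, letter_conv_ι_mul, conv_ι_mul, LinearMap.comp_assoc _ _ (ι K), h2]
  simp [conv_one]

/-! ### Defining systems as cochains of the bar construction -/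

/-- The failure `d a_{ij} + ∑ (-1)^|a_ik| a_ik a_kj` of the equation of a defining system. -/
noncomputable def mcDefect (a : ℕ → ℕ → A) (i j : ℕ) : A :=
  D.d (a i j) + ∑ k ∈ Finset.Ioo i j, D.sgn (a i k) * a k j

theorem diffA_subdivisionSum_of_lt (a : ℕ → ℕ → A) {i j : ℕ} (hij : i < j)
    (h : ∀ m, i < m → m ≤ j → diffA D c (subdivisionSum a j m) = 0) :
    diffA D c (subdivisionSum a j i) =
      c • ∑ l ∈ Finset.Ioc i j, ι K (mcDefect D a i l) * subdivisionSum a j l := by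
  have hmul : ∀ m ∈ Finset.Ioc i j,
      ((ι K ∘ₗ LinearMap.mulLeft K (D.sgn (a i m)) ∘ₗ letter) ⋆ LinearMap.id)
        (subdivisionSum a j m) =
      ∑ l ∈ Finset.Ioc m j, ι K (D.sgn (a i m) * a m l) * subdivisionSum a j l := by
    intro m hm
    rw [Finset.mem_Ioc] at hm
    rcases hm.2.lt_or_eq with h1 | rfl
    · rw [subdivisionSum_of_lt a h1, map_sum]
      refine Finset.sum_congr rfl fun l _ => ?_
      rw [← LinearMap.comp_assoc, letter_conv_ι_mul]
      rfl
    · simp [subdivisionSum_self, conv_one]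
  have hterm : ∀ m ∈ Finset.Ioc i j, diffA D c (ι K (a i m) * subdivisionSum a j m) =
      c • (ι K (D.d (a i m)) * subdivisionSum a j m +
        ∑ l ∈ Finset.Ioc m j, ι K (D.sgn (a i m) * a m l) * subdivisionSum a j l) := by
    intro m hm
    have hm' := Finset.mem_Ioc.1 hm
    rw [diffA, coDer_ι_mul, conv_id_ι_mul, hmul m hm]
    have := h m hm'.1 hm'.2
    rw [diffA] at this
    rw [this, mul_zero, add_zero]
  rw [subdivisionSum_of_lt a hij, map_sum, Finset.sum_congr rfl hterm, ← Finset.smul_sum,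
    Finset.sum_add_distrib]
  congr 1
  simp only [mcDefect, map_add, add_mul, Finset.sum_add_distrib, map_sum, Finset.sum_mul]
  congr 1
  refine Finset.sum_comm' fun m l => ?_
  simp
  omega

/-- If the equation of a defining system holds on all proper subintervals of `[i, j]`, then the
sum over the subdivisions is a cochain whose boundary is the defect on `[i, j]`. -/
theorem diffA_subdivisionSum (a : ℕ → ℕ → A) {i j : ℕ} (hij : i < j)
    (h : ∀ k l, i ≤ k → k < l → l ≤ j → (k, l) ≠ (i, j) → mcDefect D a k l = 0) :
    diffA D c (subdivisionSum a j i) = c • ι K (mcDefect D a i j) := by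
  have h0 : ∀ d m, m + d = j → i < m → diffA D c (subdivisionSum a j m) = 0 := by
    intro d
    induction d using Nat.strong_induction_on with
    | _ d ih =>
      intro m hm him
      rcases Nat.eq_zero_or_pos d with rfl | hd
      · obtain rfl : m = j := by omega
        rw [subdivisionSum_self, diffA, coDer_one _ (barA_one D c)]
      · rw [diffA_subdivisionSum_of_lt D c a (by omega)
          fun m' h1 h2 => ih (j - m') (by omega) m' (by omega) (by omega)]
        rw [Finset.sum_eq_zero, smul_zero]
        intro l hl
        rw [Finset.mem_Ioc] at hl
        rw [h m l (by omega) hl.1 hl.2 (by simp; omega), map_zero, zero_mul]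
  rw [diffA_subdivisionSum_of_lt D c a hij fun m h1 h2 => h0 (j - m) m (by omega) h1,
    Finset.sum_eq_single j]
  · rw [subdivisionSum_self, mul_one]
  · intro l hl hlj
    rw [Finset.mem_Ioc] at hl
    rw [h i l le_rfl hl.1 hl.2 (by simp; omega), map_zero, zero_mul]
  · intro hj
    exact absurd (Finset.mem_Ioc.2 ⟨hij, le_rfl⟩) hj

end BarOfDGA

end BarConstruction

namespace DGA

variable {K : Type*} [Field K] {A : Type*} [NonUnitalRing A] [Module K A]
  [IsScalarTower K A A] [SMulCommClass K A A] {D : DGA K A}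

/-- `∑ ā_{ik} a_{kj}` in terms of the sign involution. -/
theorem sysSum_eq {n : ℕ} {p : Fin n → ℤ} {a : ℕ → ℕ → A}
    (ha : ∀ i j : ℕ, i < j → j ≤ n → j - i ≤ n - 1 → a i j ∈ D.gr (sysDeg p i j)) {i j : ℕ}
    (hj : j ≤ n) : sysSum p a i j = -∑ k ∈ Finset.Ioo i j, D.sgn (a i k) * a k j := by
  rw [sysSum, ← Finset.sum_neg_distrib]
  refine Finset.sum_congr rfl fun k hk => ?_
  rw [Finset.mem_Ioo] at hk
  rw [D.sgn_of_mem (ha i k hk.1 (by omega) (by omega)), Int.negOnePow_succ, Units.neg_smul,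
    neg_mul]

end DGA

namespace BarConstruction

open TensorAlgebra (ι)

/-! ### Massey products and morphisms to the bar construction -/

section Functoriality

variable {K U V W : Type*} [Field K] [AddCommGroup U] [Module K U] [AddCommGroup V] [Module K V]
  [AddCommGroup W] [Module K W]

theorem tmap_tmap (φ : U →ₗ[K] V) (ψ : V →ₗ[K] W) (t : TensorAlgebra K U) :
    tmap K ψ (tmap K φ t) = tmap K (ψ ∘ₗ φ) t := by
  have : (tmap K ψ).comp (tmap K φ) = tmap K (ψ ∘ₗ φ) := by
    ext u
    simp [tmap_ι]
  exact DFunLike.congr_fun this t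

theorem tmap_id (t : TensorAlgebra K V) : tmap K (LinearMap.id : V →ₗ[K] V) t = t := by
  have : tmap K (LinearMap.id : V →ₗ[K] V) = AlgHom.id K _ := by
    ext u
    simp [tmap_ι]
  exact DFunLike.congr_fun this t

theorem tmap_coDer_letter (σ d : V →ₗ[K] V) (π : V →ₗ[K] W) (hπ : π ∘ₗ d = 0)
    (t : TensorAlgebra K V) : tmap K π (coDer σ (d ∘ₗ letter) t) = 0 := by
  have : (tmap K π).toLinearMap ∘ₗ coDer σ (d ∘ₗ letter) = 0 := by
    refine ext_one_ι_mul ?_ fun v t ht => ?_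
    · simp [coDer_one]
    · have h : π (d v) = 0 := LinearMap.congr_fun hπ v
      simp only [LinearMap.comp_apply, AlgHom.toLinearMap_apply, LinearMap.zero_apply] at ht ⊢
      rw [coDer_ι_mul, ← LinearMap.comp_assoc, letter_conv_ι_mul, map_add, map_mul, map_mul, ht]
      simp [tmap_ι, h]
  exact LinearMap.congr_fun this t

end Functoriality

section Comparison

variable {K : Type*} [Field K] {A : Type*} [NonUnitalRing A] [Module K A]
  [IsScalarTower K A A] [SMulCommClass K A A] {D : DGA K A}

theorem coHom_ι {V W : Type*} [AddCommGroup V] [Module K V] [AddCommGroup W] [Module K W]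
    {f : TensorAlgebra K V →ₗ[K] W} (hf : f 1 = 0) (v : V) :
    coHom f (ι K v) = ι K (f (ι K v)) := by
  have h := LinearMap.congr_fun (coHom_eq hf) (word K (fun _ => v) 0 1)
  have h0 : (convUnit (TensorAlgebra K W) : TensorAlgebra K V →ₗ[K] _) (ι K v) = 0 := by
    have := convUnit_ι_mul (R := TensorAlgebra K W) v (1 : TensorAlgebra K V)
    rwa [mul_one] at this
  rw [LinearMap.add_apply, conv_word] at h
  simpa [Finset.sum_range_succ, hf, h0, coHom_one hf] using h

/-- The corestriction of a coalgebra map determines whether it is a morphism of complexes. -/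
theorem diffA_comp_coHom {c : K} {b : TensorAlgebra K D.Cohomology →ₗ[K] D.Cohomology}
    {f : TensorAlgebra K D.Cohomology →ₗ[K] A} (hf1 : f 1 = 0)
    (hσ : (-D.sgn) ∘ₗ f = f ∘ₗ (tmap K (-D.sgnH)).toLinearMap)
    (hF : barA D c ∘ₗ coHom f = f ∘ₗ coDer (-D.sgnH) b) :
    diffA D c ∘ₗ coHom f = coHom f ∘ₗ coDer (-D.sgnH) b := by
  rw [← sub_eq_zero]
  refine rec_unique (c := 0) (a := ι K ∘ₗ (f ∘ₗ (tmap K (-D.sgnH)).toLinearMap))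
    (by simp [hf1]) ?_ ?_
  · have := coDer_comp_coHom_sub b (barA D c) hf1 hσ
    rwa [hF, sub_self, LinearMap.comp_zero, zero_conv] at this
  · rw [zero_add]
    refine ext_word fun x k => ?_
    simp [conv_word]

/-- A morphism from a minimal structure to the bar construction which induces the identity in
cohomology reflects boundaries, with control of the leading terms: this is the comparison theorem
of the spectral sequences of the length filtrations. -/
theorem exists_coDer_eq {c : K} (hc : c * c = 1)
    {b : TensorAlgebra K D.Cohomology →ₗ[K] D.Cohomology}
    {f : TensorAlgebra K D.Cohomology →ₗ[K] A} (hb1 : b 1 = 0) (hbι : ∀ h, b (ι K h) = 0)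
    (hf1 : f 1 = 0) {φ : D.Cohomology →ₗ[K] A} (hfφ : ∀ h, f (ι K h) = φ h)
    (hrep : ∀ h, D.Represents (φ h) h) (hgr : ∀ p, ∀ h ∈ D.grH p, φ h ∈ D.gr p)
    (hσ : (-D.sgn) ∘ₗ f = f ∘ₗ (tmap K (-D.sgnH)).toLinearMap)
    (hF : barA D c ∘ₗ coHom f = f ∘ₗ coDer (-D.sgnH) b) {n : ℕ} {w : TensorAlgebra K A}
    {z : TensorAlgebra K D.Cohomology} (hw : w ∈ lenLT K A (n + 1))
    (hz : z ∈ lenLT K D.Cohomology n) (h : coHom f z = diffA D c w) :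
    ∃ z', coDer (-D.sgnH) b z' = z ∧ z' - tmap K D.toCoh w ∈ lenLT K D.Cohomology n := by
  obtain ⟨q, hq⟩ : ∃ q, q = φ ∘ₗ D.toCoh := ⟨_, rfl⟩
  obtain ⟨k, hk⟩ : ∃ k, k = D.homotopy φ := ⟨_, rfl⟩
  have e1 : (c • D.d) ∘ₗ q = 0 := LinearMap.ext fun a => by
    simp [hq, (hrep (D.toCoh a)).d_eq_zero]
  have e2 : D.toCoh ∘ₗ (c • D.d) = 0 := LinearMap.ext fun a => by simp [D.toCoh_d]
  have e3 : (c • k) ∘ₗ (-D.sgn) = -((-D.sgn) ∘ₗ (c • k)) := LinearMap.ext fun a => by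
    have := D.comp_sgn_of_odd (φ := k) (e := -1) (by decide)
      (fun p a ha => hk ▸ D.homotopy_mem hgr ha) a
    simp [this]
  have e4 : q ∘ₗ (-D.sgn) = (-D.sgn) ∘ₗ q := by
    have : q ∘ₗ D.sgn = D.sgn ∘ₗ q := LinearMap.ext_of_iSup_eq_top D.iSup_gr fun p a ha => by
      have hqa : q a ∈ D.gr p := hq ▸ hgr p _ (D.toCoh_mem ha)
      change q (D.sgn a) = D.sgn (q a)
      rw [D.sgn_of_mem ha, D.sgn_of_mem hqa, negOnePow_smul_eq (K := K), map_smul,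
        ← negOnePow_smul_eq]
    rw [LinearMap.comp_neg, LinearMap.neg_comp, this]
  have e5 : (c • D.d) ∘ₗ (c • k) + (c • k) ∘ₗ (c • D.d) = LinearMap.id - q :=
    LinearMap.ext fun a => by
      have h1 := D.d_homotopy hrep a
      have h2 := D.homotopy_d φ a
      simp only [LinearMap.add_apply, LinearMap.comp_apply, LinearMap.smul_apply, map_smul,
        smul_smul, hc, one_smul, LinearMap.sub_apply, LinearMap.id_apply]
      rw [hk, h1, h2, hq, LinearMap.comp_apply]
      abel
  have e6 : D.toCoh ∘ₗ φ = LinearMap.id := LinearMap.ext fun a => (hrep a).toCoh_eq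
  have hspec := tensorHomotopy_spec (neg_sgn_comp_neg_sgn D) e1
    (by rw [hq, LinearMap.comp_assoc, e2, LinearMap.comp_zero]) e3 e4 e5
  have hFI := lowers_coHom_sub_tmap (f := f) (φ := φ) hf1 hfφ
  have hchain := diffA_comp_coHom hf1 hσ hF
  have key := exists_primitive (filM := lenLT K D.Cohomology) (filN := lenLT K A)
    (δ := coDer (-D.sgnH) b) (δ' := diffA D c) (D := coDer (-D.sgn) ((c • D.d) ∘ₗ letter))
    (H := tensorHomotopy (-D.sgn) q (c • k)) (F := coHom f) (I := (tmap K φ).toLinearMap)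
    (P := (tmap K D.toCoh).toLinearMap) lenLT_zero (fun _ _ h => lenLT_mono h)
    (fun k t ht => (lowers_coDer (e := 1) _ (agreeBelow_two hb1 hbι)).mem ht)
    (fun k t ht => (lowers_diffA_sub D c).mem ht)
    (fun k t ht => (lowers_coHom hf1).mem ht)
    (fun k t ht => hFI.mem ht)
    (fun k t ht => (lowers_tmap _).mem ht)
    (fun k t ht => (lowers_tensorHomotopy _ _ _).mem ht)
    (fun t => by
      have := LinearMap.congr_fun hspec t
      rw [LinearMap.add_apply, LinearMap.comp_apply, LinearMap.comp_apply, LinearMap.sub_apply,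
        LinearMap.id_apply] at this
      rw [this, AlgHom.toLinearMap_apply, AlgHom.toLinearMap_apply, AlgHom.toLinearMap_apply,
        tmap_tmap, hq])
    (fun t => tmap_coDer_letter _ _ _ e2 t)
    (fun t => by
      rw [AlgHom.toLinearMap_apply, AlgHom.toLinearMap_apply, tmap_tmap, e6, tmap_id])
    (fun t => LinearMap.congr_fun (diffA_diffA D c) t)
    (fun t => LinearMap.congr_fun hchain t) n w z hw hz h
  obtain ⟨z', -, hz1, hz2⟩ := key
  exact ⟨z', hz1, hz2⟩

/-- A defining system for `y ∈ ⟨x₁, …, xₙ⟩` yields a cochain of the bar construction with leading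
term `-c x₁⋯xₙ` and boundary a given representative of `y`. -/
theorem exists_diffA_eq {c : K} (hc : c * c = 1) {n : ℕ} (hn : 2 ≤ n) {p : Fin n → ℤ}
    {x : Fin n → D.Cohomology} {y : D.Cohomology} (hy : y ∈ D.masseyProduct p x)
    {x' : ℕ → D.Cohomology} (hx' : ∀ j : Fin n, x' j = x j) {z : A} (hz : D.Represents z y) :
    ∃ w ∈ lenLT K A (n + 1), diffA D c w = ι K z ∧
      tmap K D.toCoh w + c • word K x' 0 n ∈ lenLT K D.Cohomology n := by
  obtain ⟨a, ha, hay⟩ := hy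
  obtain ⟨a', ha'n, ha'eq⟩ : ∃ a' : ℕ → ℕ → A, a' 0 n = 0 ∧
      ∀ i j, (i, j) ≠ (0, n) → a' i j = a i j := by
    refine ⟨fun i j => if i = 0 ∧ j = n then 0 else a i j, by simp, fun i j hij => if_neg ?_⟩
    rintro ⟨rfl, rfl⟩
    exact hij rfl
  have hsum : ∀ i j, j ≤ n → ∑ k ∈ Finset.Ioo i j, D.sgn (a' i k) * a' k j =
      -DGA.sysSum p a i j := by
    intro i j hj
    rw [DGA.sysSum_eq ha.mem hj, neg_neg]
    refine Finset.sum_congr rfl fun k hk => ?_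
    rw [Finset.mem_Ioo] at hk
    rw [ha'eq i k (by simp; omega), ha'eq k j (by simp; omega)]
  have hdef : ∀ k l, 0 ≤ k → k < l → l ≤ n → (k, l) ≠ (0, n) → mcDefect D a' k l = 0 := by
    intro k l _ hkl hl hne
    have hne' : l - k ≤ n - 1 := by
      by_contra hcon
      exact hne (by ext <;> simp <;> omega)
    rw [mcDefect, hsum k l hl, ha'eq k l hne]
    by_cases h2 : 2 ≤ l - k
    · rw [ha.d_eq k l hl h2 hne', add_neg_cancel]
    · have hkn : k < n := by omega
      obtain rfl : l = k + 1 := by omega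
      have := (ha.represents ⟨k, hkn⟩).d_eq_zero
      rw [this, DGA.sysSum, Finset.sum_eq_zero, neg_zero, add_zero]
      intro m hm
      rw [Finset.mem_Ioo] at hm
      omega
  have hΦ := diffA_subdivisionSum D c a' (show 0 < n by omega) hdef
  have hdef0 : mcDefect D a' 0 n = -DGA.sysSum p a 0 n := by
    rw [mcDefect, hsum 0 n le_rfl, ha'n, map_zero, zero_add]
  rw [hdef0] at hΦ
  obtain ⟨u, hu⟩ := hz.exists_eq_d hay
  have hιu : ι K u ∈ lenLT K A 2 := by
    rw [← word_one K (fun _ => u) 0]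
    exact word_mem_lenLT _ _ (by omega)
  refine ⟨-(c • subdivisionSum a' n 0) + c • ι K u, ?_, ?_, ?_⟩
  · refine Submodule.add_mem _ (Submodule.neg_mem _ (Submodule.smul_mem _ _ ?_))
      (Submodule.smul_mem _ _ (lenLT_mono (by omega) hιu))
    have := subdivisionSum_mem (K := K) a' (Nat.zero_le n)
    rwa [Nat.sub_zero] at this
  · have hz' : z = DGA.sysSum p a 0 n + D.d u := by rw [← hu]; abel
    rw [map_add, map_neg, map_smul, map_smul, hΦ, diffA_ι, map_neg, smul_neg, smul_neg,
      neg_neg, smul_smul, hc, one_smul, map_smul, smul_smul, hc, one_smul, ← map_add, ← hz']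
  · have h1 : word K x' 0 n = tmap K D.toCoh (word K (fun j => a' j (j + 1)) 0 n) := by
      rw [tmap_word]
      refine word_congr fun j hj => ?_
      rw [zero_add, ha'eq _ _ (by simp; omega), hx' ⟨j, hj⟩]
      exact (ha.represents ⟨j, hj⟩).toCoh_eq.symm
    have h2 : tmap K D.toCoh (-(c • subdivisionSum a' n 0) + c • ι K u) + c • word K x' 0 n =
        -(c • tmap K D.toCoh
          (subdivisionSum a' (0 + n) 0 - word K (fun j => a' j (j + 1)) 0 n)) +
        c • tmap K D.toCoh (ι K u) := by
      rw [h1, zero_add]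
      simp only [map_add, map_neg, map_smul, map_sub, smul_sub]
      abel
    rw [h2]
    refine Submodule.add_mem _ (Submodule.neg_mem _ (Submodule.smul_mem _ _ ?_))
      (Submodule.smul_mem _ _ ?_)
    · exact (lowers_tmap D.toCoh).mem (subdivisionSum_sub_mem a')
    · exact lenLT_mono hn ((lowers_tmap D.toCoh).mem hιu)

/-- A morphism `f` from a minimal structure `b` on the cohomology to the bar construction of `A`,
which induces the identity in cohomology, relates `b` on `x₁⋯xₙ` to the Massey products, up to
values of `b` on shorter words. -/
theorem bar_word_eq_massey {c : K} (hc : c * c = 1)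
    {b : TensorAlgebra K D.Cohomology →ₗ[K] D.Cohomology}
    {f : TensorAlgebra K D.Cohomology →ₗ[K] A} (hb1 : b 1 = 0) (hbι : ∀ h, b (ι K h) = 0)
    (hf1 : f 1 = 0) (hrep : ∀ h, D.Represents (f (ι K h)) h)
    (hgr : ∀ p, ∀ h ∈ D.grH p, f (ι K h) ∈ D.gr p)
    (hσ : (-D.sgn) ∘ₗ f = f ∘ₗ (tmap K (-D.sgnH)).toLinearMap)
    (hF : barA D c ∘ₗ coHom f = f ∘ₗ coDer (-D.sgnH) b)
    {n : ℕ} (hn : 2 ≤ n) {p : Fin n → ℤ} {x : Fin n → D.Cohomology} {y : D.Cohomology}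
    (hy : y ∈ D.masseyProduct p x) {x' : ℕ → D.Cohomology} (hx' : ∀ j : Fin n, x' j = x j) :
    ∃ t ∈ lenLT K D.Cohomology n, b (word K x' 0 n) = -(c • y) + b t := by
  obtain ⟨w, hw, hdw, hPw⟩ := exists_diffA_eq hc hn hy hx' (hrep y)
  have hιy : ι K y ∈ lenLT K D.Cohomology n := by
    rw [← word_one K (fun _ => y) 0]
    exact word_mem_lenLT _ _ (by omega)
  obtain ⟨z', hz1, hz2⟩ := exists_coDer_eq hc hb1 hbι hf1 (φ := f ∘ₗ ι K) (fun _ => rfl) hrep hgr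
    hσ hF hw hιy (by rw [hdw, coHom_ι hf1])
  have hbz : b z' = y := by
    have := LinearMap.congr_fun (letter_comp_coDer (-D.sgnH) b) z'
    rw [← this, LinearMap.comp_apply, hz1, letter_ι]
  refine ⟨c • (z' + c • word K x' 0 n), Submodule.smul_mem _ _ ?_, ?_⟩
  · have : z' + c • word K x' 0 n = (z' - tmap K D.toCoh w) +
        (tmap K D.toCoh w + c • word K x' 0 n) := by abel
    rw [this]
    exact Submodule.add_mem _ hz2 hPw
  · rw [map_smul, map_add, map_smul, hbz, smul_add, smul_smul, hc, one_smul]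
    abel

end Comparison

end BarConstruction

namespace BarConstruction

open TensorAlgebra (ι)

/-! ### Degrees -/

section Degree

variable {K M N P : Type*} [Field K] [AddCommGroup M] [Module K M] [AddCommGroup N] [Module K N]
  [AddCommGroup P] [Module K P]

/-- The map `f` has degree `e` for the gradings `G` and `G'`. -/
def HasDegree (G : ℤ → Submodule K M) (G' : ℤ → Submodule K N) (e : ℤ) (f : M →ₗ[K] N) : Prop :=
  ∀ q, ∀ t ∈ G q, f t ∈ G' (q + e)

variable {G : ℤ → Submodule K M} {G' : ℤ → Submodule K N} {G'' : ℤ → Submodule K P} {e : ℤ}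

theorem HasDegree.comp {e' : ℤ} {f : M →ₗ[K] N} {g : N →ₗ[K] P} (hg : HasDegree G' G'' e' g)
    (hf : HasDegree G G' e f) : HasDegree G G'' (e + e') (g ∘ₗ f) := by
  intro q t ht
  rw [← add_assoc]
  exact hg _ _ (hf q t ht)

theorem HasDegree.zero : HasDegree G G' e (0 : M →ₗ[K] N) :=
  fun _ _ _ => Submodule.zero_mem _

theorem HasDegree.add {f g : M →ₗ[K] N} (hf : HasDegree G G' e f) (hg : HasDegree G G' e g) :
    HasDegree G G' e (f + g) :=
  fun q t ht => Submodule.add_mem _ (hf q t ht) (hg q t ht)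

theorem HasDegree.sub {f g : M →ₗ[K] N} (hf : HasDegree G G' e f) (hg : HasDegree G G' e g) :
    HasDegree G G' e (f - g) :=
  fun q t ht => Submodule.sub_mem _ (hf q t ht) (hg q t ht)

theorem HasDegree.smul (c : K) {f : M →ₗ[K] N} (hf : HasDegree G G' e f) :
    HasDegree G G' e (c • f) :=
  fun q t ht => Submodule.smul_mem _ c (hf q t ht)

theorem HasDegree.of_eq {e' : ℤ} {f : M →ₗ[K] N} (hf : HasDegree G G' e f) (h : e = e') :
    HasDegree G G' e' f := h ▸ hf

end Degree

section WordDegree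

variable {K V W : Type*} [Field K] [AddCommGroup V] [Module K V] [AddCommGroup W] [Module K W]
  {gr : ℤ → Submodule K V} {gr' : ℤ → Submodule K W}

local notation:70 f:70 " ⋆ " g:71 => conv f g

/-- The grading of the tensor coalgebra of the suspension, where `v` has degree `|v| - 1`. -/
def wordGr (gr : ℤ → Submodule K V) (q : ℤ) : Submodule K (TensorAlgebra K V) :=
  Submodule.span K {t | ∃ (p : ℕ → ℤ) (x : ℕ → V) (k : ℕ), (∀ j, x j ∈ gr (p j)) ∧
    ∑ j ∈ Finset.range k, (p j - 1) = q ∧ t = word K x 0 k}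

theorem word_mem_wordGr {p : ℕ → ℤ} {x : ℕ → V} (hx : ∀ j, x j ∈ gr (p j)) (a k : ℕ) :
    word K x a k ∈ wordGr gr (∑ j ∈ Finset.range k, (p (a + j) - 1)) :=
  Submodule.subset_span ⟨fun j => p (a + j), fun j => x (a + j), k, fun _ => hx _, rfl,
    word_congr fun j _ => by simp⟩

theorem map_mem_of_mem_wordGr {f : TensorAlgebra K V →ₗ[K] W} {S : Submodule K W} {q : ℤ}
    (h : ∀ (p : ℕ → ℤ) (x : ℕ → V) (k : ℕ), (∀ j, x j ∈ gr (p j)) →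
      ∑ j ∈ Finset.range k, (p j - 1) = q → f (word K x 0 k) ∈ S)
    {t : TensorAlgebra K V} (ht : t ∈ wordGr gr q) : f t ∈ S := by
  have : wordGr gr q ≤ S.comap f := by
    rw [wordGr, Submodule.span_le]
    rintro _ ⟨p, x, k, hx, hq, rfl⟩
    exact h p x k hx hq
  exact this ht

theorem hasDegree_word {e : ℤ} {f : TensorAlgebra K V →ₗ[K] W}
    (h : ∀ (p : ℕ → ℤ) (x : ℕ → V) (k : ℕ), (∀ j, x j ∈ gr (p j)) →
      f (word K x 0 k) ∈ gr' (∑ j ∈ Finset.range k, (p j - 1) + e)) :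
    HasDegree (wordGr gr) gr' e f :=
  fun _ _ ht => map_mem_of_mem_wordGr (fun p x k hx hq => hq ▸ h p x k hx) ht

theorem HasDegree.word_mem {e : ℤ} {f : TensorAlgebra K V →ₗ[K] W}
    (hf : HasDegree (wordGr gr) gr' e f) {p : ℕ → ℤ} {x : ℕ → V} (hx : ∀ j, x j ∈ gr (p j))
    (a k : ℕ) : f (word K x a k) ∈ gr' (∑ j ∈ Finset.range k, (p (a + j) - 1) + e) :=
  hf _ _ (word_mem_wordGr hx a k)

theorem ι_mul_mem_wordGr {p q : ℤ} {v : V} (hv : v ∈ gr p) {t : TensorAlgebra K V}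
    (ht : t ∈ wordGr gr q) : ι K v * t ∈ wordGr gr (p - 1 + q) := by
  refine map_mem_of_mem_wordGr (f := LinearMap.mulLeft K (ι K v)) (fun p' x k hx hq => ?_) ht
  rw [LinearMap.mulLeft_apply, exists_word_cons]
  have := word_mem_wordGr (K := K) (gr := gr) (p := fun j => Nat.casesOn j p p')
    (x := fun j => Nat.casesOn j v x) (fun j => by cases j <;> simp [hv, hx]) 0 (k + 1)
  rw [Finset.sum_range_succ'] at this
  simp only [zero_add, hq, add_comm q] at this
  exact this

/-- A fixed point has degree `e` if the operator preserves the maps of degree `e`. -/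
theorem HasDegree.fixedPoint {e : ℤ}
    {Ψ : (TensorAlgebra K V →ₗ[K] W) → (TensorAlgebra K V →ₗ[K] W)}
    (hΨ : ∀ f, HasDegree (wordGr gr) gr' e f → HasDegree (wordGr gr) gr' e (Ψ f)) :
    HasDegree (wordGr gr) gr' e (fixedPoint Ψ) := by
  have h : ∀ m, HasDegree (wordGr gr) gr' e (Ψ^[m] 0) := by
    intro m
    induction m with
    | zero => exact HasDegree.zero
    | succ m ih =>
      rw [Function.iterate_succ_apply']
      exact hΨ _ ih
  refine hasDegree_word fun p x k hx => ?_
  rw [fixedPoint_word]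
  simpa using (h (k + 1)).word_mem hx 0 k

theorem hasDegree_coDer {s : V →ₗ[K] V} (hs : ∀ p, ∀ v ∈ gr p, s v = Int.negOnePow p • v)
    {b : TensorAlgebra K V →ₗ[K] V} (hb1 : b 1 = 0) (hb : HasDegree (wordGr gr) gr 2 b) :
    HasDegree (wordGr gr) (wordGr gr) 1 (coDer (-s) b) := by
  refine hasDegree_word fun p x k hx => ?_
  have key : ∀ a, coDer (-s) b (word K x a k) ∈
      wordGr gr (∑ j ∈ Finset.range k, (p (a + j) - 1) + 1) := by
    induction k with
    | zero => simp [coDer_one _ hb1]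
    | succ k ih =>
      intro a
      rw [word_succ, coDer_ι_mul, ← word_succ, conv_word]
      refine Submodule.add_mem _ (Submodule.sum_mem _ fun u hu => ?_) ?_
      · rw [Finset.mem_range] at hu
        have := ι_mul_mem_wordGr (hb.word_mem hx a u)
          (word_mem_wordGr (K := K) hx (a + u) (k + 1 - u))
        rw [LinearMap.comp_apply, LinearMap.id_apply]
        convert this using 2
        obtain ⟨l, hl⟩ := Nat.exists_eq_add_of_le (show u ≤ k + 1 by omega)
        rw [hl, Finset.sum_range_add, Nat.add_sub_cancel_left]
        simp only [add_assoc]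
        ring
      · have hsv : (-s) (x a) ∈ gr (p a) := by
          rw [LinearMap.neg_apply, hs _ _ (hx a)]
          exact Submodule.neg_mem _ (Submodule.units_smul_mem' _ _ (hx a))
        have := ι_mul_mem_wordGr hsv (ih (a + 1))
        convert this using 2
        rw [Finset.sum_range_succ']
        simp only [add_assoc, add_comm 1, add_zero]
        ring
  simpa using key 0

/-- The signs of a map of the tensor coalgebra of degree `e`. -/
theorem HasDegree.comp_tmap (hgr : ⨆ p, gr p = ⊤) {s : V →ₗ[K] V} {s' : W →ₗ[K] W}
    (hs : ∀ p, ∀ v ∈ gr p, s v = Int.negOnePow p • v)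
    (hs' : ∀ p, ∀ w ∈ gr' p, s' w = Int.negOnePow p • w) {e : ℤ} {f : TensorAlgebra K V →ₗ[K] W}
    (hf : HasDegree (wordGr gr) gr' e f) :
    f ∘ₗ (tmap K (-s)).toLinearMap = Int.negOnePow e • (s' ∘ₗ f) := by
  have hσ : ∀ p, ∀ v ∈ gr p, (-s) v = Int.negOnePow (p + 1) • v := by
    intro p v hv
    rw [LinearMap.neg_apply, hs p v hv, Int.negOnePow_succ, Units.neg_smul]
  refine ext_homogeneous_word hgr fun p x k hx => ?_
  have h := hf.word_mem hx 0 k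
  rw [LinearMap.comp_apply, AlgHom.toLinearMap_apply, tmap_word, word_sign hσ hx,
    negOnePow_smul_eq (K := K), map_smul, ← negOnePow_smul_eq]
  have : (Int.negOnePow e • (s' ∘ₗ f)) (word K x 0 k) =
      Int.negOnePow e • s' (f (word K x 0 k)) := by
    rcases Int.units_eq_one_or (Int.negOnePow e) with h | h <;> simp [h]
  rw [this, hs' _ _ h, smul_smul, ← Int.negOnePow_add]
  congr 1
  rw [Int.negOnePow_eq_iff, Finset.sum_sub_distrib]
  refine ⟨k - e, ?_⟩
  simp
  ring

end WordDegree

section Conv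

variable {K V : Type*} [Field K] [AddCommGroup V] [Module K V] {A : Type*} [NonUnitalRing A]
  [Module K A] [IsScalarTower K A A] [SMulCommClass K A A] (D : DGA K A) {gr : ℤ → Submodule K V}

theorem HasDegree.conv {e e' : ℤ} {f g : TensorAlgebra K V →ₗ[K] A}
    (hf : HasDegree (wordGr gr) D.gr e f) (hg : HasDegree (wordGr gr) D.gr e' g) :
    HasDegree (wordGr gr) D.gr (e + e') (conv f g) := by
  refine hasDegree_word fun p x k hx => ?_
  rw [conv_word]
  refine Submodule.sum_mem _ fun u hu => ?_
  rw [Finset.mem_range] at hu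
  have := D.mul_mem (hf.word_mem hx 0 u) (hg.word_mem hx (0 + u) (k - u))
  convert this using 2
  obtain ⟨l, rfl⟩ := Nat.exists_eq_add_of_le (show u ≤ k by omega)
  rw [Finset.sum_range_add, Nat.add_sub_cancel_left]
  simp only [zero_add]
  ring

end Conv

/-! ### Values of minimal models on words with a Massey product -/

section MinimalModel

variable {K : Type*} [Field K] {A : Type*} [NonUnitalRing A] [Module K A]
  [IsScalarTower K A A] [SMulCommClass K A A] {D : DGA K A}

theorem exists_seq_extension {n : ℕ} {p : Fin n → ℤ} {V : Type*} [AddCommGroup V] [Module K V]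
    {gr : ℤ → Submodule K V} {x : Fin n → V} (hx : ∀ j, x j ∈ gr (p j)) :
    ∃ (p' : ℕ → ℤ) (x' : ℕ → V), (∀ j, x' j ∈ gr (p' j)) ∧ (∀ j : Fin n, p' j = p j) ∧
      ∀ j : Fin n, x' j = x j := by
  refine ⟨fun j => if h : j < n then p ⟨j, h⟩ else 0, fun j => if h : j < n then x ⟨j, h⟩ else 0,
    fun j => ?_, fun j => by simp, fun j => by simp⟩
  by_cases h : j < n
  · simpa [h] using hx ⟨j, h⟩
  · simp [h]

theorem hasDegree_bar {V W : Type*} [AddCommGroup V] [Module K V] [AddCommGroup W] [Module K W]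
    {gr : ℤ → Submodule K V} {gr' : ℤ → Submodule K W} {s : V →ₗ[K] V}
    (hs : ∀ p, ∀ v ∈ gr p, s v = Int.negOnePow p • v)
    {g : (k : ℕ) → MultilinearMap K (fun _ : Fin k => V) W} {e : ℤ} (hg0 : g 0 = 0)
    (hg : ∀ (k : ℕ) (p : Fin k → ℤ) (x : Fin k → V), 1 ≤ k → (∀ j, x j ∈ gr (p j)) →
      g k x ∈ gr' ((∑ j, p j) + e - k)) : HasDegree (wordGr gr) gr' e (bar s g) := by
  refine hasDegree_word fun p x k hx => ?_
  rcases Nat.eq_zero_or_pos k with rfl | hk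
  · simp [bar_one g hg0]
  · rw [bar_word hs hx]
    refine Submodule.units_smul_mem' _ _ ?_
    have := hg k (fun j => p j) (fun j => x (0 + j)) hk fun j => by simpa using hx j
    convert this using 2
    rw [Fin.sum_univ_eq_sum_range p, Finset.sum_sub_distrib]
    simp
    ring

/-- A quasi-isomorphism from an `A∞` structure on the cohomology yields a coalgebra map to the bar
construction of `A`, compatible with the differentials. -/
theorem barA_comp_coHom_bar {κ : ℤˣ} {S : AInfStructure K D.grH} (F : AInfHom S (D.toAInf κ)) :
    barA D ((κ : ℤ) : K) ∘ₗ coHom (bar D.sgnH F.f) =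
      bar D.sgnH F.f ∘ₗ coDer (-D.sgnH) (bar D.sgnH S.m) := by
  have hs : ∀ p, ∀ v ∈ D.grH p, D.sgnH v = Int.negOnePow p • v := fun p v hv => D.sgnH_of_mem hv
  have hf1 : bar D.sgnH F.f 1 = 0 := bar_one F.f F.f_zero
  refine ext_homogeneous_word D.iSup_grH fun p x k hx => ?_
  rcases Nat.eq_zero_or_pos k with rfl | hk
  · simp [coHom_one hf1, barA_one, coDer_one _ (bar_one S.m S.m_zero)]
  · have h := F.map_eq k p x hk hx
    change _ = compositionSum (D.ops κ) F.f k p x at h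
    rw [insertionSum_eq hs F.f S.m S.m_zero S.m_mem k hx,
      compositionSum_eq D hs κ F.f F.f_zero F.f_mem hk hx] at h
    have h' := congrArg (fun v => Int.negOnePow (suspExp p 0 k) • v) h
    simp only [Int.negOnePow_smul_self] at h'
    rw [barA_comp_coHom D _ hf1, LinearMap.smul_apply, ← units_smul_eq, LinearMap.comp_apply, h']
    rfl

theorem bar_mem_iSup_range {V : Type*} [AddCommGroup V] [Module K V] {s : V →ₗ[K] V}
    {m : (k : ℕ) → MultilinearMap K (fun _ : Fin k => V) V} (hm : m 0 = 0) {n : ℕ}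
    {t : TensorAlgebra K V} (ht : t ∈ lenLT K V n) :
    bar s m t ∈ ⨆ j ∈ Finset.Icc 1 (n - 1), Submodule.span K (Set.range (m j)) := by
  refine map_mem_of_mem_lenLT (fun x a j hj => ?_) ht
  rcases Nat.eq_zero_or_pos j with rfl | hj0
  · simp [bar_one m hm]
  · rw [bar, ofMultilinear_word]
    refine Submodule.mem_iSup_of_mem j (Submodule.mem_iSup_of_mem ?_ ?_)
    · simp
      omega
    · exact Submodule.subset_span ⟨_, rfl⟩

/-- The value of the operations of a minimal model on classes with a Massey product. -/
theorem minimalModel_eq_massey {κ : ℤˣ} {n : ℕ} (hn : 2 ≤ n) {p : Fin n → ℤ}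
    {x : Fin n → D.Cohomology} (hx : ∀ j, x j ∈ D.grH (p j)) {y : D.Cohomology}
    (hy : y ∈ D.masseyProduct p x) {S : AInfStructure K D.grH} (hS : S.IsMinimal)
    (hqi : D.QuasiIsoTo κ S) :
    ∃ Γ ∈ ⨆ j ∈ Finset.Icc 1 (n - 1), Submodule.span K (Set.range (S.m j)),
      -(κ * Int.negOnePow (∑ j : Fin n, ((n : ℤ) - 1 - j) * p j)) • S.m n x = y + Γ := by
  obtain ⟨F, hF⟩ := hqi
  have hs : ∀ p, ∀ v ∈ D.grH p, D.sgnH v = Int.negOnePow p • v := fun p v hv => D.sgnH_of_mem hv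
  have hsA : ∀ p, ∀ v ∈ D.gr p, D.sgn v = Int.negOnePow p • v := fun p v hv => D.sgn_of_mem hv
  obtain ⟨p', x', hx', hpp, hxx⟩ := exists_seq_extension hx
  have hκ : ((κ : ℤ) : K) * ((κ : ℤ) : K) = 1 := by
    rcases Int.units_eq_one_or κ with h | h <;> simp [h]
  have hdeg : HasDegree (wordGr D.grH) D.gr 1 (bar D.sgnH F.f) :=
    hasDegree_bar hs F.f_zero F.f_mem
  have hσ : (-D.sgn) ∘ₗ bar D.sgnH F.f =
      bar D.sgnH F.f ∘ₗ (tmap K (-D.sgnH)).toLinearMap := by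
    rw [hdeg.comp_tmap D.iSup_grH hs hsA, Int.negOnePow_one, LinearMap.neg_comp]
    simp
  obtain ⟨t, ht, h⟩ := bar_word_eq_massey hκ (bar_one S.m S.m_zero)
    (fun h => by rw [bar_ι, hS]; rfl) (bar_one F.f F.f_zero) (fun h => by rw [bar_ι]; exact hF h)
    (fun p h hh => by
      rw [bar_ι]
      simpa using F.f_mem 1 (fun _ => p) (fun _ => h) le_rfl fun _ => hh)
    hσ (barA_comp_coHom_bar F) hn hy hxx
  have hexp : suspExp p' 0 n = ∑ j : Fin n, ((n : ℤ) - 1 - j) * p j := by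
    rw [suspExp, ← Fin.sum_univ_eq_sum_range (fun j => ((n : ℤ) - 1 - j) * p' (0 + j))]
    exact Finset.sum_congr rfl fun j _ => by rw [zero_add, hpp]
  have hval : Int.negOnePow (∑ j : Fin n, ((n : ℤ) - 1 - j) * p j) • S.m n x =
      bar D.sgnH S.m (word K x' 0 n) := by
    rw [bar_word hs hx', hexp]
    congr 2
    funext j
    rw [zero_add, hxx]
  refine ⟨-(((κ : ℤ) : K) • bar D.sgnH S.m t), Submodule.neg_mem _ (Submodule.smul_mem _ _
    (bar_mem_iSup_range S.m_zero ht)), ?_⟩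
  rw [Units.neg_smul, mul_smul, hval, h, units_smul_eq (K := K), smul_add, smul_neg, smul_smul, hκ,
    one_smul]
  abel

end MinimalModel

end BarConstruction

namespace DGA

/-! ### Changing a defining system within its Massey product -/

variable {K : Type*} [Field K] {A : Type*} [NonUnitalRing A] [Module K A]
  [IsScalarTower K A A] [SMulCommClass K A A] {D : DGA K A}

theorem degSum_eq {n : ℕ} {p : Fin n → ℤ} {p' : ℕ → ℤ} (hp : ∀ j : Fin n, p' j = p j) (i : ℕ)
    {j : ℕ} (hj : j ≤ n) : degSum p i j = ∑ l ∈ Finset.Ico i j, p' l := by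
  rw [degSum, Finset.sum_filter, ← Finset.sum_congr rfl fun l _ => by rw [← hp l],
    Fin.sum_univ_eq_sum_range (fun l => if i ≤ l ∧ l < j then p' l else 0) n, ← Finset.sum_filter]
  refine Finset.sum_congr ?_ fun _ _ => rfl
  ext l
  simp
  omega

theorem sysDeg_eq {n : ℕ} {p : Fin n → ℤ} {p' : ℕ → ℤ} (hp : ∀ j : Fin n, p' j = p j) (i k : ℕ)
    (hk : i + k ≤ n) : sysDeg p i (i + k) = ∑ l ∈ Finset.range k, (p' (i + l) - 1) + 1 := by
  rw [sysDeg, degSum_eq hp i hk, Finset.sum_Ico_eq_sum_range, Nat.add_sub_cancel_left,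
    Finset.sum_sub_distrib]
  simp
  ring

theorem sysDeg_add {n : ℕ} (p : Fin n → ℤ) {i k j : ℕ} (hik : i ≤ k) (hkj : k ≤ j) (hj : j ≤ n) :
    sysDeg p i k + sysDeg p k j = sysDeg p i j + 1 := by
  obtain ⟨p', hp⟩ : ∃ p' : ℕ → ℤ, ∀ j : Fin n, p' j = p j :=
    ⟨fun l => if h : l < n then p ⟨l, h⟩ else 0, by simp⟩
  simp only [sysDeg]
  rw [degSum_eq hp i (hkj.trans hj), degSum_eq hp k hj, degSum_eq hp i hj,
    ← Finset.sum_Ico_consecutive _ hik hkj]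
  ring

theorem sysDeg_succ {n : ℕ} (p : Fin n → ℤ) (i : Fin n) : sysDeg p i (i + 1) = p i := by
  obtain ⟨p', hp⟩ : ∃ p' : ℕ → ℤ, ∀ j : Fin n, p' j = p j :=
    ⟨fun l => if h : l < n then p ⟨l, h⟩ else 0, by simp⟩
  rw [sysDeg_eq hp _ 1 i.2]
  simp [hp]

/-- The gauge transformation of a defining system by the elementary matrix with entry `b` at
`(m, m+1)`: it adds `d b` to `a_{m,m+1}`, and adjusts the other entries of row `m` and column
`m + 1` accordingly. -/
noncomputable def gauge (D : DGA K A) (m : ℕ) (b : A) (a : ℕ → ℕ → A) (i j : ℕ) : A :=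
  if i = m then (if j = m + 1 then a i j + D.d b else a i j + D.sgn b * a (m + 1) j)
  else if j = m + 1 then a i j - a i m * b else a i j

theorem gauge_succ (D : DGA K A) (m : ℕ) (b : A) (a : ℕ → ℕ → A) :
    D.gauge m b a m (m + 1) = a m (m + 1) + D.d b := by simp [gauge]

theorem gauge_left (D : DGA K A) {m j : ℕ} (b : A) (a : ℕ → ℕ → A) (hj : j ≠ m + 1) :
    D.gauge m b a m j = a m j + D.sgn b * a (m + 1) j := by simp [gauge, hj]

theorem gauge_right (D : DGA K A) {m i : ℕ} (b : A) (a : ℕ → ℕ → A) (hi : i ≠ m) :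
    D.gauge m b a i (m + 1) = a i (m + 1) - a i m * b := by simp [gauge, hi]

theorem gauge_of_ne (D : DGA K A) {m i j : ℕ} (b : A) (a : ℕ → ℕ → A) (hi : i ≠ m)
    (hj : j ≠ m + 1) : D.gauge m b a i j = a i j := by simp [gauge, hi, hj]

/-- In row `m` the sum changes by the coboundary of the correction of the entry; in column `m + 1`
(`sum_gauge_right`) likewise, and elsewhere (`sum_gauge_of_ne`) it does not change. -/
theorem sum_gauge_left (D : DGA K A) {m j : ℕ} (b : A) (a : ℕ → ℕ → A) (hj : m + 1 < j)
    (h : D.d (a (m + 1) j) = -∑ k ∈ Finset.Ioo (m + 1) j, D.sgn (a (m + 1) k) * a k j) :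
    ∑ k ∈ Finset.Ioo m j, D.sgn (D.gauge m b a m k) * D.gauge m b a k j =
      ∑ k ∈ Finset.Ioo m j, D.sgn (a m k) * a k j - D.d (D.sgn b * a (m + 1) j) := by
  have hI : Finset.Ioo m j = insert (m + 1) (Finset.Ioo (m + 1) j) := by
    ext k
    simp
    omega
  have h1 : ∀ k ∈ Finset.Ioo (m + 1) j, D.sgn (D.gauge m b a m k) * D.gauge m b a k j =
      D.sgn (a m k) * a k j + b * (D.sgn (a (m + 1) k) * a k j) := by
    intro k hk
    rw [Finset.mem_Ioo] at hk
    rw [D.gauge_left b a (by omega), D.gauge_of_ne b a (by omega) (by omega), map_add, D.sgn_mul,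
      D.sgn_sgn, add_mul, mul_assoc]
  rw [hI, Finset.sum_insert (by simp), Finset.sum_insert (by simp), Finset.sum_congr rfl h1,
    Finset.sum_add_distrib, ← Finset.mul_sum, D.gauge_succ, D.gauge_of_ne b a (by omega) (by omega),
    D.d_mul, D.sgn_sgn, h, D.d_sgn, map_add, add_mul, mul_neg, neg_mul]
  abel

theorem sum_gauge_right (D : DGA K A) {m i : ℕ} (b : A) (a : ℕ → ℕ → A) (hi : i < m)
    (h : D.d (a i m) = -∑ k ∈ Finset.Ioo i m, D.sgn (a i k) * a k m) :
    ∑ k ∈ Finset.Ioo i (m + 1), D.sgn (D.gauge m b a i k) * D.gauge m b a k (m + 1) =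
      ∑ k ∈ Finset.Ioo i (m + 1), D.sgn (a i k) * a k (m + 1) + D.d (a i m * b) := by
  have hI : Finset.Ioo i (m + 1) = insert m (Finset.Ioo i m) := by
    ext k
    simp
    omega
  have h1 : ∀ k ∈ Finset.Ioo i m, D.sgn (D.gauge m b a i k) * D.gauge m b a k (m + 1) =
      D.sgn (a i k) * a k (m + 1) - D.sgn (a i k) * a k m * b := by
    intro k hk
    rw [Finset.mem_Ioo] at hk
    rw [D.gauge_right b a (by omega), D.gauge_of_ne b a (by omega) (by omega), mul_sub, mul_assoc]
  rw [hI, Finset.sum_insert (by simp), Finset.sum_insert (by simp), Finset.sum_congr rfl h1,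
    Finset.sum_sub_distrib, ← Finset.sum_mul, D.gauge_succ,
    D.gauge_of_ne b a (by omega) (by omega), D.d_mul, h, mul_add, neg_mul]
  abel

theorem sum_gauge_of_ne (D : DGA K A) {m i j : ℕ} (b : A) (a : ℕ → ℕ → A) (hi : i ≠ m)
    (hj : j ≠ m + 1) :
    ∑ k ∈ Finset.Ioo i j, D.sgn (D.gauge m b a i k) * D.gauge m b a k j =
      ∑ k ∈ Finset.Ioo i j, D.sgn (a i k) * a k j := by
  by_cases him : i < m ∧ m + 1 < j
  · rw [← sub_eq_zero, ← Finset.sum_sub_distrib,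
      Finset.sum_eq_add_of_mem m (m + 1) (by simp; omega) (by simp; omega) (by omega)]
    · rw [D.gauge_right b a hi, D.gauge_left b a hj, D.gauge_of_ne b a hi (by omega),
        D.gauge_of_ne b a (by omega) hj, map_sub, D.sgn_mul, mul_add, sub_mul, mul_assoc]
      abel
    · rintro k - ⟨hk1, hk2⟩
      rw [D.gauge_of_ne b a hi hk2, D.gauge_of_ne b a hk1 hj, sub_self]
  · refine Finset.sum_congr rfl fun k hk => ?_
    rw [Finset.mem_Ioo] at hk
    rw [D.gauge_of_ne b a hi (by omega), D.gauge_of_ne b a (by omega) hj]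

theorem gauge_mem {n : ℕ} {p : Fin n → ℤ} {a : ℕ → ℕ → A}
    (ha : ∀ i j : ℕ, i < j → j ≤ n → j - i ≤ n - 1 → a i j ∈ D.gr (sysDeg p i j))
    {m : ℕ} {b : A} (hb : b ∈ D.gr (sysDeg p m (m + 1) + -1)) {i j : ℕ} (hij : i < j)
    (hj : j ≤ n) (hn : j - i ≤ n - 1) : D.gauge m b a i j ∈ D.gr (sysDeg p i j) := by
  have h0 := ha i j hij hj hn
  by_cases hi : i = m
  · subst hi
    by_cases hj' : j = i + 1
    · subst hj'
      rw [D.gauge_succ]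
      refine Submodule.add_mem _ h0 ?_
      have := D.d_mem hb
      rwa [neg_add_cancel_right] at this
    · rw [D.gauge_left b a hj']
      refine Submodule.add_mem _ h0 ?_
      have := D.mul_mem (D.sgn_mem hb) (ha (i + 1) j (by omega) hj (by omega))
      rwa [show sysDeg p i (i + 1) + -1 + sysDeg p (i + 1) j = sysDeg p i j by
        have := sysDeg_add p (show i ≤ i + 1 by omega) (show i + 1 ≤ j by omega) hj
        linarith] at this
  · by_cases hj' : j = m + 1
    · subst hj'
      rw [D.gauge_right b a hi]
      refine Submodule.sub_mem _ h0 ?_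
      have := D.mul_mem (ha i m (by omega) (by omega) (by omega)) hb
      rwa [show sysDeg p i m + (sysDeg p m (m + 1) + -1) = sysDeg p i (m + 1) by
        have := sysDeg_add p (show i ≤ m by omega) (show m ≤ m + 1 by omega) hj
        linarith] at this
    · rwa [D.gauge_of_ne b a hi hj']

/-- The equations of a defining system, including those which say that the `a_{i,i+1}` are
cocycles, in terms of the sign involution. -/
theorem IsDefiningSystem.d_eq_neg_sum {n : ℕ} {p : Fin n → ℤ} {x : Fin n → D.Cohomology}
    {a : ℕ → ℕ → A} (ha : D.IsDefiningSystem p x a) {i j : ℕ} (hij : i < j) (hj : j ≤ n)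
    (hn : j - i ≤ n - 1) : D.d (a i j) = -∑ k ∈ Finset.Ioo i j, D.sgn (a i k) * a k j := by
  by_cases h : 2 ≤ j - i
  · rw [ha.d_eq i j hj h hn, sysSum_eq ha.mem hj]
  · have hi : i < n := by omega
    obtain rfl : j = i + 1 := by omega
    rw [(ha.represents ⟨i, hi⟩).d_eq_zero, Finset.sum_eq_zero, neg_zero]
    intro k hk
    rw [Finset.mem_Ioo] at hk
    omega

theorem Represents.add_d {a : A} {h : D.Cohomology} (ha : D.Represents a h) (b : A) :
    D.Represents (a + D.d b) h := by
  have := ha.sub ((D.represents_zero_iff).2 ⟨-b, rfl⟩)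
  rwa [sub_zero, map_neg, sub_neg_eq_add] at this

theorem IsDefiningSystem.gauge {n : ℕ} {p : Fin n → ℤ} {x : Fin n → D.Cohomology}
    {a : ℕ → ℕ → A} (ha : D.IsDefiningSystem p x a) {m : ℕ} {b : A}
    (hb : b ∈ D.gr (sysDeg p m (m + 1) + -1)) : D.IsDefiningSystem p x (D.gauge m b a) := by
  have hmem : ∀ i j : ℕ, i < j → j ≤ n → j - i ≤ n - 1 → D.gauge m b a i j ∈ D.gr (sysDeg p i j) :=
    fun i j => gauge_mem ha.mem hb
  refine ⟨hmem, fun i => ?_, fun i j hj h2 hn => ?_⟩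
  · by_cases hi : (i : ℕ) = m
    · rw [← hi, D.gauge_succ]
      exact (ha.represents i).add_d b
    · rw [D.gauge_of_ne b a hi (by omega)]
      exact ha.represents i
  · have h0 := ha.d_eq_neg_sum (show i < j by omega) hj hn
    rw [sysSum_eq hmem hj]
    by_cases hi : i = m
    · subst hi
      rw [D.sum_gauge_left b a (by omega) (ha.d_eq_neg_sum (by omega) hj (by omega)),
        D.gauge_left b a (by omega), map_add, h0]
      abel
    · by_cases hj' : j = m + 1
      · subst hj'
        rw [D.sum_gauge_right b a (by omega) (ha.d_eq_neg_sum (by omega) (by omega) (by omega)),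
          D.gauge_right b a hi, map_sub, h0]
        abel
      · rw [D.sum_gauge_of_ne b a hi hj', D.gauge_of_ne b a hi hj', h0]

theorem IsDefiningSystem.represents_gauge {n : ℕ} (hn : 2 ≤ n) {p : Fin n → ℤ}
    {x : Fin n → D.Cohomology} {a : ℕ → ℕ → A} (ha : D.IsDefiningSystem p x a) {m : ℕ} {b : A}
    (hb : b ∈ D.gr (sysDeg p m (m + 1) + -1)) {y : D.Cohomology}
    (hy : D.Represents (sysSum p a 0 n) y) : D.Represents (sysSum p (D.gauge m b a) 0 n) y := by
  rw [sysSum_eq ha.mem le_rfl] at hy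
  rw [sysSum_eq (ha.gauge hb).mem le_rfl]
  by_cases hm : 0 = m
  · subst hm
    rw [D.sum_gauge_left b a (by omega) (ha.d_eq_neg_sum (by omega) le_rfl (by omega)), neg_sub,
      ← neg_add_eq_sub]
    exact hy.add_d _
  · by_cases hm' : n = m + 1
    · subst hm'
      rw [D.sum_gauge_right b a (by omega) (ha.d_eq_neg_sum (by omega) (by omega) (by omega)),
        neg_add, ← map_neg]
      exact hy.add_d _
    · rwa [D.sum_gauge_of_ne b a hm hm']

/-- Each element of a Massey product comes from a defining system with given representatives of
the classes `x i`. -/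
theorem exists_isDefiningSystem {n : ℕ} (hn : 2 ≤ n) {p : Fin n → ℤ} {x : Fin n → D.Cohomology}
    {y : D.Cohomology} (hy : y ∈ D.masseyProduct p x) {z : Fin n → A}
    (hz : ∀ i, D.Represents (z i) (x i)) (hzp : ∀ i, z i ∈ D.gr (p i)) :
    ∃ a, D.IsDefiningSystem p x a ∧ D.Represents (sysSum p a 0 n) y ∧
      ∀ i : Fin n, a i (i + 1) = z i := by
  have key : ∀ k ≤ n, ∃ a, D.IsDefiningSystem p x a ∧ D.Represents (sysSum p a 0 n) y ∧
      ∀ i : Fin n, (i : ℕ) < k → a i (i + 1) = z i := by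
    intro k
    induction k with
    | zero =>
      intro _
      obtain ⟨a, ha, hay⟩ := hy
      exact ⟨a, ha, hay, fun i hi => absurd hi (Nat.not_lt_zero _)⟩
    | succ k ih =>
      intro hk
      obtain ⟨a, ha, hay, haz⟩ := ih (by omega)
      set i : Fin n := ⟨k, by omega⟩
      obtain ⟨u, hu⟩ := (hz i).exists_eq_d (ha.represents i)
      have hb : D.prim (z i - a k (k + 1)) ∈ D.gr (sysDeg p k (k + 1) + -1) := by
        refine D.prim_mem (Submodule.sub_mem _ ?_ (ha.mem _ _ (by omega) (by omega) (by omega)))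
        have := sysDeg_succ p i
        rw [this]
        exact hzp i
      have hd : D.d (D.prim (z i - a k (k + 1))) = z i - a k (k + 1) := by
        change z i - a k (k + 1) = D.d u at hu
        rw [hu, D.d_prim_d]
      refine ⟨_, ha.gauge hb, ha.represents_gauge hn hb hay, fun j hj => ?_⟩
      by_cases hjk : (j : ℕ) = k
      · have : j = i := Fin.ext hjk
        rw [hjk, D.gauge_succ, hd, this]
        abel
      · rw [D.gauge_of_ne _ a hjk (by omega)]
        exact haz j (by omega)
  obtain ⟨a, ha, hay, haz⟩ := key n le_rfl
  exact ⟨a, ha, hay, fun i => haz i i.2⟩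

end DGA

namespace BarConstruction

open TensorAlgebra (ι)

/-! ### Minimal models with prescribed cocycle parts -/

section Truncation

variable {K V X : Type*} [Field K] [AddCommGroup V] [Module K V] [AddCommGroup X] [Module K X]

/-- The projection of the tensor algebra to the span of the words of length at least two. -/
noncomputable def trunc : TensorAlgebra K V →ₗ[K] TensorAlgebra K V :=
  LinearMap.id - counit.smulRight 1 - ι K ∘ₗ letter

theorem trunc_one : trunc (1 : TensorAlgebra K V) = 0 := by simp [trunc]

theorem trunc_ι (v : V) : trunc (ι K v) = 0 := by
  have : counit (ι K v * (1 : TensorAlgebra K V)) = 0 := counit_ι_mul v 1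
  rw [mul_one] at this
  simp [trunc, this, letter_ι]

theorem trunc_word (x : ℕ → V) (a k : ℕ) :
    trunc (word K x a (k + 2)) = word K x a (k + 2) := by
  have h1 : counit (word K x a (k + 2)) = 0 := by rw [word_succ, counit_ι_mul]
  have h2 : letter (word K x a (k + 2)) = 0 := by
    rw [word_succ, letter_ι_mul, word_succ, counit_ι_mul, zero_smul]
  simp [trunc, h1, h2]

theorem comp_trunc {f : TensorAlgebra K V →ₗ[K] X} (h1 : f 1 = 0) (h2 : ∀ v, f (ι K v) = 0) :
    f ∘ₗ trunc = f := by
  refine LinearMap.ext fun t => ?_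
  simp [trunc, h1, h2]

theorem AgreeBelow.comp_trunc {k : ℕ} {f g : TensorAlgebra K V →ₗ[K] X} (h : AgreeBelow k f g) :
    AgreeBelow k (f ∘ₗ trunc) (g ∘ₗ trunc) := by
  intro x a j hj
  match j with
  | 0 => simp [trunc_one]
  | 1 => simp [trunc_ι]
  | j + 2 => simpa [trunc_word] using h x a (j + 2) hj

theorem HasDegree.comp_trunc {gr : ℤ → Submodule K V} {G : ℤ → Submodule K X} {e : ℤ}
    {f : TensorAlgebra K V →ₗ[K] X} (hf : HasDegree (wordGr gr) G e f) :
    HasDegree (wordGr gr) G e (f ∘ₗ trunc) := by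
  refine hasDegree_word fun p x k hx => ?_
  match k with
  | 0 => simp [trunc_one]
  | 1 => simp [trunc_ι]
  | k + 2 => simpa [trunc_word] using hf.word_mem hx 0 (k + 2)

theorem hasDegree_comp_letter {gr : ℤ → Submodule K V} {G : ℤ → Submodule K X} {φ : V →ₗ[K] X}
    (hφ : HasDegree gr G 0 φ) : HasDegree (wordGr gr) G 1 (φ ∘ₗ letter) := by
  refine hasDegree_word fun p x k hx => ?_
  match k with
  | 0 => simp
  | 1 => simpa [letter_ι] using hφ _ _ (hx 0)
  | k + 2 =>
    rw [LinearMap.comp_apply, word_succ, letter_ι_mul, word_succ, counit_ι_mul, zero_smul, map_zero]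
    exact Submodule.zero_mem _

/-- Two coderivations whose corestrictions agree on short words differ on words that are longer by
one letter by a single letter. -/
theorem coDer_word_sub (σ : V →ₗ[K] V) {b b' : TensorAlgebra K V →ₗ[K] V} {k : ℕ}
    (h : AgreeBelow k b b') (x : ℕ → V) (a j : ℕ) (hj : j ≤ k) :
    coDer σ b (word K x a j) - coDer σ b' (word K x a j) =
      ι K (b (word K x a j) - b' (word K x a j)) := by
  rw [← LinearMap.sub_apply, ← coDer_sub, ← LinearMap.sub_apply b]
  refine eq_on_leading_words (e := b - b') (a := σ ∘ₗ letter) (G := LinearMap.id) (by simp) rfl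
    (coDer_eq _ _) (fun x a j hj => ?_) x a j hj
  simp [h x a j hj]

end Truncation

section Construction

variable {K : Type*} [Field K] {A : Type*} [NonUnitalRing A] [Module K A]
  [IsScalarTower K A A] [SMulCommClass K A A] (D : DGA K A) (c : K)

local notation:70 f:70 " ⋆ " g:71 => conv f g

/-- The part of the equation of an `A∞` morphism `f` from `(H, b)` to `A` that only involves the
values of `f` and `b` on shorter words. -/
noncomputable def obstruction (f : TensorAlgebra K D.Cohomology →ₗ[K] A)
    (b : TensorAlgebra K D.Cohomology →ₗ[K] D.Cohomology) : TensorAlgebra K D.Cohomology →ₗ[K] A :=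
  c • ((D.sgn ∘ₗ f) ⋆ f) - (f ∘ₗ trunc) ∘ₗ coDer (-D.sgnH) b

variable {D c}

theorem obstruction_one {f : TensorAlgebra K D.Cohomology →ₗ[K] A}
    {b : TensorAlgebra K D.Cohomology →ₗ[K] D.Cohomology} (hf : f 1 = 0) (hb : b 1 = 0) :
    obstruction D c f b 1 = 0 := by
  simp [obstruction, conv_one, hf, coDer_one _ hb]

theorem obstruction_ι {f : TensorAlgebra K D.Cohomology →ₗ[K] A}
    {b : TensorAlgebra K D.Cohomology →ₗ[K] D.Cohomology} (hf : f 1 = 0) (hb : b 1 = 0)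
    (h : D.Cohomology) : obstruction D c f b (ι K h) = 0 := by
  have h1 : ((D.sgn ∘ₗ f) ⋆ f) (ι K h) = 0 := by
    rw [← word_one K (fun _ => h) 0, conv_word]
    simp [Finset.sum_range_succ, hf]
  simp [obstruction, h1, coDer_ι _ hb, trunc_ι]

theorem AgreeBelow.obstruction {k : ℕ} {f f' : TensorAlgebra K D.Cohomology →ₗ[K] A}
    {b b' : TensorAlgebra K D.Cohomology →ₗ[K] D.Cohomology} (hf : AgreeBelow k f f')
    (hb : AgreeBelow k b b') (hf1 : f 1 = 0) (hf1' : f' 1 = 0) (hb2 : AgreeBelow 2 b 0) :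
    AgreeBelow (k + 1) (obstruction D c f b) (obstruction D c f' b') := by
  intro x a j hj
  have h1 : ((D.sgn ∘ₗ f) ⋆ f) (word K x a j) = ((D.sgn ∘ₗ f') ⋆ f') (word K x a j) := by
    rw [conv_word, conv_word]
    refine Finset.sum_congr rfl fun s hs => ?_
    rw [Finset.mem_range] at hs
    rcases Nat.eq_zero_or_pos s with rfl | hs0
    · simp [hf1, hf1']
    · rcases (show s ≤ j by omega).lt_or_eq with hsj | rfl
      · rw [LinearMap.comp_apply, LinearMap.comp_apply, hf x a s (by omega),
          hf x (a + s) (j - s) (by omega)]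
      · simp [hf1, hf1']
  have h2 : (f ∘ₗ trunc) (coDer (-D.sgnH) b (word K x a j)) =
      (f' ∘ₗ trunc) (coDer (-D.sgnH) b' (word K x a j)) := by
    have hmem : coDer (-D.sgnH) b (word K x a j) ∈ lenLT K D.Cohomology k :=
      lenLT_mono (by omega) ((lowers_coDer (e := 1) _ hb2) x a j)
    rw [hf.comp_trunc.eq_of_mem hmem, ← sub_eq_zero, ← map_sub,
      coDer_word_sub _ hb x a j (by omega), LinearMap.comp_apply, trunc_ι, map_zero]
  simp only [BarConstruction.obstruction, LinearMap.sub_apply, LinearMap.smul_apply, h1]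
  rw [LinearMap.comp_apply _ (coDer _ b), LinearMap.comp_apply _ (coDer _ b'), h2]

theorem HasDegree.obstruction {f : TensorAlgebra K D.Cohomology →ₗ[K] A}
    {b : TensorAlgebra K D.Cohomology →ₗ[K] D.Cohomology}
    (hf : HasDegree (wordGr D.grH) D.gr 1 f) (hb : HasDegree (wordGr D.grH) D.grH 2 b)
    (hb1 : b 1 = 0) : HasDegree (wordGr D.grH) D.gr 2 (obstruction D c f b) := by
  have hs : HasDegree D.gr D.gr 0 D.sgn := fun p a ha => by simpa using D.sgn_mem ha
  have h1 := ((hs.comp hf).conv D hf).smul c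
  have h2 := hf.comp_trunc.comp (hasDegree_coDer (fun p v hv => D.sgnH_of_mem hv) hb1 hb)
  exact (h1.of_eq (by norm_num)).sub (h2.of_eq (by norm_num))

/-- Solution of the equations `b = π U`, `f = f₁ - c h U + φ`, where `U` is the obstruction. -/
theorem exists_solution (c : K) {φ : TensorAlgebra K D.Cohomology →ₗ[K] A} (hφ1 : φ 1 = 0)
    (hφι : ∀ h, φ (ι K h) = 0) (hφ : HasDegree (wordGr D.grH) D.gr 1 φ) :
    ∃ (f : TensorAlgebra K D.Cohomology →ₗ[K] A)
      (b : TensorAlgebra K D.Cohomology →ₗ[K] D.Cohomology),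
      f 1 = 0 ∧ b 1 = 0 ∧ (∀ h, f (ι K h) = D.ofCoh h) ∧ (∀ h, b (ι K h) = 0) ∧
      HasDegree (wordGr D.grH) D.gr 1 f ∧ HasDegree (wordGr D.grH) D.grH 2 b ∧
      b = D.toCoh ∘ₗ obstruction D c f b ∧
      f = D.ofCoh ∘ₗ letter - c • (D.homotopy D.ofCoh ∘ₗ obstruction D c f b) + φ := by
  -- the components of length at least two of `f` and `b` are found together
  let F : (TensorAlgebra K D.Cohomology →ₗ[K] A × D.Cohomology) →
      TensorAlgebra K D.Cohomology →ₗ[K] A := fun X =>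
    D.ofCoh ∘ₗ letter + (LinearMap.fst K A D.Cohomology ∘ₗ X) ∘ₗ trunc
  let B : (TensorAlgebra K D.Cohomology →ₗ[K] A × D.Cohomology) →
      TensorAlgebra K D.Cohomology →ₗ[K] D.Cohomology := fun X =>
    (LinearMap.snd K A D.Cohomology ∘ₗ X) ∘ₗ trunc
  let Ψ : (TensorAlgebra K D.Cohomology →ₗ[K] A × D.Cohomology) →
      TensorAlgebra K D.Cohomology →ₗ[K] A × D.Cohomology := fun X =>
    LinearMap.prod (-(c • (D.homotopy D.ofCoh ∘ₗ obstruction D c (F X) (B X))) + φ)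
      (D.toCoh ∘ₗ obstruction D c (F X) (B X))
  have hF1 : ∀ X, F X 1 = 0 := fun X => by simp [F, trunc_one]
  have hB1 : ∀ X, B X 1 = 0 := fun X => by simp [B, trunc_one]
  have hFι : ∀ X h, F X (ι K h) = D.ofCoh h := fun X h => by simp [F, trunc_ι, letter_ι]
  have hBι : ∀ X h, B X (ι K h) = 0 := fun X h => by simp [B, trunc_ι]
  have hFk : ∀ {k X X'}, AgreeBelow k X X' → AgreeBelow k (F X) (F X') := by
    intro k X X' h x a j hj
    have h' := AgreeBelow.comp_trunc (f := LinearMap.fst K A D.Cohomology ∘ₗ X)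
      (g := LinearMap.fst K A D.Cohomology ∘ₗ X') (fun x a j hj => by simp [h x a j hj]) x a j hj
    simp only [F, LinearMap.add_apply, h']
  have hBk : ∀ {k X X'}, AgreeBelow k X X' → AgreeBelow k (B X) (B X') := by
    intro k X X' h
    exact AgreeBelow.comp_trunc fun x a j hj => by simp [h x a j hj]
  have hΨ : ∀ k X X', AgreeBelow k X X' → AgreeBelow (k + 1) (Ψ X) (Ψ X') := by
    intro k X X' h x a j hj
    have := AgreeBelow.obstruction (c := c) (hFk h) (hBk h) (hF1 X) (hF1 X')
      (agreeBelow_two (hB1 X) (hBι X)) x a j hj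
    simp [Ψ, this]
  have hdeg1 : ∀ X, HasDegree (wordGr D.grH) (fun q => (D.gr q).prod (D.grH (q + 1))) 1 X →
      HasDegree (wordGr D.grH) D.gr 1 (F X) ∧ HasDegree (wordGr D.grH) D.grH 2 (B X) := by
    intro X hX
    refine ⟨(hasDegree_comp_letter fun p h hh => ?_).add
      (HasDegree.comp_trunc fun q t ht => (hX q t ht).1),
      HasDegree.comp_trunc fun q t ht => ?_⟩
    · simpa using D.ofCoh_mem hh
    · have := (hX q t ht).2
      rwa [add_assoc] at this
  have hdeg := HasDegree.fixedPoint (gr := D.grH)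
    (gr' := fun q => (D.gr q).prod (D.grH (q + 1))) (e := 1) (Ψ := Ψ) fun X hX => by
      obtain ⟨h1, h2⟩ := hdeg1 X hX
      have hU := HasDegree.obstruction (c := c) h1 h2 (hB1 X)
      intro q t ht
      refine ⟨Submodule.add_mem _ (Submodule.neg_mem _ (Submodule.smul_mem _ _ ?_)) (hφ q t ht), ?_⟩
      · have := D.homotopy_mem (fun p h hh => D.ofCoh_mem hh) (hU q t ht)
        rwa [show q + 2 + -1 = q + 1 by ring] at this
      · have := D.toCoh_mem (hU q t ht)
        rwa [show q + 2 = q + 1 + 1 by ring] at this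
  obtain ⟨X, hX⟩ : ∃ X, X = fixedPoint Ψ := ⟨_, rfl⟩
  have hfix : X = Ψ X := by rw [hX]; exact fixedPoint_eq hΨ
  rw [← hX] at hdeg
  have hU1 : obstruction D c (F X) (B X) 1 = 0 := obstruction_one (hF1 X) (hB1 X)
  have hUι : ∀ h, obstruction D c (F X) (B X) (ι K h) = 0 := obstruction_ι (hF1 X) (hB1 X)
  have hfst : LinearMap.fst K A D.Cohomology ∘ₗ X =
      -(c • (D.homotopy D.ofCoh ∘ₗ obstruction D c (F X) (B X))) + φ := by
    conv_lhs => rw [hfix]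
    rfl
  have hsnd : LinearMap.snd K A D.Cohomology ∘ₗ X = D.toCoh ∘ₗ obstruction D c (F X) (B X) := by
    conv_lhs => rw [hfix]
    rfl
  refine ⟨F X, B X, hF1 X, hB1 X, hFι X, hBι X, (hdeg1 X hdeg).1, (hdeg1 X hdeg).2, ?_, ?_⟩
  · have : B X = LinearMap.snd K A D.Cohomology ∘ₗ X := by
      refine comp_trunc ?_ ?_
      · rw [hsnd]; simp [hU1]
      · intro h; rw [hsnd]; simp [hUι]
    conv_lhs => rw [this, hsnd]
  · have : (LinearMap.fst K A D.Cohomology ∘ₗ X) ∘ₗ trunc = LinearMap.fst K A D.Cohomology ∘ₗ X := by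
      refine comp_trunc ?_ ?_
      · rw [hfst]; simp [hU1, hφ1]
      · intro h; rw [hfst]; simp [hUι, hφι]
    change D.ofCoh ∘ₗ letter + (LinearMap.fst K A D.Cohomology ∘ₗ X) ∘ₗ trunc = _
    rw [this, hfst]
    abel

theorem sgnH_sgnH : (-D.sgnH) ∘ₗ (-D.sgnH) = LinearMap.id := by
  refine LinearMap.ext_of_iSup_eq_top D.iSup_grH fun p h hh => ?_
  have hh' : D.sgnH h ∈ D.grH p := by
    rw [D.sgnH_of_mem hh]
    exact Submodule.units_smul_mem' _ _ hh
  rw [LinearMap.comp_apply, LinearMap.neg_apply, LinearMap.neg_apply, map_neg, neg_neg,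
    D.sgnH_of_mem hh', D.sgnH_of_mem hh, Int.negOnePow_smul_self, LinearMap.id_apply]

/-- A solution of the equations `b = π U`, `f = f₁ - c h U + φ`, for a cocycle-valued `φ`, is an
`A∞` structure together with an `A∞` morphism. -/
theorem solution_spec {c : K} (hc : c * c = 1) {φ f : TensorAlgebra K D.Cohomology →ₗ[K] A}
    {b : TensorAlgebra K D.Cohomology →ₗ[K] D.Cohomology} (hφ : D.d ∘ₗ φ = 0)
    (hf1 : f 1 = 0) (hb1 : b 1 = 0) (hfι : ∀ h, f (ι K h) = D.ofCoh h) (hbι : ∀ h, b (ι K h) = 0)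
    (hfdeg : HasDegree (wordGr D.grH) D.gr 1 f) (hbdeg : HasDegree (wordGr D.grH) D.grH 2 b)
    (hb : b = D.toCoh ∘ₗ obstruction D c f b)
    (hf : f = D.ofCoh ∘ₗ letter - c • (D.homotopy D.ofCoh ∘ₗ obstruction D c f b) + φ) :
    b ∘ₗ coDer (-D.sgnH) b = 0 ∧ barA D c ∘ₗ coHom f = f ∘ₗ coDer (-D.sgnH) b := by
  have hs : ∀ p, ∀ v ∈ D.grH p, D.sgnH v = Int.negOnePow p • v := fun p v hv => D.sgnH_of_mem hv
  have hσ : (-D.sgn) ∘ₗ f = f ∘ₗ (tmap K (-D.sgnH)).toLinearMap := by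
    rw [hfdeg.comp_tmap D.iSup_grH hs (fun p v hv => D.sgn_of_mem hv), Int.negOnePow_one,
      LinearMap.neg_comp]
    simp
  have hσb : b ∘ₗ (tmap K (-D.sgnH)).toLinearMap = -((-D.sgnH) ∘ₗ b) := by
    rw [hbdeg.comp_tmap D.iSup_grH hs hs, Int.negOnePow_even 2 (by decide), one_smul,
      LinearMap.neg_comp, neg_neg]
  obtain ⟨U, hU⟩ : ∃ U, U = obstruction D c f b := ⟨_, rfl⟩
  obtain ⟨δ, hδ⟩ : ∃ δ, δ = coDer (-D.sgnH) b := ⟨_, rfl⟩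
  obtain ⟨e, he⟩ : ∃ e, e = barA D c ∘ₗ coHom f - f ∘ₗ δ := ⟨_, rfl⟩
  have hletter : letter ∘ₗ δ = b := by rw [hδ]; exact letter_comp_coDer _ _
  have hfl : f ∘ₗ trunc = f - D.ofCoh ∘ₗ letter := by
    refine LinearMap.ext fun t => ?_
    simp [trunc, hf1, hfι]
  have he' : ∀ t, e t = c • D.d (f t) + U t - D.ofCoh (b t) := by
    intro t
    have h1 := LinearMap.congr_fun hletter t
    rw [he, hU, obstruction, hfl, barA_comp_coHom D c hf1, ← hδ]
    simp only [LinearMap.sub_apply, LinearMap.smul_apply, LinearMap.add_apply,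
      LinearMap.comp_apply, smul_add] at h1 ⊢
    rw [h1]
    abel
  have hdf : ∀ t, c • D.d (f t) = -(U t - D.prim (D.d (U t)) - D.ofCoh (b t)) := by
    intro t
    have h1 := D.d_homotopy D.represents_ofCoh (U t)
    have h2 : D.d (φ t) = 0 := LinearMap.congr_fun hφ t
    have h3 : D.toCoh (U t) = b t := by
      rw [hU]
      exact (LinearMap.congr_fun hb t).symm
    rw [hf, ← hU]
    simp only [LinearMap.add_apply, LinearMap.sub_apply, LinearMap.comp_apply,
      LinearMap.smul_apply, map_add, map_sub, map_smul, (D.represents_ofCoh _).d_eq_zero, h1, h2,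
      h3, add_zero, zero_sub, smul_neg, smul_smul, hc, one_smul]
  have heU : ∀ t, e t = D.prim (D.d (U t)) := by
    intro t
    rw [he', hdf]
    abel
  have hde : ∀ t, D.d (e t) = D.d (U t) := by
    intro t
    rw [he', map_sub, map_add, map_smul, D.d_d, (D.represents_ofCoh _).d_eq_zero, smul_zero,
      zero_add, sub_zero]
  obtain ⟨E, hE⟩ : ∃ E, E = diffA D c ∘ₗ coHom f - coHom f ∘ₗ δ := ⟨_, rfl⟩
  have hErec : E = (ι K ∘ₗ e) ⋆ coHom f +
      (ι K ∘ₗ (f ∘ₗ (tmap K (-D.sgnH)).toLinearMap)) ⋆ E := by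
    rw [hE, he, hδ]
    exact coDer_comp_coHom_sub b (barA D c) hf1 hσ
  have hδδ : δ ∘ₗ δ = (ι K ∘ₗ (b ∘ₗ δ)) ⋆ LinearMap.id + (ι K ∘ₗ letter) ⋆ (δ ∘ₗ δ) := by
    rw [hδ]
    exact coDer_comp_coDer sgnH_sgnH hσb
  have hEδ : ∀ t, barA D c (E t) + e (δ t) = -f (δ (δ t)) := by
    intro t
    have h1 : barA D c (diffA D c (coHom f t)) = 0 :=
      LinearMap.congr_fun (barA_comp_diffA D c) (coHom f t)
    rw [hE, he]
    simp only [LinearMap.sub_apply, LinearMap.comp_apply, map_sub, h1]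
    abel
  have hlow : Lowers 1 δ := by
    rw [hδ]
    exact lowers_coDer _ (agreeBelow_two hb1 hbι)
  have key : ∀ k, AgreeBelow k (b ∘ₗ δ) 0 ∧ AgreeBelow k e 0 := by
    intro k
    induction k with
    | zero => exact ⟨fun x a j hj => absurd hj (Nat.not_lt_zero _),
        fun x a j hj => absurd hj (Nat.not_lt_zero _)⟩
    | succ k ih =>
      have h0 : ∀ x a j, j < k + 1 →
          b (δ (word K x a j)) = 0 ∧ e (word K x a j) = 0 := by
        intro x a j hj
        have h1 := hEδ (word K x a j)
        rw [eq_on_leading_words (by simp [hf1]) (coHom_one hf1) hErec ih.2 x a j (by omega),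
          barA_ι, ih.2.eq_of_mem (lenLT_mono (by omega) (hlow x a j)), LinearMap.zero_apply,
          add_zero] at h1
        have h2 := eq_on_leading_words (by simp) rfl hδδ ih.1 x a j (by omega)
        rw [LinearMap.comp_apply] at h2
        rw [h2, hfι, LinearMap.comp_apply] at h1
        have h3 : b (δ (word K x a j)) = 0 := by
          rw [← (D.represents_ofCoh (b (δ (word K x a j)))).toCoh_eq, ← neg_neg (D.ofCoh _), ← h1,
            ← map_smul, map_neg, D.toCoh_d, neg_zero]
        rw [h3, map_zero, neg_zero] at h1
        have h4 : D.d (e (word K x a j)) = 0 := by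
          have := congrArg (fun v => c • v) h1
          simpa [smul_smul, hc] using this
        exact ⟨h3, by rw [heU, ← hde, h4, map_zero]⟩
      exact ⟨fun x a j hj => (h0 x a j hj).1, fun x a j hj => (h0 x a j hj).2⟩
  rw [← hδ]
  constructor
  · exact ext_word fun x k => (key (k + 1)).1 x 0 k (by omega)
  · rw [← sub_eq_zero, ← he]
    exact ext_word fun x k => (key (k + 1)).2 x 0 k (by omega)

end Construction

end BarConstruction

namespace BarConstruction

open TensorAlgebra (ι)

/-! ### Functionals on the tensor algebra dual to consecutive words -/

section WordFunctional

variable {K V : Type*} [Field K] [AddCommGroup V] [Module K V]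

/-- The map which splits off the first letter of a word, `v₁⋯vₖ ↦ v₁ ⊗ v₂⋯vₖ`. -/
noncomputable def splitFirst : TensorAlgebra K V →ₗ[K] V ⊗[K] TensorAlgebra K V :=
  LinearMap.rTensor _ letter ∘ₗ comul

theorem splitFirst_one : splitFirst (1 : TensorAlgebra K V) = 0 := by
  simp [splitFirst, comul_one]

theorem splitFirst_ι_mul (v : V) (t : TensorAlgebra K V) : splitFirst (ι K v * t) = v ⊗ₜ t := by
  have h : LinearMap.rTensor _ (counit.smulRight v) ∘ₗ comul =
      TensorProduct.mk K V (TensorAlgebra K V) v := by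
    refine ext_one_ι_mul (by simp [comul_one]) fun w t _ => ?_
    have h0 : (counit.smulRight v) ∘ₗ LinearMap.mulLeft K (ι K w) = 0 := by
      ext t
      simp
    rw [LinearMap.comp_apply, comul_ι_mul, map_add, ← LinearMap.comp_apply, ← LinearMap.rTensor_comp,
      h0]
    simp
  have h1 : letter ∘ₗ LinearMap.mulLeft K (ι K v) = counit.smulRight v := by
    ext t
    simp [letter_ι_mul]
  have h2 := LinearMap.congr_fun h t
  rw [← h1, LinearMap.rTensor_comp, LinearMap.comp_assoc, LinearMap.comp_apply,
    LinearMap.comp_apply] at h2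
  rw [splitFirst, LinearMap.comp_apply, comul_ι_mul, map_add, h2]
  simp

/-- The functional `v₁⋯v_m ↦ l_i(v₁) ⋯ l_{i+m-1}(v_m)`. -/
noncomputable def prodFunctional (l : ℕ → V →ₗ[K] K) : ℕ → ℕ → TensorAlgebra K V →ₗ[K] K
  | 0, _ => counit
  | m + 1, i => conv (l i ∘ₗ letter) (prodFunctional l m (i + 1))

theorem prodFunctional_word (l : ℕ → V →ₗ[K] K) (m i : ℕ) (y : ℕ → V) (a k : ℕ) :
    prodFunctional l m i (word K y a k) =
      if k = m then ∏ j ∈ Finset.range m, l (i + j) (y (a + j)) else 0 := by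
  induction m generalizing i a k with
  | zero =>
    cases k with
    | zero => simp [prodFunctional]
    | succ k => simp [prodFunctional, word_succ]
  | succ m ih =>
    cases k with
    | zero => simp [prodFunctional, conv_one]
    | succ k =>
      rw [prodFunctional, word_succ, letter_conv_ι_mul, ih, Finset.prod_range_succ']
      simp only [add_left_inj, add_assoc, add_comm 1, add_zero]
      split_ifs <;> ring

/-- The functional `v₁⋯v_{m+2} ↦ ξ(v₁ ⊗ v₂) l_{i+2}(v₃) ⋯ l_{i+m+1}(v_{m+2})`. -/
noncomputable def wordFunctional (ξ : V ⊗[K] V →ₗ[K] K) (l : ℕ → V →ₗ[K] K) (i m : ℕ) :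
    TensorAlgebra K V →ₗ[K] K :=
  LinearMap.mul' K K ∘ₗ TensorProduct.map ξ (prodFunctional l m (i + 2)) ∘ₗ
    (TensorProduct.assoc K V V (TensorAlgebra K V)).symm.toLinearMap ∘ₗ
      LinearMap.lTensor V splitFirst ∘ₗ splitFirst

theorem wordFunctional_word (ξ : V ⊗[K] V →ₗ[K] K) (l : ℕ → V →ₗ[K] K) (i m : ℕ) (y : ℕ → V)
    (a k : ℕ) : wordFunctional ξ l i m (word K y a k) = if k = m + 2 then
      ξ (y a ⊗ₜ y (a + 1)) * ∏ j ∈ Finset.range m, l (i + 2 + j) (y (a + 2 + j)) else 0 := by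
  match k with
  | 0 => simp [wordFunctional, splitFirst_one]
  | 1 =>
    rw [word_succ, word_zero, wordFunctional]
    simp only [LinearMap.comp_apply, splitFirst_ι_mul, LinearMap.lTensor_tmul, splitFirst_one]
    simp
  | k + 2 =>
    rw [word_succ, word_succ]
    simp [wordFunctional, splitFirst_ι_mul, prodFunctional_word, add_assoc]

theorem exists_dual_family {ι' X : Type*} [DecidableEq ι'] [AddCommGroup X] [Module K X]
    {u : ι' → X} (hu : LinearIndependent K u) :
    ∃ ξ : ι' → X →ₗ[K] K, ∀ i j, ξ i (u j) = if i = j then 1 else 0 := by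
  have h : ∀ i, ∃ g : X →ₗ[K] K, g ∘ₗ (Submodule.span K (Set.range u)).subtype =
      Finsupp.lapply i ∘ₗ hu.repr := fun i => LinearMap.exists_extend _
  choose g hg using h
  refine ⟨g, fun i j => ?_⟩
  have h1 := LinearMap.congr_fun (hg i) ⟨u j, Submodule.subset_span ⟨j, rfl⟩⟩
  have h2 := hu.repr_eq_single j ⟨u j, Submodule.subset_span ⟨j, rfl⟩⟩ rfl
  simp only [LinearMap.comp_apply, Submodule.subtype_apply, h2,
    Finsupp.lapply_apply] at h1
  rw [h1, Finsupp.single_apply]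
  simp [eq_comm]

end WordFunctional

section CocyclePart

variable {K : Type*} [Field K] {A : Type*} [NonUnitalRing A] [Module K A]
  [IsScalarTower K A A] [SMulCommClass K A A] {D : DGA K A}

/-- Functionals on `H ⊗ H` and on `H` dual to the `x_i ⊗ x_{i+1}` and to the `x_i`, and supported
in the degrees of these elements. -/
theorem exists_homogeneous_dual {n : ℕ} (hn : 2 ≤ n) {p : ℕ → ℤ} {x : ℕ → D.Cohomology}
    (hx : ∀ j, x j ∈ D.grH (p j))
    (hli : LinearIndependent K fun j : Fin (n - 1) => x j ⊗ₜ[K] x (j + 1)) :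
    ∃ (ξ : ℕ → D.Cohomology ⊗[K] D.Cohomology →ₗ[K] K) (l : ℕ → D.Cohomology →ₗ[K] K),
      (∀ i j, i + 1 < n → j + 1 < n → ξ i (x j ⊗ₜ x (j + 1)) = if i = j then 1 else 0) ∧
      (∀ i < n, l i (x i) = 1) ∧
      (∀ i q r, ∀ v ∈ D.grH q, ∀ w ∈ D.grH r, ξ i (v ⊗ₜ w) ≠ 0 → q = p i ∧ r = p (i + 1)) ∧
      ∀ i q, ∀ v ∈ D.grH q, l i v ≠ 0 → q = p i := by
  obtain ⟨ξ, hξ⟩ := exists_dual_family hli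
  have hx0 : ∀ i < n, x i ≠ 0 := by
    intro i hi h0
    by_cases h : i + 1 < n
    · exact hli.ne_zero ⟨i, by omega⟩ (by simp [h0])
    · refine hli.ne_zero ⟨i - 1, by omega⟩ ?_
      have : i - 1 + 1 = i := by omega
      simp [this, h0]
  have hl : ∀ i, ∃ g : D.Cohomology →ₗ[K] K, i < n → g (x i) = 1 := by
    intro i
    by_cases hi : i < n
    · obtain ⟨g, hg⟩ := Module.Projective.exists_dual_eq_one K (hx0 i hi)
      exact ⟨g, fun _ => hg⟩
    · exact ⟨0, fun h => absurd h hi⟩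
  choose g hg using hl
  refine ⟨fun i => if h : i < n - 1 then
      ξ ⟨i, h⟩ ∘ₗ TensorProduct.map (D.projGrH (p i)) (D.projGrH (p (i + 1))) else 0,
    fun i => g i ∘ₗ D.projGrH (p i), fun i j hi hj => ?_, fun i hi => ?_,
    fun i q r v hv w hw h => ?_, fun i q v hv h => ?_⟩
  · have hi' : i < n - 1 := by omega
    simp only [hi', dif_pos, LinearMap.comp_apply, TensorProduct.map_tmul]
    by_cases h1 : p j = p i ∧ p (j + 1) = p (i + 1)
    · rw [← h1.1, ← h1.2, D.projGrH_of_mem (hx j), D.projGrH_of_mem (hx (j + 1))]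
      have := hξ ⟨i, hi'⟩ ⟨j, by omega⟩
      simpa using this
    · have hij : i ≠ j := by
        rintro rfl
        exact h1 ⟨rfl, rfl⟩
      rw [if_neg hij]
      by_cases h2 : p j = p i
      · have h3 : p (j + 1) ≠ p (i + 1) := fun h3 => h1 ⟨h2, h3⟩
        rw [D.projGrH_of_ne (hx (j + 1)) h3]
        simp
      · rw [D.projGrH_of_ne (hx j) h2]
        simp
  · rw [LinearMap.comp_apply, D.projGrH_of_mem (hx i), hg i hi]
  · by_cases hi : i < n - 1
    · simp only [hi, dif_pos, LinearMap.comp_apply, TensorProduct.map_tmul] at h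
      constructor
      · by_contra hq
        rw [D.projGrH_of_ne hv hq] at h
        simp at h
      · by_contra hr
        rw [D.projGrH_of_ne hw hr] at h
        simp at h
    · simp [hi] at h
  · by_contra hq
    rw [LinearMap.comp_apply, D.projGrH_of_ne hv hq, map_zero] at h
    exact h rfl

/-- If the `x_i ⊗ x_{i+1}` are linearly independent, then there is a cocycle-valued homogeneous map
with prescribed values on the words `x_a⋯x_{a+k-1}`, `k ≥ 2`. -/
theorem exists_cocyclePart {n : ℕ} (hn : 2 ≤ n) {p : ℕ → ℤ} {x : ℕ → D.Cohomology}
    (hx : ∀ j, x j ∈ D.grH (p j))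
    (hli : LinearIndependent K fun j : Fin (n - 1) => x j ⊗ₜ[K] x (j + 1)) {z : ℕ → ℕ → A}
    (hz : ∀ a k, 2 ≤ k → k < n → a + k ≤ n →
      D.d (z a k) = 0 ∧ z a k ∈ D.gr (∑ l ∈ Finset.range k, (p (a + l) - 1) + 1)) :
    ∃ φ : TensorAlgebra K D.Cohomology →ₗ[K] A, φ 1 = 0 ∧ (∀ h, φ (ι K h) = 0) ∧ D.d ∘ₗ φ = 0 ∧
      HasDegree (wordGr D.grH) D.gr 1 φ ∧
      ∀ a k, 2 ≤ k → k < n → a + k ≤ n → φ (word K x a k) = z a k := by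
  obtain ⟨ξ, l, hξ, hl, hξp, hlp⟩ := exists_homogeneous_dual hn hx hli
  let T : Finset (ℕ × ℕ) := {ik ∈ Finset.range n ×ˢ Finset.range n | 2 ≤ ik.2 ∧ ik.1 + ik.2 ≤ n}
  have hT : ∀ ik ∈ T, 2 ≤ ik.2 ∧ ik.2 < n ∧ ik.1 + ik.2 ≤ n := by
    intro ik hik
    simp only [T, Finset.mem_filter, Finset.mem_product, Finset.mem_range] at hik
    omega
  let φ : TensorAlgebra K D.Cohomology →ₗ[K] A := ∑ ik ∈ T,
    (wordFunctional (ξ ik.1) l ik.1 (ik.2 - 2)).smulRight (z ik.1 ik.2)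
  have hφ : ∀ t, φ t = ∑ ik ∈ T,
      wordFunctional (ξ ik.1) l ik.1 (ik.2 - 2) t • z ik.1 ik.2 := by
    intro t
    simp [φ]
  refine ⟨φ, ?_, fun h => ?_, LinearMap.ext fun t => ?_, hasDegree_word fun q y k hy => ?_,
    fun a k h2 hk hak => ?_⟩
  · rw [hφ, ← word_zero K x 0]
    refine Finset.sum_eq_zero fun ik _ => ?_
    rw [wordFunctional_word, if_neg (by omega), zero_smul]
  · rw [hφ, ← word_one K (fun _ => h) 0]
    refine Finset.sum_eq_zero fun ik _ => ?_
    rw [wordFunctional_word, if_neg (by omega), zero_smul]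
  · rw [LinearMap.comp_apply, hφ, map_sum, LinearMap.zero_apply]
    refine Finset.sum_eq_zero fun ik hik => ?_
    obtain ⟨h1, h2, h3⟩ := hT ik hik
    rw [map_smul, (hz _ _ h1 h2 h3).1, smul_zero]
  · rw [hφ]
    refine Submodule.sum_mem _ fun ik hik => ?_
    obtain ⟨h1, h2, h3⟩ := hT ik hik
    by_cases h0 : wordFunctional (ξ ik.1) l ik.1 (ik.2 - 2) (word K y 0 k) = 0
    · rw [h0, zero_smul]
      exact Submodule.zero_mem _
    · refine Submodule.smul_mem _ _ ?_
      rw [wordFunctional_word] at h0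
      by_cases hk : k = ik.2 - 2 + 2
      · rw [if_pos hk] at h0
        obtain rfl : k = ik.2 := by omega
        have hq1 := hξp _ _ _ _ (hy 0) _ (hy (0 + 1)) (left_ne_zero_of_mul h0)
        have hq2 := Finset.prod_ne_zero_iff.1 (right_ne_zero_of_mul h0)
        have hsum : ∑ j ∈ Finset.range ik.2, (q j - 1) =
            ∑ j ∈ Finset.range ik.2, (p (ik.1 + j) - 1) := by
          refine Finset.sum_congr rfl fun j hj => ?_
          rw [Finset.mem_range] at hj
          match j with
          | 0 => rw [hq1.1, add_zero]
          | 1 => rw [← hq1.2]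
          | j + 2 =>
            have := hlp _ _ _ (hy _) (hq2 j (Finset.mem_range.2 (by omega)))
            rw [show j + 2 = 0 + 2 + j by omega, this]
            congr 2
            omega
        rw [hsum]
        exact (hz _ _ h1 h2 h3).2
      · rw [if_neg hk] at h0
        exact absurd rfl h0
  · rw [hφ, Finset.sum_eq_single (a, k)]
    · rw [wordFunctional_word, if_pos (by simp; omega), hξ a a (by omega) (by omega), if_pos rfl,
        Finset.prod_eq_one, one_mul, one_smul]
      intro j hj
      rw [Finset.mem_range] at hj
      exact hl _ (by simp at hj; omega)
    · intro ik hik hne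
      obtain ⟨h1, h2, h3⟩ := hT ik hik
      rw [wordFunctional_word]
      by_cases hk : k = ik.2 - 2 + 2
      · obtain rfl : k = ik.2 := by omega
        have : ik.1 ≠ a := by
          rintro rfl
          exact hne rfl
        rw [hξ _ _ (by omega) (by omega), if_neg this]
        simp
      · rw [if_neg hk, zero_smul]
    · intro h
      refine absurd ?_ h
      simp only [T, Finset.mem_filter, Finset.mem_product, Finset.mem_range]
      omega

end CocyclePart

end BarConstruction

namespace BarConstruction

open TensorAlgebra (ι)

/-! ### From the bar construction to `A∞` structures and morphisms -/

section Unbar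

variable {K : Type*} [Field K] {A : Type*} [NonUnitalRing A] [Module K A]
  [IsScalarTower K A A] [SMulCommClass K A A] {D : DGA K A}

theorem unbar_zero {V W : Type*} [AddCommGroup V] [Module K V] [AddCommGroup W] [Module K W]
    (s : V →ₗ[K] V) {b : TensorAlgebra K V →ₗ[K] W} (hb : b 1 = 0) : unbar s b 0 = 0 := by
  ext v
  simp [unbar, hb]

theorem unbar_one {V W : Type*} [AddCommGroup V] [Module K V] [AddCommGroup W] [Module K W]
    (s : V →ₗ[K] V) (b : TensorAlgebra K V →ₗ[K] W) (v : Fin 1 → V) :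
    unbar s b 1 v = b (ι K (v 0)) := by
  simp [unbar, TensorAlgebra.tprod_apply]

theorem unbar_mem {V W : Type*} [AddCommGroup V] [Module K V] [AddCommGroup W] [Module K W]
    {gr : ℤ → Submodule K V} {gr' : ℤ → Submodule K W} {s : V →ₗ[K] V}
    (hs : ∀ p, ∀ v ∈ gr p, s v = Int.negOnePow p • v) (hss : ∀ v, s (s v) = v)
    {b : TensorAlgebra K V →ₗ[K] W} {e : ℤ} (hb : HasDegree (wordGr gr) gr' e b) {k : ℕ}
    {p : Fin k → ℤ} {x : Fin k → V} (hx : ∀ j, x j ∈ gr (p j)) :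
    unbar s b k x ∈ gr' ((∑ j, p j) + e - k) := by
  obtain ⟨p', x', hx', hpp, hxx⟩ := exists_seq_extension hx
  have h := eq_bar_word hs hx' (unbar s b) 0 k
  simp only [zero_add, hxx] at h
  rw [h, bar_unbar hss]
  refine Submodule.units_smul_mem' _ _ ?_
  have := hb.word_mem hx' 0 k
  convert this using 2
  simp only [zero_add, Finset.sum_sub_distrib, ← Fin.sum_univ_eq_sum_range p', hpp]
  simp
  ring

/-- A coderivation of square zero and a coalgebra map to the bar construction of `A` are an `A∞`
structure on the cohomology and an `A∞` morphism to `A`. -/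
theorem exists_aInfStructure {κ : ℤˣ} {f : TensorAlgebra K D.Cohomology →ₗ[K] A}
    {b : TensorAlgebra K D.Cohomology →ₗ[K] D.Cohomology} (hf1 : f 1 = 0) (hb1 : b 1 = 0)
    (hfι : ∀ h, D.Represents (f (ι K h)) h) (hbι : ∀ h, b (ι K h) = 0)
    (hfdeg : HasDegree (wordGr D.grH) D.gr 1 f) (hbdeg : HasDegree (wordGr D.grH) D.grH 2 b)
    (hbb : b ∘ₗ coDer (-D.sgnH) b = 0)
    (hbf : barA D ((κ : ℤ) : K) ∘ₗ coHom f = f ∘ₗ coDer (-D.sgnH) b) :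
    ∃ S : AInfStructure K D.grH, S.m = unbar D.sgnH b ∧ S.IsMinimal ∧ D.QuasiIsoTo κ S := by
  have hs : ∀ p, ∀ v ∈ D.grH p, D.sgnH v = Int.negOnePow p • v := fun p v hv => D.sgnH_of_mem hv
  have hss : ∀ v, D.sgnH (D.sgnH v) = v := fun v => by
    simpa using LinearMap.congr_fun (sgnH_sgnH (D := D)) v
  have hm : ∀ (k : ℕ) (p : Fin k → ℤ) (x : Fin k → D.Cohomology), 1 ≤ k →
      (∀ j, x j ∈ D.grH (p j)) → unbar D.sgnH b k x ∈ D.grH ((∑ j, p j) + 2 - k) :=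
    fun k p x _ hx => unbar_mem hs hss hbdeg hx
  have hf : ∀ (k : ℕ) (p : Fin k → ℤ) (x : Fin k → D.Cohomology), 1 ≤ k →
      (∀ j, x j ∈ D.grH (p j)) → unbar D.sgnH f k x ∈ D.gr ((∑ j, p j) + 1 - k) :=
    fun k p x _ hx => unbar_mem hs hss hfdeg hx
  have hm0 := unbar_zero D.sgnH hb1
  have hf0 := unbar_zero D.sgnH hf1
  let S : AInfStructure K D.grH :=
    { m := unbar D.sgnH b
      m_zero := hm0
      m_mem := hm
      stasheff := fun i p x _ hx => by
        have := LinearMap.congr_fun hbb (word K x 0 i)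
        rw [LinearMap.comp_apply] at this
        rw [insertionSum_eq hs _ _ hm0 hm i hx, bar_unbar hss, this, LinearMap.zero_apply,
          smul_zero] }
  let F : AInfHom S (D.toAInf κ) :=
    { f := unbar D.sgnH f
      f_zero := hf0
      f_mem := hf
      map_eq := fun i p x hi hx => by
        change insertionSum (unbar D.sgnH f) (unbar D.sgnH b) i p x =
          compositionSum (D.ops κ) (unbar D.sgnH f) i p x
        have := LinearMap.congr_fun hbf (word K x 0 i)
        rw [barA_comp_coHom D _ hf1, LinearMap.smul_apply, ← units_smul_eq] at this
        rw [insertionSum_eq hs _ _ hm0 hm i hx, compositionSum_eq D hs κ _ hf0 hf hi hx,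
          bar_unbar hss, bar_unbar hss, ← LinearMap.comp_apply, ← this]
        rfl }
  refine ⟨S, rfl, ?_, F, fun h => ?_⟩
  · refine MultilinearMap.ext fun v => ?_
    change unbar D.sgnH b 1 v = 0
    rw [unbar_one, hbι]
  · change D.Represents (unbar D.sgnH f 1 _) h
    rw [unbar_one]
    exact hfι h

end Unbar

/-! ### Minimal models which recover a Massey product -/

section Recover

variable {K : Type*} [Field K] {A : Type*} [NonUnitalRing A] [Module K A]
  [IsScalarTower K A A] [SMulCommClass K A A] {D : DGA K A}

/-- A coderivation whose corestriction vanishes on the proper subwords of a word only acts on this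
word by its corestriction. -/
theorem coDer_word_of_subwords {V : Type*} [AddCommGroup V] [Module K V] (σ : V →ₗ[K] V)
    {b : TensorAlgebra K V →ₗ[K] V} (hb1 : b 1 = 0) (x : ℕ → V) (a k : ℕ)
    (h : ∀ i j, j < k → a ≤ i → i + j ≤ a + k → b (word K x i j) = 0) :
    coDer σ b (word K x a k) = ι K (b (word K x a k)) := by
  rw [coDer_word _ _ hb1, Finset.sum_range_succ', Finset.sum_eq_zero, zero_add, word_zero, one_mul,
    add_zero, Nat.sub_zero, conv_word, Finset.sum_range_succ, Finset.sum_eq_zero, zero_add,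
    Nat.sub_self, word_zero]
  · simp
  · intro s hs
    rw [Finset.mem_range] at hs
    rw [LinearMap.comp_apply, h a s hs le_rfl (by omega), map_zero, zero_mul]
  · intro r hr
    rw [Finset.mem_range] at hr
    rw [conv_word, Finset.sum_eq_zero, mul_zero]
    intro s hs
    rw [Finset.mem_range] at hs
    rw [LinearMap.comp_apply, h _ s (by omega) (by omega) (by omega), map_zero, zero_mul]

/-- The values of a solution of the equations `b = π U`, `f = f₁ - c h U + φ` on words formed from
classes with a defining system, when `φ` has the appropriate values. -/
theorem solution_word {c : K} (hc : c * c = 1) {φ f : TensorAlgebra K D.Cohomology →ₗ[K] A}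
    {b : TensorAlgebra K D.Cohomology →ₗ[K] D.Cohomology}
    (hf1 : f 1 = 0) (hb1 : b 1 = 0) (hfι : ∀ h, f (ι K h) = D.ofCoh h) (hbι : ∀ h, b (ι K h) = 0)
    (hb : b = D.toCoh ∘ₗ obstruction D c f b)
    (hf : f = D.ofCoh ∘ₗ letter - c • (D.homotopy D.ofCoh ∘ₗ obstruction D c f b) + φ)
    {n : ℕ} (hn : 2 ≤ n) {p : Fin n → ℤ} {x : Fin n → D.Cohomology} {a : ℕ → ℕ → A}
    (ha : D.IsDefiningSystem p x a) {x' : ℕ → D.Cohomology} (hx' : ∀ j : Fin n, x' j = x j)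
    (ha1 : ∀ i : Fin n, a i (i + 1) = D.ofCoh (x i))
    (hφ : ∀ i k, 2 ≤ k → k < n → i + k ≤ n →
      φ (word K x' i k) = a i (i + k) - D.prim (D.d (a i (i + k)))) :
    b (word K x' 0 n) = -(c • D.toCoh (DGA.sysSum p a 0 n)) := by
  -- the obstruction on a word, provided that the claim holds on its proper subwords
  have hU : ∀ i k, i + k ≤ n →
      (∀ j l, 1 ≤ l → l < k → i ≤ j → j + l ≤ i + k → f (word K x' j l) = a j (j + l)) →
      (∀ j l, l < k → i ≤ j → j + l ≤ i + k → b (word K x' j l) = 0) →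
      obstruction D c f b (word K x' i k) = -(c • DGA.sysSum p a i (i + k)) := by
    intro i k hik h1 h2
    have h3 : (f ∘ₗ trunc) (coDer (-D.sgnH) b (word K x' i k)) = 0 := by
      rw [coDer_word_of_subwords _ hb1 x' i k h2, LinearMap.comp_apply, trunc_ι, map_zero]
    rw [obstruction, LinearMap.sub_apply, LinearMap.smul_apply,
      LinearMap.comp_apply _ (coDer (-D.sgnH) b), h3, sub_zero, DGA.sysSum_eq ha.mem hik, smul_neg,
      neg_neg, conv_word]
    congr 1
    have hsub : Finset.Ioo 0 k ⊆ Finset.range (k + 1) := fun s hs => by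
      simp at hs ⊢
      omega
    rw [← Finset.sum_subset hsub]
    · refine Finset.sum_bij (fun s _ => i + s) (fun s hs => ?_) (fun s _ t _ h => by omega)
        (fun m hm => ?_) (fun s hs => ?_)
      · simp at hs ⊢
        omega
      · rw [Finset.mem_Ioo] at hm
        exact ⟨m - i, by simp; omega, by omega⟩
      · rw [Finset.mem_Ioo] at hs
        rw [LinearMap.comp_apply, h1 i s (by omega) (by omega) le_rfl (by omega),
          h1 (i + s) (k - s) (by omega) (by omega) (by omega) (by omega),
          show i + s + (k - s) = i + k by omega]
    · intro s hs hs'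
      obtain rfl | rfl : s = 0 ∨ s = k := by
        simp at hs hs'
        omega
      · simp [hf1]
      · simp [hf1]
  have key : ∀ k < n, ∀ i, i + k ≤ n →
      b (word K x' i k) = 0 ∧ (1 ≤ k → f (word K x' i k) = a i (i + k)) := by
    intro k
    induction k using Nat.strong_induction_on with
    | _ k ih =>
      intro hk i hik
      match k with
      | 0 => simp [hb1]
      | 1 =>
        rw [word_one, hbι, hfι, hx' ⟨i, by omega⟩]
        exact ⟨rfl, fun _ => (ha1 ⟨i, by omega⟩).symm⟩
      | k + 2 =>
        have hUk := hU i (k + 2) hik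
          (fun j l hl hlk hj hjl => (ih l hlk (by omega) j (by omega)).2 hl)
          (fun j l hlk hj hjl => (ih l hlk (by omega) j (by omega)).1)
        rw [← ha.d_eq i (i + (k + 2)) hik (by omega) (by omega)] at hUk
        constructor
        · rw [hb, LinearMap.comp_apply, hUk, map_neg, map_smul, D.toCoh_d, smul_zero, neg_zero]
        · intro _
          have hl : letter (word K x' i (k + 2)) = 0 := by
            rw [word_succ, letter_ι_mul, word_succ, counit_ι_mul, zero_smul]
          rw [hf, LinearMap.add_apply, LinearMap.sub_apply, LinearMap.smul_apply,
            LinearMap.comp_apply, LinearMap.comp_apply, hUk, hl, hφ i _ (by omega) hk hik, map_neg,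
            map_smul, D.homotopy_d, map_zero, smul_neg, smul_smul, hc, one_smul]
          abel
  have hUn := hU 0 n (by omega) (fun j l hl hlk _ hjl => (key l hlk j (by omega)).2 hl)
    (fun j l hlk _ hjl => (key l hlk j (by omega)).1)
  rw [zero_add] at hUn
  rw [hb, LinearMap.comp_apply, hUn, map_neg, map_smul]

/-- When the `x_i ⊗ x_{i+1}` are linearly independent, a defining system can be prescribed as the
values of an `A∞` morphism on the proper subwords of `x₁⋯xₙ`; the resulting operations recover its
Massey product. -/
theorem exists_minimalModel {κ : ℤˣ} {n : ℕ} (hn : 2 ≤ n) {p : Fin n → ℤ}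
    {x : Fin n → D.Cohomology} (hx : ∀ j, x j ∈ D.grH (p j)) {y : D.Cohomology}
    (hy : y ∈ D.masseyProduct p x)
    (hli : LinearIndependent K (fun j : Fin (n - 1) =>
      x ⟨j, by omega⟩ ⊗ₜ[K] x ⟨j + 1, by omega⟩)) :
    ∃ S : AInfStructure K D.grH, S.IsMinimal ∧ D.QuasiIsoTo κ S ∧
      (S.m n x = y ∨ -S.m n x = y) := by
  have hs : ∀ p, ∀ v ∈ D.grH p, D.sgnH v = Int.negOnePow p • v := fun p v hv => D.sgnH_of_mem hv
  have hss : ∀ v, D.sgnH (D.sgnH v) = v := fun v => by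
    simpa using LinearMap.congr_fun (sgnH_sgnH (D := D)) v
  have hκ : ((κ : ℤ) : K) * ((κ : ℤ) : K) = 1 := by
    rcases Int.units_eq_one_or κ with h | h <;> simp [h]
  obtain ⟨p', x', hx', hpp, hxx⟩ := exists_seq_extension hx
  obtain ⟨a, ha, hay, ha1⟩ := DGA.exists_isDefiningSystem hn hy
    (fun i => D.represents_ofCoh (x i)) (fun i => D.ofCoh_mem (hx i))
  have hli' : LinearIndependent K fun j : Fin (n - 1) => x' j ⊗ₜ[K] x' (j + 1) := by
    convert hli using 3 with j
    · exact hxx ⟨j, by omega⟩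
    · exact hxx ⟨j + 1, by omega⟩
  obtain ⟨φ, hφ1, hφι, hdφ, hφdeg, hφ⟩ := exists_cocyclePart hn hx' hli'
    (z := fun i k => a i (i + k) - D.prim (D.d (a i (i + k)))) fun i k h2 hk hik => by
      refine ⟨by rw [map_sub, D.d_prim_d, sub_self], ?_⟩
      rw [← DGA.sysDeg_eq hpp i k hik]
      have hmem := ha.mem i (i + k) (by omega) hik (by omega)
      refine Submodule.sub_mem _ hmem ?_
      have := D.prim_mem (D.d_mem hmem)
      rwa [add_neg_cancel_right] at this
  obtain ⟨f, b, hf1, hb1, hfι, hbι, hfdeg, hbdeg, hb, hf⟩ :=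
    exists_solution ((κ : ℤ) : K) hφ1 hφι hφdeg
  obtain ⟨hbb, hbf⟩ := solution_spec hκ hdφ hf1 hb1 hfι hbι hfdeg hbdeg hb hf
  obtain ⟨S, hSm, hmin, hqi⟩ := exists_aInfStructure hf1 hb1
    (fun h => by rw [hfι]; exact D.represents_ofCoh h) hbι hfdeg hbdeg hbb hbf
  have hval := solution_word hκ hf1 hb1 hfι hbι hb hf hn ha hxx ha1 hφ
  rw [hay.toCoh_eq] at hval
  have hSn : S.m n x = Int.negOnePow (suspExp p' 0 n) • -(((κ : ℤ) : K) • y) := by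
    have h := eq_bar_word hs hx' (unbar D.sgnH b) 0 n
    simp only [zero_add, hxx] at h
    rw [hSm, h, bar_unbar hss, hval]
  refine ⟨S, hmin, hqi, ?_⟩
  rw [hSn]
  rcases Int.units_eq_one_or κ with h | h <;>
    rcases Int.units_eq_one_or (Int.negOnePow (suspExp p' 0 n)) with h' | h' <;> simp [h, h']

end Recover

end BarConstruction

theorem theorem2p1 {K : Type*} [Field K] {A : Type*} [NonUnitalRing A] [Module K A]
    [IsScalarTower K A A] [SMulCommClass K A A] (D : DGA K A) (κ : ℤˣ)
    (n : ℕ) (hn : 3 ≤ n) (p : Fin n → ℤ) (x : Fin n → D.Cohomology)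
    (hx : ∀ j, x j ∈ D.grH (p j)) (y : D.Cohomology) (hy : y ∈ D.masseyProduct p x) :
    (LinearIndependent K (fun j : Fin (n - 1) =>
        x ⟨j, by omega⟩ ⊗ₜ[K] x ⟨j + 1, by omega⟩) →
      ∃ S : AInfStructure K D.grH, S.IsMinimal ∧ D.QuasiIsoTo κ S ∧
        (S.m n x = y ∨ -S.m n x = y)) ∧
    (∀ S : AInfStructure K D.grH, S.IsMinimal → D.QuasiIsoTo κ S →
      ∃ Γ ∈ ⨆ j ∈ Finset.Icc 1 (n - 1), Submodule.span K (Set.range (S.m j)),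
        -(κ * Int.negOnePow (∑ j : Fin n, ((n : ℤ) - 1 - j) * p j)) • S.m n x = y + Γ) := by
  exact ⟨fun h => BarConstruction.exists_minimalModel (by omega) hx hy h,
    fun S hS hqi => BarConstruction.minimalModel_eq_massey (by omega) hx hy hS hqi⟩
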